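/- **Model.** Let $G$ be the infinite triangular grid graph. A *particle* occupies one node (contracted) or two adjacent nodes (expanded) of $G$; every node is occupied by at most one particle. A particle has a state from a finite set $Q$, holds a flag from a finite alphabet on each incident edge, and labels its incident edges counter-clockwise by $0,1,\dots$ ($6$ labels if contracted, $10$ if expanded), where the edge labelled $0$ leads to a node adjacent to only one of the occupied nodes and keeps a fixed direction, the *orientation* of the particle, throughout. An *algorithm* is a transition function that maps a state and the tuple of flags read via the labelled edges (a reserved symbol $\varepsilon$, which no particle can set, signals a missing edge or an unoccupied node) to a set of *turns*; a turn consists of a new state, new flags, and one of the movements idle, expand$_i$, contract$_i$, handoverContract$_i$. A contracted particle may expand into an unoccupied adjacent node; an expanded particle may contract out of one of its two nodes; in a *handover* one particle contracts out of a node while a contracted neighbor expands into it (handoverContract can be executed only in this way). An *action* is one isolated turn of a particle or the two turns of a handover. One enabled action at a time is executed, in an arbitrary order, as long as there is an enabled action, subject to the fairness condition that any set of consecutive configurations in which a given particle could be affected by an enabled action, but is not, is finite. **Problem.** A *valid object* is a set $C$ of nodes that induces a connected subgraph and whose complement induces a 2-connected subgraph; its surface (the nodes outside $C$ that are adjacent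 to $C$) is assumed to be infinite. The nodes of $C$ are occupied by contracted object particles of arbitrary orientation, which never act and show a fixed flag (or one fixed flag per label). An *initial configuration* with $n$ particles is a connected configuration consisting of a valid object and $n$ contracted non-object particles with arbitrary orientations, all in the initial (inactive) state with the initial flags. An algorithm *solves the Infinite Object Coating problem* if every fair execution from every initial configuration stays connected, reaches a configuration in which the transition function of every particle maps to the empty set (termination), and then all particles are contracted and adjacent to the object. The *work* of an execution is the number of expansions and contractions until termination, a handover counting as two and idle movements as none. The *worst-case work* for $n$ particles is the supremum of the work over all fair executions from initial configurations with $n$ particles. **Coating algorithm.** Particles are in phase inactive, follow or lead and show their phase, their shape and the edge label in all flags. The node last expanded into is the *head* of an expanded particle, the other one its *tail*; particles contract only out of their tails. A follower stores the direction $d$ of an edge at its head and shows a follow indicator on that edge. Every movement, and every change of phase, resets the flags so that they contain no complaint indicator. The first rule below that applies is executed; if none applies, there is no turn. - *Inactive:* if adjacent to the object, become a leader; otherwise, if an adjacent node is occupied by a leader or follower, let $d$ point to (any) such node and become a follower. - *Contracted follower:* if adjacent to the object, become a leader; otherwise, if the node in direction $d$ is occupied by an expanded particle $p'$, attempt to expand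 in direction $d$ (by a handover) and set $d$ to the contraction direction of $p'$. - *Expanded follower or leader:* if a follow indicator of a contracted neighbor is read over a tail edge, execute a handover contraction; otherwise, if no follow indicator is read over a tail edge and there is no inactive neighbor, contract. The direction $d$ is kept. - *Contracted leader:* let $s$ be the first direction not leading to the object that is met when turning clockwise from a direction that leads to the object. If no follow indicator and no complaint indicator is read, do nothing. Otherwise, if the node in direction $s$ is unoccupied or is the tail of an expanded particle, attempt to expand in direction $s$ (by a handover in the second case); if it is neither, show a complaint indicator on the edge in direction $s$ and stay idle. **Theorem.** For every way of resolving the arbitrary choices in its rules, the coating algorithm solves the Infinite Object Coating problem, and its worst-case work is $\Theta(n^2)$, with constants independent of these choices. This is optimal: there is a constant $c>0$ such that every algorithm that solves the Infinite Object Coating problem has worst-case work at least $c\,n^2$ for all $n\ge 2$. -/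

import Mathlib

namespace Amoebot

/-! ### The equilateral triangular graph -/

/-- Nodes of the triangular grid, in the basis of two unit vectors at an angle of 60 degrees. -/
abbrev Node := ℤ × ℤ

/-- The six directions of edges, numbered counter-clockwise in steps of 60 degrees. -/
abbrev Dir := Fin 6

/-- The unit vector of a direction. -/
def dir : Dir → Node := ![(1, 0), (0, 1), (-1, 1), (-1, 0), (0, -1), (1, -1)]

theorem dir_opp : ∀ k : Dir, dir (k + 3) = -dir k := by decide

theorem dir_ne_zero : ∀ k : Dir, dir k ≠ 0 := by decide

/-- The equilateral triangular graph. -/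
def Geqt : SimpleGraph Node where
  Adj u v := ∃ k : Dir, v = u + dir k
  symm := ⟨by
    rintro u v ⟨k, rfl⟩
    exact ⟨k + 3, by rw [dir_opp]; abel⟩⟩
  loopless := ⟨by
    rintro u ⟨k, hk⟩
    exact dir_ne_zero k (by simpa using hk.symm)⟩

/-- `S` induces a connected subgraph of the triangular grid. -/
def ConnectedSet (S : Set Node) : Prop := (Geqt.induce S).Connected

/-- `S` induces a 2-connected subgraph: at least three nodes, connected, and still connected
after the removal of any single node. -/
def TwoConnectedSet (S : Set Node) : Prop :=
  2 < S.encard ∧ ConnectedSet S ∧ ∀ v ∈ S, ConnectedSet (S \ {v})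

/-- A valid object: it induces a connected and compact subgraph, compact meaning that the
complement is 2-connected. -/
def ValidObject (C : Set Node) : Prop := ConnectedSet C ∧ TwoConnectedSet Cᶜ

/-- The surface of an object: the nodes outside the object that are adjacent to it. -/
def surface (C : Set Node) : Set Node := {v | v ∉ C ∧ ∃ w ∈ C, Geqt.Adj v w}

/-! ### Local edge labels -/

/-- The ten edges of an expanded particle in counter-clockwise order, where `a` is the direction
from its first node (`false`) to its second node (`true`).  An edge is given by the node of the
particle that it is incident to and by its direction. -/
def ring (a : Dir) : Fin 10 → Bool × Dir :=
  ![(false, a + 1), (false, a + 2), (false, a + 3), (false, a + 4), (false, a + 5),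
    (true, a + 4), (true, a + 5), (true, a), (true, a + 1), (true, a + 2)]

/-- The position in `ring a` of the edge that has direction `0` and leads to a node adjacent to
only one of the two occupied nodes. -/
def ringStart : Dir → Fin 10 := ![7, 6, 3, 2, 1, 8]

/-- The edge with a given label, for a particle of orientation `0`.  The shape is `none` for a
contracted particle and `some a` for an expanded one with direction `a` from its first to its
second node.  The single node of a contracted particle counts as the second node. -/
def labelEdge : Option Dir → Fin 10 → Option (Bool × Dir)
  | none, i => if h : i.val < 6 then some (true, ⟨i.val, h⟩) else none
  | some a, i => some (ring a (ringStart a + i))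

/-- The edge labelled `0` has direction `0` and leads to a node that is adjacent to only one of
the two nodes `0` and `dir a` of an expanded particle; this determines it. -/
theorem labelEdge_zero : ∀ a : Dir, ∀ e : Bool × Dir,
    labelEdge (some a) 0 = some e ↔
      (e.2 = 0 ∧ e ≠ (false, a) ∧ e ≠ (true, a + 3) ∧
        (∀ k : Dir, (if e.1 then dir a else 0) + dir e.2 ≠ (if e.1 then 0 else dir a) + dir k)) := by
  decide

/-- The label of a direction at a contracted particle of orientation `0`. -/
def dirLabel (k : Dir) : Fin 10 := ⟨k.val, by omega⟩

/-! ### Algorithms -/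

/-- Movements. -/
inductive Move where
  | idle
  | expand (i : Fin 10)
  | contract (i : Fin 10)
  | handoverContract (i : Fin 10)

/-- A turn: a state to assume, flags to set, and a movement to execute. -/
structure Turn (Q Flag : Type) where
  state : Q
  flags : Fin 10 → Flag
  move : Move

/-- An algorithm: finite sets of states and of flags, a transition function, the initial
(inactive) state and flags of a particle, and the flags shown by object particles.
The reserved letter of the alphabet that signals a missing edge or an unoccupied node, and that
no particle can set, is the value `none` of `Option Flag`. -/
structure Algorithm where
  Q : Type
  Flag : Type
  finiteQ : Finite Q
  finiteFlag : Finite Flag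
  δ : Q → (Fin 10 → Option Flag) → Set (Turn Q Flag)
  initState : Q
  initFlags : Fin 10 → Flag
  objFlags : Fin 10 → Flag

/-! ### Configurations -/

/-- The configuration of a non-object particle: state, flags, occupied nodes and orientation.
If `ext = none`, the particle is contracted and occupies `tail`; if `ext = some a`, it is expanded
and occupies `tail` and `tail + dir a`. -/
structure Particle (A : Algorithm) where
  state : A.Q
  flags : Fin 10 → A.Flag
  tail : Node
  ext : Option Dir
  orient : Dir

namespace Particle

variable {A : Algorithm}

/-- The second occupied node, or the only one. -/
def head (p : Particle A) : Node :=
  match p.ext with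
  | none => p.tail
  | some a => p.tail + dir a

def nodes (p : Particle A) : Set Node := {p.tail, p.head}

/-- The edge with a given label, as occupied endpoint and direction. -/
def edge (p : Particle A) (i : Fin 10) : Option (Node × Dir) :=
  (labelEdge (p.ext.map (fun a => a - p.orient)) i).map
    (fun e => (if e.1 then p.head else p.tail, e.2 + p.orient))

/-- Assume the state and set the flags of a turn. -/
def assume (p : Particle A) (t : Turn A.Q A.Flag) : Particle A :=
  { p with state := t.state, flags := t.flags }

/-- The label `i` is the one of direction `k` at the contracted particle `p`. -/
def ExpandsAlong (p : Particle A) (i : Fin 10) (k : Dir) : Prop :=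
  p.ext = none ∧ p.edge i = some (p.tail, k)

/-- A contraction of the expanded particle `p` in the direction of the edge `i` keeps the node
`u` and leaves the node `v`. -/
def ContractsTo (p : Particle A) (i : Fin 10) (u v : Node) : Prop :=
  ∃ a, p.ext = some a ∧
    ((p.edge i = some (p.head, a) ∧ u = p.head ∧ v = p.tail) ∨
      (p.edge i = some (p.tail, a + 3) ∧ u = p.tail ∧ v = p.head))

end Particle

/-- A configuration of an object and `n` non-object particles.  Object particles are contracted
and never act or change, so they are given by their nodes and orientations. -/
structure Config (A : Algorithm) (n : ℕ) where
  obj : Set Node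
  objOrient : Node → Dir
  part : Fin n → Particle A

namespace Config

variable {A : Algorithm} {n : ℕ}

/-- All occupied nodes, the object included. -/
def occupied (c : Config A n) : Set Node := c.obj ∪ ⋃ p, (c.part p).nodes

/-- Every node is occupied by at most one particle. -/
def Disjointed (c : Config A n) : Prop :=
  (∀ p, Disjoint (c.part p).nodes c.obj) ∧
    ∀ p q, p ≠ q → Disjoint (c.part p).nodes (c.part q).nodes

/-- The connectivity graph of the configuration is connected. -/
def IsConnected (c : Config A n) : Prop := ConnectedSet c.occupied

open Classical in
/-- The flag held for the edge that leaves the node `w` in direction `k`, by the particle or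
object particle that occupies `w`; it is `none` if `w` is unoccupied. -/
noncomputable def flagAt (c : Config A n) (w : Node) (k : Dir) : Option A.Flag :=
  if h : ∃ x : Fin n × Fin 10, (c.part x.1).edge x.2 = some (w, k) then
    some ((c.part h.choose.1).flags h.choose.2)
  else if w ∈ c.obj then some (A.objFlags (dirLabel (k - c.objOrient w)))
  else none

/-- The flag that the particle `p` reads via its edge labelled `i`. -/
noncomputable def read (c : Config A n) (p : Fin n) (i : Fin 10) : Option A.Flag :=
  ((c.part p).edge i).bind (fun e => c.flagAt (e.1 + dir e.2) (e.2 + 3))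

/-- The turns that the transition function specifies for `p`. -/
def turns (c : Config A n) (p : Fin n) : Set (Turn A.Q A.Flag) :=
  A.δ (c.part p).state (c.read p)

/-- Replace the configuration of one particle. -/
def update (c : Config A n) (p : Fin n) (x : Particle A) : Config A n :=
  { c with part := Function.update c.part p x }

/-- The transition function of each particle maps to the empty set. -/
def Terminated (c : Config A n) : Prop := ∀ p, c.turns p = ∅

/-- The particle lies on the surface of the object. -/
def OnSurface (c : Config A n) (p : Fin n) : Prop :=
  ∃ v ∈ (c.part p).nodes, ∃ w ∈ c.obj, Geqt.Adj v w

/-- A connected configuration of a valid object with infinite surface and of contracted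
particles. -/
structure Admissible (c : Config A n) : Prop where
  valid : ValidObject c.obj
  infinite : (surface c.obj).Infinite
  disjointed : c.Disjointed
  connected : c.IsConnected
  contracted : ∀ p, (c.part p).ext = none

/-- Initial configurations of infinite object coating: all particles are in the initial (inactive)
state; orientations are arbitrary. -/
structure Initial (c : Config A n) : Prop extends Admissible c where
  state : ∀ p, (c.part p).state = A.initState
  flags : ∀ p, (c.part p).flags = A.initFlags

/-- Goal configurations of infinite object coating: all particles lie on the surface. -/
structure Goal (c : Config A n) : Prop extends Admissible c where
  onSurface : ∀ p, c.OnSurface p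

end Config

/-! ### Actions and executions -/

/-- Kinds of actions: an isolated idle turn, an isolated expansion or contraction, and a handover
in which the first particle contracts and the second one expands. -/
inductive Action (n : ℕ) where
  | idle (p : Fin n)
  | single (p : Fin n)
  | handover (p q : Fin n)

namespace Action

/-- The particles affected by an action. -/
def affects {n : ℕ} : Action n → Set (Fin n)
  | idle p => {p}
  | single p => {p}
  | handover p q => {p, q}

/-- The number of movements (expansions and contractions); a handover counts as two. -/
def movements {n : ℕ} : Action n → ℕ
  | idle _ => 0
  | single _ => 1
  | handover _ _ => 2

end Action

/-- `Step c a c'`: the action `a` is enabled in `c` and its execution can result in `c'`. -/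
inductive Step {A : Algorithm} {n : ℕ} (c : Config A n) : Action n → Config A n → Prop
  | idle (p : Fin n) (t : Turn A.Q A.Flag) (ht : t ∈ c.turns p) (hm : t.move = Move.idle) :
      Step c (Action.idle p) (c.update p ((c.part p).assume t))
  | expand (p : Fin n) (t : Turn A.Q A.Flag) (i : Fin 10) (k : Dir) (ht : t ∈ c.turns p)
      (hm : t.move = Move.expand i) (he : (c.part p).ExpandsAlong i k)
      (hfree : (c.part p).tail + dir k ∉ c.occupied) :
      Step c (Action.single p) (c.update p { (c.part p).assume t with ext := some k })
  | contract (p : Fin n) (t : Turn A.Q A.Flag) (i : Fin 10) (u v : Node) (ht : t ∈ c.turns p)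
      (hm : t.move = Move.contract i) (hc : (c.part p).ContractsTo i u v) :
      Step c (Action.single p) (c.update p { (c.part p).assume t with tail := u, ext := none })
  | handover (p q : Fin n) (hpq : p ≠ q) (t s : Turn A.Q A.Flag) (i j : Fin 10) (u : Node)
      (k : Dir) (ht : t ∈ c.turns p) (hs : s ∈ c.turns q)
      (hmt : t.move = Move.contract i ∨ t.move = Move.handoverContract i)
      (hms : s.move = Move.expand j) (he : (c.part q).ExpandsAlong j k)
      (hc : (c.part p).ContractsTo i u ((c.part q).tail + dir k)) :
      Step c (Action.handover p q)
        ((c.update p { (c.part p).assume t with tail := u, ext := none }).update q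
          { (c.part q).assume s with ext := some k })

/-- An execution: actions are executed as long as there is an enabled one; afterwards the
configuration is repeated forever. -/
structure Execution (A : Algorithm) (n : ℕ) where
  conf : ℕ → Config A n
  act : ℕ → Option (Action n)
  step : ∀ t a, act t = some a → Step (conf t) a (conf (t + 1))
  halt : ∀ t, act t = none → (∀ a c', ¬ Step (conf t) a c') ∧ conf (t + 1) = conf t

namespace Execution

variable {A : Algorithm} {n : ℕ}

/-- Fairness: any set of consecutive configurations in which a particle could be affected by an
enabled action, but is not, is finite. -/
def Fair (e : Execution A n) : Prop :=
  ∀ p t, ∃ t' ≥ t, (∃ a, e.act t' = some a ∧ p ∈ a.affects) ∨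
    ¬ ∃ a c', Step (e.conf t') a c' ∧ p ∈ a.affects

/-- The fair executions that start in an initial configuration. -/
def Proper (e : Execution A n) : Prop := e.Fair ∧ (e.conf 0).Initial

/-- The number of movements of an execution.  No action is enabled after termination, so this is
the number of movements until termination. -/
noncomputable def work (e : Execution A n) : ℕ∞ :=
  ⨆ T : ℕ, ((∑ t ∈ Finset.range T, (e.act t).elim 0 Action.movements : ℕ) : ℕ∞)

end Execution

/-- The algorithm solves the infinite object coating problem. -/
def Solves (A : Algorithm) : Prop :=
  ∀ (n : ℕ) (e : Execution A n), e.Proper →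
    (∀ t, (e.conf t).IsConnected) ∧ (∃ t, (e.conf t).Terminated) ∧
      ∀ t, (e.conf t).Terminated → (e.conf t).Goal

/-- The worst-case work for `n` particles. -/
noncomputable def worstCaseWork (A : Algorithm) (n : ℕ) : ℕ∞ :=
  ⨆ (e : Execution A n) (_ : e.Proper), e.work

/-! ### The coating algorithm -/

namespace Coating

inductive Phase where
  | inactive
  | follow
  | lead
  deriving DecidableEq

instance : Fintype Phase :=
  ⟨{Phase.inactive, Phase.follow, Phase.lead}, by intro x; cases x <;> simp⟩

/-- States.  All directions are relative to the orientation of the particle.  The shape is `none`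
if the particle is contracted, and the direction from tail to head if it is expanded (which
determines the head labels and the contraction labels).  The value `d` is the direction of the
edge at the head via which a follower follows; it is irrelevant in other phases. -/
structure State where
  phase : Phase
  shape : Option Dir
  d : Dir
  deriving DecidableEq, Fintype

/-- Flags: the flag of object particles, and the flags of other particles, which contain the
phase, the shape and the label of the edge, and possibly a follow indicator and a complaint
indicator. -/
inductive Flag where
  | object
  | agent (phase : Phase) (shape : Option Dir) (label : Fin 10) (follow complaint : Bool)
  deriving DecidableEq, Fintype

namespace Flag

/-- Set by a leader or a follower. -/
def Active : Flag → Prop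
  | object => False
  | agent ph _ _ _ _ => ph ≠ Phase.inactive

def Inactive : Flag → Prop
  | object => False
  | agent ph _ _ _ _ => ph = Phase.inactive

def Follow : Flag → Prop
  | object => False
  | agent _ _ _ f _ => f = true

def Complaint : Flag → Prop
  | object => False
  | agent _ _ _ _ c => c = true

/-- Set by a contracted particle. -/
def Contracted : Flag → Prop
  | object => False
  | agent _ sh _ _ _ => sh = none

/-- Set by an expanded particle for an edge at its tail. -/
def ExpandedTail : Flag → Prop
  | object => False
  | agent _ sh i _ _ => sh ≠ none ∧ ∃ k, labelEdge sh i = some (false, k)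

/-- For a flag that is read via an edge of local direction `d`: the contraction direction (from
tail to head) of the expanded particle that set the flag, translated into the local directions of
the reader.  The edge has direction `e.2` for the particle that set the flag, and this is the
direction `d + 3` for the reader. -/
def contractionDir (d : Dir) : Flag → Option Dir
  | object => none
  | agent _ sh i _ _ => sh.bind fun a => (labelEdge sh i).map fun e => a + (d + 3 - e.2)

end Flag

/-- What a particle reads. -/
abbrev Reading := Fin 10 → Option Flag

/-- Some edge satisfying `P` carries a flag satisfying `F`. -/
def Sees (r : Reading) (P : Fin 10 → Prop) (F : Flag → Prop) : Prop :=
  ∃ i, P i ∧ ∃ f, r i = some f ∧ F f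

/-- The tail edges of a particle of a given shape. -/
def TailLabel (sh : Option Dir) (i : Fin 10) : Prop := ∃ k, labelEdge sh i = some (false, k)

/-- The flags of a particle in a given state that sends a complaint indicator in the direction
`comp`, if there is one.  A follower includes a follow indicator for the head edge of direction
`d`. -/
def mkFlags (s : State) (comp : Option Dir) (i : Fin 10) : Flag :=
  Flag.agent s.phase s.shape i
    (decide (s.phase = Phase.follow ∧ labelEdge s.shape i = some (true, s.d)))
    (decide (∃ k, comp = some k ∧ labelEdge s.shape i = some (true, k)))

/-- The turn that assumes the state `s` with its flags. -/
def mkTurn (s : State) (comp : Option Dir) (m : Move) : Turn State Flag :=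
  ⟨s, mkFlags s comp, m⟩

/-- The label at the head in the direction from tail to head. -/
def headContractLabel (a : Dir) : Fin 10 := 7 - ringStart a

theorem labelEdge_headContractLabel : ∀ a : Dir,
    labelEdge (some a) (headContractLabel a) = some (true, a) := by decide

/-- The direction of the edge with a given label at a contracted particle. -/
def labelDir (i : Fin 10) : Dir := Fin.ofNat 6 i.val

open Classical in
/-- Decrease the direction `i` until it does not lead to the object (at most `m` times). -/
noncomputable def skipObject (r : Reading) : ℕ → Dir → Dir
  | 0, i => i
  | m + 1, i => if r (dirLabel i) = some Flag.object then skipObject r m (i - 1) else i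

open Classical in
/-- The direction in which a contracted particle on the surface travels along the surface,
starting the search from some edge connected to the object. -/
noncomputable def surfaceDir (pick : Finset (Fin 10) → Fin 10) (r : Reading) : Dir :=
  skipObject r 6 (labelDir (pick {i | r i = some Flag.object}))

open Classical in
/-- An inactive particle. -/
noncomputable def inactiveTurn (pick : Finset (Fin 10) → Fin 10) (s : State) (r : Reading) :
    Option (Turn State Flag) :=
  if Sees r (fun _ => True) (· = Flag.object) then
    some (mkTurn { s with phase := Phase.lead } none Move.idle)
  else if Sees r (fun _ => True) Flag.Active then
    some (mkTurn { s with
      phase := Phase.follow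
      d := labelDir (pick {i | ∃ f, r i = some f ∧ f.Active}) } none Move.idle)
  else none

open Classical in
/-- An expanded follower or leader, with direction `a` from tail to head: it contracts out of its
tail, in a handover if a contracted neighbor follows via a tail edge. -/
noncomputable def expandedTurn (s : State) (a : Dir) (r : Reading) : Option (Turn State Flag) :=
  if Sees r (TailLabel s.shape) (fun f => f.Follow ∧ f.Contracted) then
    some (mkTurn { s with shape := none } none (Move.handoverContract (headContractLabel a)))
  else if ¬ Sees r (TailLabel s.shape) Flag.Follow ∧ ¬ Sees r (fun _ => True) Flag.Inactive then
    some (mkTurn { s with shape := none } none (Move.contract (headContractLabel a)))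
  else none

open Classical in
/-- A contracted follower. -/
noncomputable def followTurn (s : State) (r : Reading) : Option (Turn State Flag) :=
  if Sees r (fun _ => True) (· = Flag.object) then
    some (mkTurn { s with phase := Phase.lead } none Move.idle)
  else
    ((r (dirLabel s.d)).bind (Flag.contractionDir s.d)).map fun d' =>
      mkTurn { s with shape := some s.d, d := d' } none (Move.expand (dirLabel s.d))

open Classical in
/-- A contracted leader.  It can expand, possibly in a handover, if the next node along the
surface is unoccupied or the tail of an expanded particle.  If it sees a follow or a complaint
indicator, it expands if it can, and otherwise sends a complaint indicator along the surface. -/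
noncomputable def leadTurn (pick : Finset (Fin 10) → Fin 10) (s : State) (r : Reading) :
    Option (Turn State Flag) :=
  if Sees r (fun _ => True) (fun f => f.Follow ∨ f.Complaint) then
    if ∀ f, r (dirLabel (surfaceDir pick r)) = some f → f.ExpandedTail then
      some (mkTurn { s with shape := some (surfaceDir pick r) } none
        (Move.expand (dirLabel (surfaceDir pick r))))
    else some (mkTurn s (some (surfaceDir pick r)) Move.idle)
  else none

/-- The single turn, if any, of a particle. -/
noncomputable def turn (pick : Finset (Fin 10) → Fin 10) (s : State) (r : Reading) :
    Option (Turn State Flag) :=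
  match s.phase, s.shape with
  | Phase.inactive, _ => inactiveTurn pick s r
  | _, some a => expandedTurn s a r
  | Phase.follow, none => followTurn s r
  | Phase.lead, none => leadTurn pick s r

end Coating

/-- The coating algorithm.  The function `pick` resolves the arbitrary choice of a neighboring
active node by an inactive particle and of an edge connected to the object by a leader. -/
noncomputable def coating (pick : Finset (Fin 10) → Fin 10) : Algorithm where
  Q := Coating.State
  Flag := Coating.Flag
  finiteQ := inferInstance
  finiteFlag := inferInstance
  δ s r := {t | Coating.turn pick s r = some t}
  initState := ⟨Coating.Phase.inactive, none, 0⟩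
  initFlags := Coating.mkFlags ⟨Coating.Phase.inactive, none, 0⟩ none
  objFlags := fun _ => Coating.Flag.object

end Amoebot

/-!
# Work-optimal coating

*Geometry.* The boundary edges of the object, those that lead from a node outside the object to a
node of it, are permuted by turning clockwise around their endpoints.  A function on the edges of
the grid that has sum zero modulo 2 around every triangle is a coboundary (`exists_potential`).
Applied to the boundary edges of one orbit of the permutation this shows that there is only one
orbit, because the object and its complement are connected; applied to an arc of this orbit together
with the edges at one node it shows that the orbit visits each surface node only once, because the
complement remains connected when the node is removed.  As the surface is infinite, the orbit is a
line.  Hence the surface nodes are numbered injectively by integers such that a leader always moves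
from a position to the next one (`exists_surfaceCoordinates`).

*Invariant.* The state of an execution is described by agents, which use global directions, and by
two auxiliary quantities.  The rank of a node, zero on the surface, decreases whenever a follower
off the surface moves, and from its head to the node that it follows; this excludes cycles of
followers and keeps the configuration connected.  The base of an agent is the position on the
surface from which its displacement is measured: an agent that is on the surface from the beginning
is measured from its initial position, and a follower that takes over a node from another agent
inherits the base of that agent.  A leader moves only if it is pushed, directly or via complaints,
by a follower, so that the displacement of an agent remains at most twice the number of agents
behind it, up to an exception of one step for a leader that a follower is about to replace
(`Coating.Invariant`).

*Upper bound.* The potential adds up, over heads and tails, the ranks off the surface and the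
remaining displacements on the surface, with an extra charge for agents that are not leaders yet.
It is nonnegative, at most `12 * n ^ 2` initially, constant in complaints, and each other action
decreases it by at least the number of its movements (`Coating.Invariant.step`).

*Termination.* Hence there are only complaints from some time on.  By fairness, nobody but
contracted leaders could act then: there are no inactive agents, since these are connected to the
others, and no expanded agents, since one whose tail has maximal rank could contract.  If a follower
were left, one of minimal rank would stimulate a leader; but the foremost leader that is stimulated
at some time would expand or eventually complain to a leader even further ahead
(`Coating.Trace.not_stimulated`).  So nothing is enabled, and all particles are contracted leaders.

*Lower bound.* If the object is a half-plane and the particles form a line that leads away from it,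
their heights have to decrease by `n * (n - 1) / 2` in total, and a movement changes the sum of the
heights of heads and tails by at most one (`sq_le_worstCaseWork`).
-/

namespace Amoebot

/-! ### Potentials on the triangular grid -/

theorem dir_add_dir : ∀ k : Dir, dir k + dir (k + 2) = dir (k + 1) := by decide

theorem dir_injective : Function.Injective dir := by
  have : ∀ j k : Dir, dir j = dir k → j = k := by decide
  exact fun j k => this j k

theorem add_dir_add_dir (u : Node) {i j k : Dir} (h : dir i + dir j = dir k) :
    u + dir i + dir j = u + dir k := by rw [add_assoc, h]

theorem add_dir_opp (u : Node) (k : Dir) : u + dir k + dir (k + 3) = u := by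
  rw [dir_opp]; abel

theorem Geqt_adj_dir (u : Node) (k : Dir) : Geqt.Adj u (u + dir k) := ⟨k, rfl⟩

theorem exists_int_antiderivative {M : Type*} [AddCommGroup M] (h : ℤ → M) :
    ∃ H : ℤ → M, ∀ x, H (x + 1) = H x + h x := by
  refine ⟨fun x => (∑ i ∈ Finset.range x.toNat, h i) -
    ∑ i ∈ Finset.range (-x).toNat, h (-(i : ℤ) - 1), fun x => ?_⟩
  rcases le_or_gt 0 x with hx | hx
  · lift x to ℕ using hx
    have h1 : ((x : ℤ) + 1).toNat = x + 1 := by omega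
    have h2 : (-((x : ℤ) + 1)).toNat = 0 := by omega
    have h3 : (-(x : ℤ)).toNat = 0 := by omega
    simp only [h1, h2, h3, Finset.sum_range_succ, Int.toNat_natCast]
    simp
  · obtain ⟨m, rfl⟩ : ∃ m : ℕ, x = -(m : ℤ) - 1 := ⟨(-x - 1).toNat, by omega⟩
    have h1 : (-(m : ℤ) - 1 + 1).toNat = 0 := by omega
    have h2 : (-(-(m : ℤ) - 1 + 1)).toNat = m := by omega
    have h3 : (-(m : ℤ) - 1).toNat = 0 := by omega
    have h4 : (-(-(m : ℤ) - 1)).toNat = m + 1 := by omega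
    simp only [h1, h2, h3, h4, Finset.sum_range_succ]
    simp

/-- The triangular grid has trivial first cohomology modulo 2: a function on edges whose sum over
every triangle vanishes is the coboundary of a function on nodes. -/
theorem exists_potential (f : Node → Dir → ZMod 2)
    (hs : ∀ u k, f (u + dir k) (k + 3) = f u k)
    (ht : ∀ u k, f u k + f (u + dir k) (k + 2) + f u (k + 1) = 0) :
    ∃ g : Node → ZMod 2, ∀ u k, f u k = g u + g (u + dir k) := by
  have two : ∀ z : ZMod 2, z + z = 0 := by decide
  obtain ⟨H, hH⟩ := exists_int_antiderivative (fun x => f (x, 0) 0)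
  choose V hV using fun x : ℤ => exists_int_antiderivative (fun y => f (x, y) 1)
  let g : Node → ZMod 2 := fun u => H u.1 + V u.1 u.2 + V u.1 0
  have d0 : dir 0 = (1, 0) := rfl
  have d1 : dir 1 = (0, 1) := rfl
  have g1 : ∀ x y, g (x, y + 1) = g (x, y) + f (x, y) 1 := by
    intro x y; simp only [g, hV]; abel
  have square : ∀ x y, f (x, y) 0 + f (x + 1, y) 1 + f (x, y + 1) 0 + f (x, y) 1 = 0 := by
    intro x y
    have a := ht (x, y) 0
    have b := ht (x + 1, y) 1
    have c := hs (x, y + 1) 0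
    have e1 : ((x, y) : Node) + dir 0 = (x + 1, y) := by simp [d0]
    have e2 : ((x + 1, y) : Node) + dir 1 = (x + 1, y + 1) := by simp [d1]
    have e3 : ((x, y + 1) : Node) + dir 0 = (x + 1, y + 1) := by simp [d0]
    rw [e1] at a; rw [e2] at b; rw [e3] at c
    have i1 : (0 : Dir) + 2 = 2 := rfl
    have i2 : (0 : Dir) + 1 = 1 := rfl
    have i3 : (1 : Dir) + 2 = 3 := rfl
    have i4 : (1 : Dir) + 1 = 2 := rfl
    have i5 : (0 : Dir) + 3 = 3 := rfl
    rw [i1, i2] at a; rw [i3, i4] at b; rw [i5] at c; rw [c] at b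
    linear_combination a + b - two (f (x + 1, y) 2)
  have g0 : ∀ x y, g (x + 1, y) = g (x, y) + f (x, y) 0 := by
    intro x y
    induction y using Int.induction_on with
    | zero =>
      simp only [g, hH]
      linear_combination two (V (x + 1) 0) - two (V x 0)
    | succ y ih =>
      rw [g1, g1, ih]
      linear_combination square x y - two (f (x, y) 1) - two (f (x, (y : ℤ) + 1) 0)
    | pred y ih =>
      have a := g1 (x + 1) (-(y : ℤ) - 1)
      have b := g1 x (-(y : ℤ) - 1)
      have c := square x (-(y : ℤ) - 1)
      rw [sub_add_cancel] at a b c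
      linear_combination ih - a + b + c - two (f (x, -(y : ℤ) - 1) 0)
        - two (f (x + 1, -(y : ℤ) - 1) 1)
  have h0 : ∀ u : Node, f u 0 = g u + g (u + dir 0) := by
    rintro ⟨x, y⟩
    have e1 : ((x, y) : Node) + dir 0 = (x + 1, y) := by simp [d0]
    rw [e1, g0]
    linear_combination - two (g (x, y))
  have h1 : ∀ u : Node, f u 1 = g u + g (u + dir 1) := by
    rintro ⟨x, y⟩
    have e1 : ((x, y) : Node) + dir 1 = (x, y + 1) := by simp [d1]
    rw [e1, g1]
    linear_combination - two (g (x, y))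
  have hopp : ∀ k : Dir, (∀ u : Node, f u k = g u + g (u + dir k)) →
      ∀ u : Node, f u (k + 3) = g u + g (u + dir (k + 3)) := by
    intro k hk u
    have e : u + dir (k + 3) + dir k = u := by
      have := add_dir_opp u (k + 3)
      rwa [add_assoc k 3 3, show (3 : Dir) + 3 = 0 from rfl, add_zero] at this
    have := hs (u + dir (k + 3)) k
    rw [e] at this
    rw [this, hk, e, add_comm]
  have h2 : ∀ u : Node, f u 2 = g u + g (u + dir 2) := by
    intro u
    have a := ht u 1
    have b := hopp 0 h0 (u + dir 1)
    have e : u + dir 1 + dir (0 + 3) = u + dir 2 := add_dir_add_dir u (by decide)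
    rw [e] at b
    rw [show (1 : Dir) + 2 = 0 + 3 from rfl, b, h1 u, show (1 : Dir) + 1 = 2 from rfl] at a
    linear_combination a - two (g (u + dir 1)) - two (g u) - two (g (u + dir 2))
  refine ⟨g, fun u k => ?_⟩
  have hk : k = 0 ∨ k = 1 ∨ k = 2 ∨ k = 0 + 3 ∨ k = 1 + 3 ∨ k = 2 + 3 := by
    revert k; decide
  rcases hk with rfl | rfl | rfl | rfl | rfl | rfl
  · exact h0 u
  · exact h1 u
  · exact h2 u
  · exact hopp 0 h0 u
  · exact hopp 1 h1 u
  · exact hopp 2 h2 u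

/-- A function on nodes that does not change along the edges of a connected set is constant
on it. -/
theorem ConnectedSet.constant {S : Set Node} (hS : ConnectedSet S) {α : Type*} (g : Node → α)
    (hg : ∀ u ∈ S, ∀ k, u + dir k ∈ S → g (u + dir k) = g u) {u v : Node} (hu : u ∈ S)
    (hv : v ∈ S) : g u = g v := by
  obtain ⟨w⟩ := hS.preconnected ⟨u, hu⟩ ⟨v, hv⟩
  have : ∀ (x y : S), (Geqt.induce S).Walk x y → g x = g y := by
    intro x y w
    induction w with
    | nil => rfl
    | @cons x y z h w ih =>
      rw [← ih]
      obtain ⟨k, hk⟩ : Geqt.Adj (x : Node) y := h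
      rw [hk]
      exact (hg x x.2 k (hk ▸ y.2)).symm
  exact this _ _ w

/-! ### The boundary of an object -/

/-- The boundary edges of `C`, directed from the complement to `C`. -/
abbrev BoundaryEdge (C : Set Node) := {e : Node × Dir // e.1 ∉ C ∧ e.1 + dir e.2 ∈ C}

namespace BoundaryEdge

variable {C : Set Node}

theorem add_dir_sub_one (v : Node) (k : Dir) : v + dir (k - 1) + dir (k + 1) = v + dir k :=
  add_dir_add_dir v (by clear * -; decide +revert)

theorem add_dir_add_one (v : Node) (k : Dir) : v + dir (k + 1) + dir (k - 1) = v + dir k :=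
  add_dir_add_dir v (by clear * -; decide +revert)

open Classical in
/-- The next boundary edge along the boundary, which shares a triangle with the given one: the
triangle that is met when turning clockwise around the outer endpoint. -/
noncomputable def next (e : BoundaryEdge C) : BoundaryEdge C :=
  if h : e.1.1 + dir (e.1.2 - 1) ∈ C then ⟨(e.1.1, e.1.2 - 1), e.2.1, h⟩
  else ⟨(e.1.1 + dir (e.1.2 - 1), e.1.2 + 1), h, by
    show e.1.1 + dir (e.1.2 - 1) + dir (e.1.2 + 1) ∈ C
    rw [add_dir_sub_one]; exact e.2.2⟩

open Classical in
/-- The previous boundary edge along the boundary. -/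
noncomputable def prev (e : BoundaryEdge C) : BoundaryEdge C :=
  if h : e.1.1 + dir (e.1.2 + 1) ∈ C then ⟨(e.1.1, e.1.2 + 1), e.2.1, h⟩
  else ⟨(e.1.1 + dir (e.1.2 + 1), e.1.2 - 1), h, by
    show e.1.1 + dir (e.1.2 + 1) + dir (e.1.2 - 1) ∈ C
    rw [add_dir_add_one]; exact e.2.2⟩

theorem next_of_mem {v : Node} {k : Dir} (h) (h' : v + dir (k - 1) ∈ C) :
    (next (C := C) ⟨(v, k), h⟩).1 = (v, k - 1) := by
  rw [next, dif_pos h']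

theorem next_of_notMem {v : Node} {k : Dir} (h) (h' : v + dir (k - 1) ∉ C) :
    (next (C := C) ⟨(v, k), h⟩).1 = (v + dir (k - 1), k + 1) := by
  rw [next, dif_neg h']

theorem prev_of_mem {v : Node} {k : Dir} (h) (h' : v + dir (k + 1) ∈ C) :
    (prev (C := C) ⟨(v, k), h⟩).1 = (v, k + 1) := by
  rw [prev, dif_pos h']

theorem prev_of_notMem {v : Node} {k : Dir} (h) (h' : v + dir (k + 1) ∉ C) :
    (prev (C := C) ⟨(v, k), h⟩).1 = (v + dir (k + 1), k - 1) := by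
  rw [prev, dif_neg h']

theorem prev_next (e : BoundaryEdge C) : prev (next e) = e := by
  obtain ⟨⟨v, k⟩, h⟩ := e
  by_cases h' : v + dir (k - 1) ∈ C
  · have : next (C := C) ⟨(v, k), h⟩ = ⟨(v, k - 1), h.1, h'⟩ := Subtype.ext (next_of_mem h h')
    rw [this]
    apply Subtype.ext
    rw [prev_of_mem _ (by rw [sub_add_cancel]; exact h.2), sub_add_cancel]
  · have e1 : v + dir (k - 1) + dir (k + 1) = v + dir k := add_dir_sub_one v k
    have e2 : v + dir (k - 1) + dir (k + 1 + 1) = v := by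
      rw [show k + 1 + 1 = k - 1 + 3 by clear * -; decide +revert]
      exact add_dir_opp v (k - 1)
    have : next (C := C) ⟨(v, k), h⟩ = ⟨(v + dir (k - 1), k + 1), h', by rw [e1]; exact h.2⟩ :=
      Subtype.ext (next_of_notMem h h')
    rw [this]
    apply Subtype.ext
    rw [prev_of_notMem _ (by rw [e2]; exact h.1), e2, add_sub_cancel_right]

theorem next_prev (e : BoundaryEdge C) : next (prev e) = e := by
  obtain ⟨⟨v, k⟩, h⟩ := e
  by_cases h' : v + dir (k + 1) ∈ C
  · have : prev (C := C) ⟨(v, k), h⟩ = ⟨(v, k + 1), h.1, h'⟩ := Subtype.ext (prev_of_mem h h')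
    rw [this]
    apply Subtype.ext
    rw [next_of_mem _ (by rw [add_sub_cancel_right]; exact h.2), add_sub_cancel_right]
  · have e1 : v + dir (k + 1) + dir (k - 1) = v + dir k := add_dir_add_one v k
    have e2 : v + dir (k + 1) + dir (k - 1 - 1) = v := by
      rw [show k - 1 - 1 = k + 1 + 3 by clear * -; decide +revert]
      exact add_dir_opp v (k + 1)
    have : prev (C := C) ⟨(v, k), h⟩ = ⟨(v + dir (k + 1), k - 1), h', by rw [e1]; exact h.2⟩ :=
      Subtype.ext (prev_of_notMem h h')
    rw [this]
    apply Subtype.ext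
    rw [next_of_notMem _ (by rw [e2]; exact h.1), e2, sub_add_cancel]

variable (C) in
/-- `next` as a permutation. -/
noncomputable def shift : Equiv.Perm (BoundaryEdge C) := ⟨next, prev, prev_next, next_prev⟩

@[simp] theorem shift_apply (e : BoundaryEdge C) : shift C e = next e := rfl

open Classical in
/-- A function on boundary edges, extended by zero to all directed edges. -/
noncomputable def extend (χ : BoundaryEdge C → ZMod 2) (v : Node) (k : Dir) : ZMod 2 :=
  if h : v ∉ C ∧ v + dir k ∈ C then χ ⟨(v, k), h⟩ else 0

theorem extend_edge (χ : BoundaryEdge C → ZMod 2) (e : BoundaryEdge C) :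
    extend χ e.1.1 e.1.2 = χ e := dif_pos e.2

theorem extend_of_mem (χ : BoundaryEdge C → ZMod 2) {v : Node} (k : Dir) (h : v ∈ C) :
    extend χ v k = 0 := dif_neg fun h' => h'.1 h

theorem extend_of_notMem (χ : BoundaryEdge C → ZMod 2) {v : Node} {k : Dir}
    (h : v + dir k ∉ C) : extend χ v k = 0 := dif_neg fun h' => h h'.2

theorem extend_next (χ : BoundaryEdge C → ZMod 2) {v : Node} {k : Dir} (hv : v ∉ C)
    (hk : v + dir k ∈ C) :
    extend (fun e => χ e + χ (next e)) v k =
      extend χ v k + extend χ v (k - 1) + extend χ (v + dir (k - 1)) (k + 1) := by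
  have e1 := extend_edge χ (next ⟨(v, k), hv, hk⟩)
  rw [extend, dif_pos ⟨hv, hk⟩, extend, dif_pos ⟨hv, hk⟩, ← e1]
  by_cases h : v + dir (k - 1) ∈ C
  · rw [next_of_mem _ h, extend_of_mem χ (v := v + dir (k - 1)) _ h]; simp
  · rw [next_of_notMem _ h, extend_of_notMem χ h]; simp

/-- The sum over a triangle of a function on boundary edges.  A triangle that meets both `C` and
its complement has exactly two boundary edges, and one of them is the successor of the other. -/
theorem triangle_sum (χ : BoundaryEdge C → ZMod 2) (u : Node) (k : Dir) :
    extend χ u k + extend χ (u + dir k) (k + 3)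
      + (extend χ (u + dir k) (k + 2) + extend χ (u + dir (k + 1)) (k + 5))
      + (extend χ u (k + 1) + extend χ (u + dir (k + 1)) (k + 4)) =
    extend (fun e => χ e + χ (next e)) u (k + 1)
      + extend (fun e => χ e + χ (next e)) (u + dir k) (k + 3)
      + extend (fun e => χ e + χ (next e)) (u + dir (k + 1)) (k + 5) := by
  have a1 : u + dir k + dir (k + 3) = u := add_dir_opp u k
  have a2 : u + dir k + dir (k + 2) = u + dir (k + 1) := add_dir_add_dir u (dir_add_dir k)
  have a3 : u + dir (k + 1) + dir (k + 5) = u + dir k :=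
    add_dir_add_dir u (by clear * -; decide +revert)
  have a4 : u + dir (k + 1) + dir (k + 4) = u := by
    have := add_dir_opp u (k + 1)
    rwa [show k + 1 + 3 = k + 4 by clear * -; decide +revert] at this
  have i1 : k + 1 - 1 = k := by clear * -; decide +revert
  have i2 : k + 3 - 1 = k + 2 := by clear * -; decide +revert
  have i3 : k + 5 - 1 = k + 4 := by clear * -; decide +revert
  have i4 : k + 1 + 1 = k + 2 := by clear * -; decide +revert
  have i5 : k + 3 + 1 = k + 4 := by clear * -; decide +revert
  have i6 : k + 5 + 1 = k := by clear * -; decide +revert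
  have b1 := @extend_next C χ u (k + 1)
  have b2 := @extend_next C χ (u + dir k) (k + 3)
  have b3 := @extend_next C χ (u + dir (k + 1)) (k + 5)
  rw [i1, i4] at b1
  rw [a1, i2, a2, i5] at b2
  rw [a3, i3, a4, i6] at b3
  by_cases hA : u ∈ C <;> by_cases hB : u + dir k ∈ C <;> by_cases hD : u + dir (k + 1) ∈ C <;>
    simp only [hA, hB, hD, not_true_eq_false, not_false_eq_true,
      IsEmpty.forall_iff, forall_const] at b1 b2 b3 <;>
    simp only [extend, hA, hB, hD, a1, a2, a3, a4, not_true_eq_false, not_false_eq_true,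
      and_self, and_true, and_false, dite_true, dite_false, add_zero,
      zero_add] at b1 b2 b3 ⊢ <;>
    first
      | done
      | (rw [b1]; try abel)
      | (rw [b2]; try abel)
      | (rw [b3]; try abel)

/-- A function `χ` on the boundary edges, together with a function `D` on the edges around a node
`v`, is the coboundary of a function on nodes if the sums over the triangles cancel. -/
theorem exists_potential (χ : BoundaryEdge C → ZMod 2) (D : Node → Dir → ZMod 2)
    (h : ∀ u k, extend (fun e => χ e + χ (next e)) u k + (D u k + D u (k - 1)) = 0) :
    ∃ g : Node → ZMod 2, ∀ u k, extend χ u k + extend χ (u + dir k) (k + 3)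
      + (D u k + D (u + dir k) (k + 3)) = g u + g (u + dir k) := by
  apply Amoebot.exists_potential
  · intro u k
    rw [add_dir_opp, show k + 3 + 3 = k by clear * -; decide +revert]
    abel
  · intro u k
    have a2 : u + dir k + dir (k + 2) = u + dir (k + 1) := add_dir_add_dir u (dir_add_dir k)
    have i1 : k + 2 + 3 = k + 5 := by clear * -; decide +revert
    have i2 : k + 1 + 3 = k + 4 := by clear * -; decide +revert
    have j1 : k + 1 - 1 = k := by clear * -; decide +revert
    have j2 : k + 3 - 1 = k + 2 := by clear * -; decide +revert
    have j3 : k + 5 - 1 = k + 4 := by clear * -; decide +revert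
    have t := triangle_sum χ u k
    have c1 := h u (k + 1)
    have c2 := h (u + dir k) (k + 3)
    have c3 := h (u + dir (k + 1)) (k + 5)
    rw [a2, i1, i2]
    rw [j1] at c1; rw [j2] at c2; rw [j3] at c3
    linear_combination t + c1 + c2 + c3

/-- The boundary of a connected set with connected complement is a single orbit: the indicator
function of an orbit is the coboundary of a function that is constant on the set and on its
complement. -/
theorem sameCycle_shift (hC : ConnectedSet C) (hC' : ConnectedSet Cᶜ) (e₀ e : BoundaryEdge C) :
    (shift C).SameCycle e₀ e := by
  classical
  let χ : BoundaryEdge C → ZMod 2 := fun e => if (shift C).SameCycle e₀ e then 1 else 0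
  have hχ : ∀ e, χ e + χ (next e) = 0 := by
    intro e
    have : (shift C).SameCycle e₀ (next e) ↔ (shift C).SameCycle e₀ e := by
      rw [← shift_apply, Equiv.Perm.sameCycle_apply_right]
    simp only [χ, this]
    split_ifs <;> decide
  obtain ⟨g, hg⟩ := exists_potential χ (fun _ _ => 0) (fun u k => by
    simp only [hχ]; simp [extend])
  simp only [add_zero] at hg
  have eqz : ∀ x y : ZMod 2, 0 = x + y → y = x := by decide
  have gC : ∀ u ∈ C, ∀ w ∈ C, g u = g w := fun u hu w hw =>
    hC.constant g (fun u hu k hk => eqz _ _ (by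
      rw [← hg, extend_of_mem χ k hu, extend_of_mem χ _ hk, add_zero])) hu hw
  have gC' : ∀ u ∈ Cᶜ, ∀ w ∈ Cᶜ, g u = g w := fun u hu w hw =>
    hC'.constant g (fun u hu k hk => eqz _ _ (by
      rw [← hg, extend_of_notMem χ hk, extend_of_notMem χ (by rw [add_dir_opp]; exact hu),
        add_zero])) hu hw
  have hχe : ∀ e : BoundaryEdge C, χ e = g e.1.1 + g (e.1.1 + dir e.1.2) := by
    intro e
    rw [← hg, extend_edge, extend_of_mem χ _ e.2.2, add_zero]
  have h1 : χ e₀ = χ e := by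
    rw [hχe, hχe, gC' _ e₀.2.1 _ e.2.1, gC _ e₀.2.2 _ e.2.2]
  have h2 : χ e₀ = 1 := if_pos (Equiv.Perm.SameCycle.refl _ _)
  by_contra hne
  rw [h2, show χ e = 0 from if_neg hne] at h1
  exact one_ne_zero h1

/-- The edges of an infinite connected boundary are indexed by the integers. -/
theorem exists_index (hC : ConnectedSet C) (hC' : ConnectedSet Cᶜ)
    (hinf : Infinite (BoundaryEdge C)) :
    ∃ idx : BoundaryEdge C → ℤ, Function.Injective idx ∧ ∀ e, idx (next e) = idx e + 1 := by
  obtain ⟨e₀⟩ := hinf.nonempty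
  choose idx hidx using fun e => sameCycle_shift hC hC' e₀ e
  have key : ∀ m : ℕ, 0 < m → (shift C ^ (m : ℤ)) e₀ ≠ e₀ := by
    intro m hm h
    apply hinf.not_finite
    refine Set.finite_univ_iff.mp (Set.Finite.subset
      (Set.finite_range (fun i : Fin m => (shift C ^ ((i : ℕ) : ℤ)) e₀)) ?_)
    intro e _
    have hpos : (0 : ℤ) < m := by exact_mod_cast hm
    refine ⟨⟨(idx e % m).toNat, ?_⟩, ?_⟩
    · have := Int.emod_lt_of_pos (idx e) hpos
      have := Int.emod_nonneg (idx e) hpos.ne'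
      omega
    · have h0 := Int.emod_nonneg (idx e) hpos.ne'
      have hfix : ∀ j : ℤ, (shift C ^ ((m : ℤ) * j)) e₀ = e₀ := by
        intro j
        rw [zpow_mul]
        exact Function.IsFixedPt.perm_zpow h j
      simp only [Int.toNat_of_nonneg h0]
      conv_rhs => rw [← hidx e, ← Int.emod_add_mul_ediv (idx e) m, zpow_add, Equiv.Perm.mul_apply,
        hfix]
  have inj : ∀ i j : ℤ, (shift C ^ i) e₀ = (shift C ^ j) e₀ → i ≤ j := by
    intro i j h
    by_contra hlt
    apply key (i - j).toNat (by omega)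
    rw [Int.toNat_of_nonneg (by omega), sub_eq_neg_add, zpow_add, Equiv.Perm.mul_apply, h,
      ← Equiv.Perm.mul_apply, ← zpow_add, neg_add_cancel, zpow_zero, Equiv.Perm.one_apply]
  refine ⟨idx, fun e e' h => by rw [← hidx e, ← hidx e', h], fun e => ?_⟩
  have : (shift C ^ idx (next e)) e₀ = (shift C ^ (idx e + 1)) e₀ := by
    rw [hidx, add_comm, zpow_add, Equiv.Perm.mul_apply, hidx, zpow_one, shift_apply]
  exact le_antisymm (inj _ _ this) (inj _ _ this.symm)

/-- No node of the complement is met twice by the boundary, since it would be a cut node of the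
complement. -/
theorem arc_unique (hC : ConnectedSet C) (hC' : TwoConnectedSet Cᶜ)
    (hinf : Infinite (BoundaryEdge C)) {v : Node} (hv : v ∉ C) {k₁ k₂ : Dir}
    (h₁ : v + dir k₁ ∈ C) (h₁' : v + dir (k₁ - 1) ∉ C)
    (h₂ : v + dir k₂ ∈ C) (h₂' : v + dir (k₂ - 1) ∉ C) : k₁ = k₂ := by
  classical
  obtain ⟨idx, hinj, hidx⟩ := exists_index hC hC'.2.1 hinf
  by_contra hne
  wlog hlt : idx ⟨(v, k₁), hv, h₁⟩ < idx ⟨(v, k₂), hv, h₂⟩ generalizing k₁ k₂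
  · refine this h₂ h₂' h₁ h₁' (Ne.symm hne) (lt_of_le_of_ne (not_lt.mp hlt) fun h => hne ?_)
    have := congrArg (fun e : BoundaryEdge C => e.1.2) (hinj h)
    exact this.symm
  set e₁ : BoundaryEdge C := ⟨(v, k₁), hv, h₁⟩ with he₁
  set e₂ : BoundaryEdge C := ⟨(v, k₂), hv, h₂⟩ with he₂
  -- The edges at `v` with directions from `k₁` up to, but not including, `k₂`.
  obtain ⟨d, hd⟩ : ∃ d : Dir → ZMod 2, ∀ k, d k + d (k - 1) =
      (if k = k₁ then 1 else 0) + (if k = k₂ then 1 else 0) := by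
    refine ⟨fun k => if (k - k₁).val < (k₂ - k₁).val then 1 else 0, ?_⟩
    clear * -
    decide +revert
  -- The boundary edges after `e₁` up to `e₂`, closed up by edges around `v`.
  let χ : BoundaryEdge C → ZMod 2 := fun e => if idx e₁ < idx e ∧ idx e ≤ idx e₂ then 1 else 0
  have hχ : ∀ e, χ e + χ (next e) = (if e = e₁ then 1 else 0) + (if e = e₂ then 1 else 0) := by
    intro e
    simp only [χ, hidx, ← hinj.eq_iff (a := e)]
    have two : (1 : ZMod 2) + 1 = 0 := rfl
    split_ifs <;> first | omega | simp [two]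
  obtain ⟨g, hg⟩ := exists_potential χ (fun u k => if u = v then d k else 0) (by
    intro u k
    have two : ∀ z : ZMod 2, z + z = 0 := by decide
    simp only [hχ]
    by_cases hu : u = v
    · subst hu
      simp only [if_true, hd]
      by_cases hk : u + dir k ∈ C
      · simp only [extend, hv, hk, not_false_eq_true, and_self, dite_true, he₁, he₂,
          Subtype.mk.injEq, Prod.mk.injEq, true_and]
        exact two _
      · rw [extend_of_notMem _ hk, if_neg (fun h : k = k₁ => hk (h ▸ h₁)),
          if_neg (fun h : k = k₂ => hk (h ▸ h₂))]
        simp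
    · simp only [hu, if_false, add_zero, extend]
      simp [he₁, he₂, hu])
  have eqz : ∀ x y : ZMod 2, 0 = x + y → y = x := by decide
  have gC : ∀ u ∈ C, ∀ w ∈ C, g u = g w := fun u hu w hw =>
    hC.constant g (fun u hu k hk => eqz _ _ (by
      rw [← hg, extend_of_mem χ k hu, extend_of_mem χ _ hk, if_neg (ne_of_mem_of_not_mem hu hv),
        if_neg (ne_of_mem_of_not_mem hk hv)]; simp)) hu hw
  have gC' : ∀ u ∈ Cᶜ \ {v}, ∀ w ∈ Cᶜ \ {v}, g u = g w := fun u hu w hw =>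
    (hC'.2.2 v hv).constant g (fun u hu k hk => eqz _ _ (by
      rw [← hg, extend_of_notMem χ hk.1, extend_of_notMem χ (by rw [add_dir_opp]; exact hu.1),
        if_neg (show u ≠ v from hu.2), if_neg (show u + dir k ≠ v from hk.2)]; simp)) hu hw
  have hχe : ∀ e : BoundaryEdge C, e.1.1 ≠ v → χ e = g e.1.1 + g (e.1.1 + dir e.1.2) := by
    intro e he
    rw [← hg, extend_edge, extend_of_mem χ _ e.2.2, if_neg he,
      if_neg (ne_of_mem_of_not_mem e.2.2 hv)]
    simp
  have hn₁ : (next e₁).1.1 ≠ v := by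
    rw [he₁, next_of_notMem _ h₁']; simpa using dir_ne_zero _
  have hn₂ : (next e₂).1.1 ≠ v := by
    rw [he₂, next_of_notMem _ h₂']; simpa using dir_ne_zero _
  have h : χ (next e₁) = χ (next e₂) := by
    rw [hχe _ hn₁, hχe _ hn₂, gC' _ ⟨(next e₁).2.1, hn₁⟩ _ ⟨(next e₂).2.1, hn₂⟩,
      gC _ (next e₁).2.2 _ (next e₂).2.2]
  have e1 : χ (next e₁) = 1 := if_pos (by rw [hidx]; omega)
  have e2 : χ (next e₂) = 0 := if_neg (by rw [hidx]; omega)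
  rw [e1, e2] at h
  exact one_ne_zero h

end BoundaryEdge

/-- Coordinates of the surface of an object.  The direction `sd v` leads from the surface node `v`
to the next surface node in the sense of a particle that turns clockwise from the object, and
`pos` numbers the surface nodes in this order. -/
structure SurfaceCoordinates (C : Set Node) (sd : Node → Dir) (pos : Node → ℤ) : Prop where
  notMem : ∀ v ∈ surface C, v + dir (sd v) ∉ C
  mem : ∀ v ∈ surface C, v + dir (sd v + 1) ∈ C
  unique : ∀ v ∈ surface C, ∀ k, v + dir k ∉ C → v + dir (k + 1) ∈ C → k = sd v
  injOn : Set.InjOn pos (surface C)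
  pos_next : ∀ v ∈ surface C, pos (v + dir (sd v)) = pos v + 1

theorem mem_surface_iff {C : Set Node} {v : Node} :
    v ∈ surface C ↔ v ∉ C ∧ ∃ k, v + dir k ∈ C :=
  and_congr_right fun _ =>
    ⟨fun ⟨_, hw, k, hk⟩ => ⟨k, hk ▸ hw⟩, fun ⟨k, hk⟩ => ⟨_, hk, Geqt_adj_dir v k⟩⟩

theorem SurfaceCoordinates.next_mem {C : Set Node} {sd : Node → Dir} {pos : Node → ℤ}
    (h : SurfaceCoordinates C sd pos) {v : Node} (hv : v ∈ surface C) :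
    v + dir (sd v) ∈ surface C :=
  mem_surface_iff.mpr ⟨h.notMem v hv, sd v + 2, by
    rw [add_dir_add_dir v (dir_add_dir _)]; exact h.mem v hv⟩

theorem TwoConnectedSet.exists_neighbor {S : Set Node} (hS : TwoConnectedSet S) {v : Node}
    (hv : v ∈ S) : ∃ k, v + dir k ∈ S := by
  by_contra! h
  have hsub : S ⊆ {v} := by
    intro w hw
    have := hS.2.1.constant (fun u => u = v) (fun u hu k hk => by
      refine propext ⟨?_, fun h' => absurd hk (h' ▸ h k)⟩
      rintro rfl
      exact absurd (by rwa [add_dir_opp]) (h (k + 3))) hv hw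
    simpa using this
  have := Set.encard_le_encard hsub
  rw [Set.encard_singleton] at this
  exact absurd (hS.1.trans_le this) (by decide)

/-- The boundary of the object is a line of edges, and it meets each surface node in one interval
of this line. -/
theorem exists_surfaceCoordinates {C : Set Node} (hC : ValidObject C)
    (hinf : (surface C).Infinite) : ∃ sd pos, SurfaceCoordinates C sd pos := by
  classical
  have hE : Infinite (BoundaryEdge C) := by
    have : Infinite (surface C) := hinf.to_subtype
    have hk : ∀ v : surface C, ∃ k, (v : Node) + dir k ∈ C := fun v => (mem_surface_iff.mp v.2).2
    choose k hk using hk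
    refine Infinite.of_injective (fun v : surface C =>
      (⟨((v : Node), k v), v.2.1, hk v⟩ : BoundaryEdge C)) fun v w h => ?_
    exact Subtype.ext (congrArg (fun e : BoundaryEdge C => e.1.1) h)
  obtain ⟨idx, hinj, hidx⟩ := BoundaryEdge.exists_index hC.1 hC.2.2.1 hE
  -- The boundary leaves the outer endpoint of the edge after the edge.
  let Last : BoundaryEdge C → Prop := fun e => e.1.1 + dir (e.1.2 - 1) ∉ C
  have last_unique : ∀ e e' : BoundaryEdge C, Last e → Last e' → e.1.1 = e'.1.1 → e = e' := by
    rintro ⟨⟨v, k⟩, hv, hk⟩ ⟨⟨v', k'⟩, hv', hk'⟩ h h' heq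
    obtain rfl : v = v' := heq
    obtain rfl := BoundaryEdge.arc_unique hC.1 hC.2 hE hv hk h hk' h'
    rfl
  -- `Q` counts the nodes that the boundary has left before a given boundary edge.
  obtain ⟨H, hH⟩ := exists_int_antiderivative
    (fun i => if ∃ e, idx e = i ∧ Last e then (1 : ℤ) else 0)
  have Hmono : Monotone H := by
    refine monotone_int_of_le_succ fun i => ?_
    rw [hH]; split_ifs <;> simp
  let Q : BoundaryEdge C → ℤ := fun e => H (idx e)
  have Qlast : ∀ e, Last e → H (idx e + 1) = Q e + 1 := fun e he => by
    rw [hH, if_pos ⟨e, rfl, he⟩]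
  have Qnot : ∀ e, ¬ Last e → Q (BoundaryEdge.next e) = Q e := fun e he => by
    simp only [Q]
    rw [hidx, hH, if_neg, add_zero]
    rintro ⟨e', h1, h2⟩
    exact he (hinj h1 ▸ h2)
  have exists_last : ∀ e : BoundaryEdge C, ∃ e', Last e' ∧ e'.1.1 = e.1.1 ∧ Q e' = Q e := by
    have key : ∀ (m : ℕ) (e : BoundaryEdge C), e.1.1 + dir (e.1.2 - 1 - (Fin.ofNat 6 m)) ∉ C →
        ∃ e', Last e' ∧ e'.1.1 = e.1.1 ∧ Q e' = Q e := by
      intro m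
      induction m with
      | zero =>
        intro e he
        exact ⟨e, by simpa [Last] using he, rfl, rfl⟩
      | succ m ih =>
        intro e he
        by_cases hl : Last e
        · exact ⟨e, hl, rfl, rfl⟩
        · have hn := BoundaryEdge.next_of_mem (v := e.1.1) (k := e.1.2) e.2 (not_not.mp hl)
          have hn' : (BoundaryEdge.next e).1 = (e.1.1, e.1.2 - 1) := hn
          obtain ⟨e', h1, h2, h3⟩ := ih (BoundaryEdge.next e) (by
            rw [hn']
            show e.1.1 + dir (e.1.2 - 1 - 1 - Fin.ofNat 6 m) ∉ C
            have : Fin.ofNat 6 (m + 1) = 1 + Fin.ofNat 6 m := by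
              refine Fin.ext ?_
              show (m + 1) % 6 = (1 + m % 6) % 6
              omega
            rwa [this, ← sub_sub] at he)
          exact ⟨e', h1, h2.trans (by rw [hn']), h3.trans (Qnot e hl)⟩
    intro e
    obtain ⟨k, hk⟩ := hC.2.exists_neighbor e.2.1
    refine key (e.1.2 - 1 - k).val e ?_
    have : Fin.ofNat 6 (e.1.2 - 1 - k).val = e.1.2 - 1 - k := by
      apply Fin.ext; simp [Fin.ofNat]
    rw [this, sub_sub_cancel]
    exact hk
  have hlast : ∀ v : surface C, ∃ e, Last e ∧ e.1.1 = (v : Node) := by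
    rintro ⟨v, hv⟩
    obtain ⟨hv', k, hk⟩ := mem_surface_iff.mp hv
    obtain ⟨e', h1, h2, -⟩ := exists_last ⟨(v, k), hv', hk⟩
    exact ⟨e', h1, h2⟩
  choose L hL hLv using hlast
  let sd : Node → Dir := fun v => if h : v ∈ surface C then (L ⟨v, h⟩).1.2 - 1 else 0
  let pos : Node → ℤ := fun v => if h : v ∈ surface C then Q (L ⟨v, h⟩) else 0
  have pos_eq : ∀ e : BoundaryEdge C, pos e.1.1 = Q e := by
    intro e
    have he : e.1.1 ∈ surface C := mem_surface_iff.mpr ⟨e.2.1, _, e.2.2⟩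
    obtain ⟨e', h1, h2, h3⟩ := exists_last e
    simp only [pos, dif_pos he]
    rw [last_unique _ e' (hL ⟨_, he⟩) h1 (by rw [hLv, h2]), h3]
  have hnot : ∀ v ∈ surface C, v + dir (sd v) ∉ C := by
    intro v hv
    have := hL ⟨v, hv⟩
    simp only [Last, hLv] at this
    simpa only [sd, dif_pos hv] using this
  have hmem : ∀ v ∈ surface C, v + dir (sd v + 1) ∈ C := by
    intro v hv
    have := (L ⟨v, hv⟩).2.2
    rw [hLv] at this
    simpa only [sd, dif_pos hv, sub_add_cancel] using this
  refine ⟨sd, pos, hnot, hmem, ?_, ?_, ?_⟩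
  · intro v hv k h1 h2
    have := BoundaryEdge.arc_unique hC.1 hC.2 hE hv.1 h2 (by rwa [add_sub_cancel_right])
      (hmem v hv) (by rw [add_sub_cancel_right]; exact hnot v hv)
    exact add_right_cancel this
  · intro v hv w hw h
    have lt : ∀ e e' : BoundaryEdge C, Last e → idx e < idx e' → Q e < Q e' := by
      intro e e' he hlt
      have : H (idx e + 1) ≤ Q e' := Hmono (by omega)
      rw [Qlast e he] at this
      omega
    simp only [pos, dif_pos hv, dif_pos hw] at h
    have : idx (L ⟨v, hv⟩) = idx (L ⟨w, hw⟩) := by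
      rcases lt_trichotomy (idx (L ⟨v, hv⟩)) (idx (L ⟨w, hw⟩)) with h' | h' | h'
      · exact absurd h (lt _ _ (hL _) h').ne
      · exact h'
      · exact absurd h (lt _ _ (hL _) h').ne'
    have := hinj this
    have h1 := hLv ⟨v, hv⟩
    rw [this, hLv] at h1
    exact h1.symm
  · intro v hv
    set e := L ⟨v, hv⟩ with he
    have hn : (BoundaryEdge.next e).1 = (e.1.1 + dir (e.1.2 - 1), e.1.2 + 1) :=
      BoundaryEdge.next_of_notMem (v := e.1.1) (k := e.1.2) e.2 (hL ⟨v, hv⟩)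
    have e1 : v + dir (sd v) = (BoundaryEdge.next e).1.1 := by
      rw [hn, he, hLv]; simp only [sd, dif_pos hv]
    have e2 : pos v = Q e := by simp only [pos, dif_pos hv, he]
    rw [e1, pos_eq, e2, ← Qlast e (hL ⟨v, hv⟩), ← hidx]

/-! ### Edges and flags -/

theorem labelEdge_none_eq_some {i : Fin 10} {e : Bool × Dir} :
    labelEdge none i = some e ↔ e.1 = true ∧ i = dirLabel e.2 := by
  revert i e; decide

theorem labelEdge_some_inj : ∀ {a : Dir} {i j : Fin 10},
    labelEdge (some a) i = labelEdge (some a) j → i = j := by decide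

theorem exists_labelEdge_iff : ∀ {a : Dir} {e : Bool × Dir},
    (∃ i, labelEdge (some a) i = some e) ↔ e ≠ (false, a) ∧ e ≠ (true, a + 3) := by decide

namespace Particle

variable {A : Algorithm} (p : Particle A)

theorem tail_mem_nodes : p.tail ∈ p.nodes := Or.inl rfl

theorem head_of_contracted (h : p.ext = none) : p.head = p.tail := by simp [head, h]

theorem head_of_expanded {a : Dir} (h : p.ext = some a) : p.head = p.tail + dir a := by
  simp [head, h]

theorem nodes_of_contracted (h : p.ext = none) : p.nodes = {p.tail} := by
  simp [nodes, p.head_of_contracted h]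

theorem head_ne_tail {a : Dir} (h : p.ext = some a) : p.head ≠ p.tail := by
  rw [p.head_of_expanded h]; simpa using dir_ne_zero a

theorem edge_contracted (h : p.ext = none) {i : Fin 10} {w : Node} {k : Dir} :
    p.edge i = some (w, k) ↔ w = p.tail ∧ i = dirLabel (k - p.orient) := by
  simp only [edge, h, Option.map_none, Option.map_eq_some_iff, labelEdge_none_eq_some,
    Prod.mk.injEq, head_of_contracted p h, ite_self]
  constructor
  · rintro ⟨e, ⟨h1, rfl⟩, rfl, rfl⟩
    simp
  · rintro ⟨rfl, rfl⟩
    exact ⟨(true, k - p.orient), by simp⟩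

theorem edge_expanded {a : Dir} (h : p.ext = some a) {i : Fin 10} {w : Node} {k : Dir} :
    p.edge i = some (w, k) ↔
      (labelEdge (some (a - p.orient)) i = some (true, k - p.orient) ∧ w = p.head) ∨
      (labelEdge (some (a - p.orient)) i = some (false, k - p.orient) ∧ w = p.tail) := by
  simp only [edge, h, Option.map_some, Option.map_eq_some_iff, Prod.mk.injEq]
  constructor
  · rintro ⟨⟨b, e⟩, h1, rfl, rfl⟩
    cases b <;> simp [h1]
  · rintro (⟨h1, rfl⟩ | ⟨h1, rfl⟩)
    · exact ⟨_, h1, by simp⟩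
    · exact ⟨_, h1, by simp⟩

theorem edge_inj {i j : Fin 10} {e : Node × Dir} (hi : p.edge i = some e)
    (hj : p.edge j = some e) : i = j := by
  obtain ⟨w, k⟩ := e
  rcases hp : p.ext with _ | a
  · rw [edge_contracted p hp] at hi hj
    rw [hi.2, hj.2]
  · rw [edge_expanded p hp] at hi hj
    have := p.head_ne_tail hp
    rcases hi with ⟨hi, rfl⟩ | ⟨hi, rfl⟩ <;> rcases hj with ⟨hj, hj'⟩ | ⟨hj, hj'⟩
    · exact labelEdge_some_inj (hi.trans hj.symm)
    · exact absurd hj' this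
    · exact absurd hj'.symm this
    · exact labelEdge_some_inj (hi.trans hj.symm)

/-- The labelled edges are those that leave the particle. -/
theorem exists_edge_iff {w : Node} {k : Dir} :
    (∃ i, p.edge i = some (w, k)) ↔ w ∈ p.nodes ∧ w + dir k ∉ p.nodes := by
  rcases hp : p.ext with _ | a
  · simp only [edge_contracted p hp, nodes_of_contracted p hp, Set.mem_singleton_iff,
      exists_and_left, exists_eq, and_true]
    refine ⟨?_, fun h => h.1⟩
    rintro rfl
    simpa using dir_ne_zero k
  · have ht : p.tail + dir k = p.head ↔ (false, k - p.orient) = (false, a - p.orient) := by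
      simp [p.head_of_expanded hp, dir_injective.eq_iff]
    have hh : p.head + dir k = p.tail ↔ (true, k - p.orient) = (true, a - p.orient + 3) := by
      rw [p.head_of_expanded hp, add_assoc, add_eq_left, add_comm, add_eq_zero_iff_eq_neg,
        ← dir_opp, dir_injective.eq_iff, Prod.mk.injEq, sub_add_eq_add_sub, sub_left_inj]
      simp
    have h0 : ∀ w : Node, w + dir k ≠ w := fun w => by simpa using dir_ne_zero k
    simp only [edge_expanded p hp, exists_or, exists_and_right, exists_labelEdge_iff, nodes,
      Set.mem_insert_iff, Set.mem_singleton_iff, ne_eq]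
    constructor
    · rintro (⟨⟨-, h2⟩, rfl⟩ | ⟨⟨h1, -⟩, rfl⟩)
      · rw [← hh] at h2; exact ⟨Or.inr rfl, fun h => h.elim h2 (h0 _)⟩
      · rw [← ht] at h1; exact ⟨Or.inl rfl, fun h => h.elim (h0 _) h1⟩
    · rintro ⟨rfl | rfl, h⟩
      · exact Or.inr ⟨⟨fun h' => h (Or.inr (ht.mpr h')), by simp⟩, rfl⟩
      · exact Or.inl ⟨⟨by simp, fun h' => h (Or.inl (hh.mpr h'))⟩, rfl⟩

end Particle

namespace Config

variable {A : Algorithm} {n : ℕ} {c : Config A n}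

theorem Disjointed.eq_of_mem (hc : c.Disjointed) {p q : Fin n} {w : Node}
    (hp : w ∈ (c.part p).nodes) (hq : w ∈ (c.part q).nodes) : p = q := by
  by_contra h
  exact Set.disjoint_left.mp (hc.2 p q h) hp hq

theorem flagAt_of_edge (hc : c.Disjointed) {q : Fin n} {j : Fin 10} {w : Node} {k : Dir}
    (h : (c.part q).edge j = some (w, k)) : c.flagAt w k = some ((c.part q).flags j) := by
  classical
  have hex : ∃ x : Fin n × Fin 10, (c.part x.1).edge x.2 = some (w, k) := ⟨(q, j), h⟩
  rw [flagAt, dif_pos hex]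
  have hspec := hex.choose_spec
  have hq : hex.choose.1 = q := hc.eq_of_mem
    ((Particle.exists_edge_iff _).mp ⟨_, hspec⟩).1 ((Particle.exists_edge_iff _).mp ⟨_, h⟩).1
  rw [hq] at hspec ⊢
  rw [Particle.edge_inj _ hspec h]

theorem flagAt_of_mem_obj (hc : c.Disjointed) {w : Node} (k : Dir) (h : w ∈ c.obj) :
    ∃ i, c.flagAt w k = some (A.objFlags i) := by
  classical
  rw [flagAt, dif_neg, if_pos h]
  · exact ⟨_, rfl⟩
  · rintro ⟨⟨q, j⟩, hq⟩
    exact Set.disjoint_left.mp (hc.1 q) ((Particle.exists_edge_iff _).mp ⟨_, hq⟩).1 h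

theorem flagAt_eq_some {w : Node} {k : Dir} {f : A.Flag} (h : c.flagAt w k = some f) :
    (∃ q j, (c.part q).edge j = some (w, k) ∧ f = (c.part q).flags j) ∨
      (w ∈ c.obj ∧ ∃ i, f = A.objFlags i) := by
  classical
  rw [flagAt] at h
  split_ifs at h with h1 h2
  · exact Or.inl ⟨_, _, h1.choose_spec, (Option.some.inj h).symm⟩
  · exact Or.inr ⟨h2, _, (Option.some.inj h).symm⟩

theorem read_of_edge {p : Fin n} {i : Fin 10} {w : Node} {k : Dir}
    (h : (c.part p).edge i = some (w, k)) : c.read p i = c.flagAt (w + dir k) (k + 3) := by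
  rw [read, h]; rfl

theorem read_eq_some {p : Fin n} {i : Fin 10} {f : A.Flag} (h : c.read p i = some f) :
    ∃ w k, (c.part p).edge i = some (w, k) ∧
      ((∃ q j, q ≠ p ∧ (c.part q).edge j = some (w + dir k, k + 3) ∧ f = (c.part q).flags j) ∨
      (w + dir k ∈ c.obj ∧ ∃ i, f = A.objFlags i)) := by
  rcases he : (c.part p).edge i with _ | ⟨w, k⟩
  · rw [read, he] at h; cases h
  · rw [read_of_edge he] at h
    refine ⟨w, k, rfl, (flagAt_eq_some h).imp_left ?_⟩
    rintro ⟨q, j, hq, hf⟩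
    refine ⟨q, j, ?_, hq, hf⟩
    rintro rfl
    exact ((Particle.exists_edge_iff _).mp ⟨_, he⟩).2 ((Particle.exists_edge_iff _).mp ⟨_, hq⟩).1

theorem exists_read (hc : c.Disjointed) {p q : Fin n} (hpq : q ≠ p) {w : Node} {k : Dir}
    (hp : w ∈ (c.part p).nodes) (hq : w + dir k ∈ (c.part q).nodes) :
    ∃ i j, (c.part p).edge i = some (w, k) ∧ (c.part q).edge j = some (w + dir k, k + 3) ∧
      c.read p i = some ((c.part q).flags j) := by
  obtain ⟨i, hi⟩ := (Particle.exists_edge_iff (c.part p)).mpr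
    ⟨hp, fun h => hpq (hc.eq_of_mem hq h)⟩
  obtain ⟨j, hj⟩ := (Particle.exists_edge_iff (c.part q) (w := w + dir k) (k := k + 3)).mpr
    ⟨hq, fun h => hpq (hc.eq_of_mem h (by rwa [add_dir_opp]))⟩
  exact ⟨i, j, hi, hj, by rw [read_of_edge hi, flagAt_of_edge hc hj]⟩

end Config

namespace Coating

/-! ### Coating in global directions -/

/-- The data of a particle of the coating algorithm in global directions, without orientation:
phase, occupied nodes, the direction `d` and the direction of the complaint indicator. -/
structure Agent where
  phase : Phase
  tail : Node
  ext : Option Dir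
  d : Dir
  comp : Option Dir

namespace Agent

def head (s : Agent) : Node :=
  match s.ext with
  | none => s.tail
  | some a => s.tail + dir a

def nodes (s : Agent) : Set Node := {s.tail, s.head}

theorem tail_mem_nodes (s : Agent) : s.tail ∈ s.nodes := Or.inl rfl

theorem head_mem_nodes (s : Agent) : s.head ∈ s.nodes := Or.inr rfl

theorem head_of_contracted {s : Agent} (h : s.ext = none) : s.head = s.tail := by simp [head, h]

theorem head_of_expanded {s : Agent} {a : Dir} (h : s.ext = some a) :
    s.head = s.tail + dir a := by simp [head, h]

theorem nodes_of_contracted {s : Agent} (h : s.ext = none) : s.nodes = {s.tail} := by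
  simp [nodes, head_of_contracted h]

theorem head_ne_tail {s : Agent} {a : Dir} (h : s.ext = some a) : s.head ≠ s.tail := by
  rw [head_of_expanded h]; simpa using dir_ne_zero a

/-- The agent shows a follow indicator on an edge to the node `v`. -/
def Follows (s : Agent) (v : Node) : Prop := s.phase = Phase.follow ∧ s.head + dir s.d = v

/-- The agent shows a complaint indicator on an edge to the node `v`. -/
def Complains (s : Agent) (v : Node) : Prop := ∃ k, s.comp = some k ∧ s.head + dir k = v

end Agent

/-- The agent `s` describes the particle `x`. -/
structure Describes {pick : Finset (Fin 10) → Fin 10} (s : Agent)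
    (x : Particle (coating pick)) : Prop where
  phase : State.phase x.state = s.phase
  shape : State.shape x.state = s.ext.map (· - x.orient)
  d : State.d x.state = s.d - x.orient
  tail : x.tail = s.tail
  ext : x.ext = s.ext
  flags : x.flags = mkFlags x.state (s.comp.map (· - x.orient))

/-- The flag `f` can be shown by the agent `s` on the edge that leaves its node `w` in
direction `k`. -/
structure FlagOf (f : Flag) (s : Agent) (w : Node) (k : Dir) : Prop where
  ne_object : f ≠ Flag.object
  active : f.Active ↔ s.phase ≠ Phase.inactive
  inactive : f.Inactive ↔ s.phase = Phase.inactive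
  follow : f.Follow ↔ s.phase = Phase.follow ∧ w = s.head ∧ k = s.d
  complaint : f.Complaint ↔ s.comp = some k ∧ w = s.head
  contracted : f.Contracted ↔ s.ext = none
  expandedTail : f.ExpandedTail ↔ s.ext ≠ none ∧ w = s.tail
  contractionDir : ∀ o d : Dir, k = d + o + 3 → f.contractionDir d = s.ext.map (· - o)

namespace Describes

variable {pick : Finset (Fin 10) → Fin 10} {s : Agent} {x : Particle (coating pick)}

theorem head (h : Describes s x) : x.head = s.head := by
  rcases hs : s.ext with _ | a
  · rw [x.head_of_contracted (h.ext.trans hs), Agent.head_of_contracted hs, h.tail]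
  · rw [x.head_of_expanded (h.ext.trans hs), Agent.head_of_expanded hs, h.tail]

theorem nodes (h : Describes s x) : x.nodes = s.nodes := by
  simp only [Particle.nodes, Agent.nodes, h.head, h.tail]

theorem labelEdge_head (h : Describes s x) {j : Fin 10} {w : Node} {k : Dir}
    (hj : x.edge j = some (w, k)) (k' : Dir) :
    labelEdge (State.shape x.state) j = some (true, k') ↔ w = s.head ∧ k = k' + x.orient := by
  rw [h.shape]
  rcases hs : s.ext with _ | a
  · have hx := h.ext.trans hs
    rw [x.edge_contracted hx] at hj
    rw [Option.map_none, labelEdge_none_eq_some, hj.1, hj.2, h.tail,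
      Agent.head_of_contracted hs]
    simp only [true_and]
    have : Function.Injective dirLabel := by
      intro a b; revert a b; decide
    rw [this.eq_iff, sub_eq_iff_eq_add]
  · have hx := h.ext.trans hs
    rw [x.edge_expanded hx, h.head, h.tail] at hj
    have hne := Agent.head_ne_tail hs
    rw [Option.map_some]
    rcases hj with ⟨hj, rfl⟩ | ⟨hj, rfl⟩
    · simp [hj, sub_eq_iff_eq_add]
    · simp [hj, hne.symm]

theorem labelEdge_tail (h : Describes s x) {j : Fin 10} {w : Node} {k : Dir}
    (hj : x.edge j = some (w, k)) :
    (∃ k', labelEdge (State.shape x.state) j = some (false, k')) ↔ s.ext ≠ none ∧ w = s.tail := by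
  rw [h.shape]
  rcases hs : s.ext with _ | a
  · simp [labelEdge_none_eq_some]
  · have hx := h.ext.trans hs
    rw [x.edge_expanded hx, h.head, h.tail] at hj
    have hne := Agent.head_ne_tail hs
    rw [Option.map_some]
    rcases hj with ⟨hj, rfl⟩ | ⟨hj, rfl⟩
    · simp [hj, hne]
    · simp [hj]

theorem flagOf (h : Describes s x) {j : Fin 10} {w : Node} {k : Dir}
    (hj : x.edge j = some (w, k)) : FlagOf (x.flags j) s w k := by
  have hl := h.labelEdge_head hj
  rw [h.flags]
  constructor
  · simp [mkFlags]
  · rw [← h.phase]; rfl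
  · rw [← h.phase]; rfl
  · simp only [mkFlags, Flag.Follow, decide_eq_true_eq]
    rw [hl, h.phase, h.d, sub_add_cancel]
  · simp only [mkFlags, Flag.Complaint, decide_eq_true_eq, hl, Option.map_eq_some_iff]
    constructor
    · rintro ⟨_, ⟨k', hk', rfl⟩, hw, rfl⟩
      rw [sub_add_cancel]
      exact ⟨hk', hw⟩
    · rintro ⟨hk, hw⟩
      exact ⟨_, ⟨_, hk, rfl⟩, hw, by rw [sub_add_cancel]⟩
  · simp [mkFlags, Flag.Contracted, h.shape]
  · simp only [mkFlags, Flag.ExpandedTail, h.labelEdge_tail hj]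
    simp [h.shape]
  · intro o d hk
    obtain ⟨e, he, hek⟩ : ∃ e, labelEdge (State.shape x.state) j = some e ∧ k = e.2 + x.orient := by
      have := hj
      rw [Particle.edge, Option.map_eq_some_iff] at this
      obtain ⟨e, he, hek⟩ := this
      refine ⟨e, ?_, (congrArg Prod.snd hek).symm⟩
      rw [h.shape, ← h.ext, he]
    simp only [mkFlags, Flag.contractionDir, he]
    rw [h.shape]
    rcases hs : s.ext with _ | a
    · rfl
    · simp only [Option.map_some, Option.bind_some, Option.some.injEq]
      rw [eq_sub_of_add_eq hek.symm, hk]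
      abel

end Describes

/-! ### What a particle reads -/

/-- What the particle `p` reads. -/
noncomputable def reading {pick : Finset (Fin 10) → Fin 10} {n : ℕ} (c : Config (coating pick) n)
    (p : Fin n) : Reading := c.read p

/-- The state of the particle `p`. -/
def stateOf {pick : Finset (Fin 10) → Fin 10} {n : ℕ} (c : Config (coating pick) n)
    (p : Fin n) : State := (c.part p).state

/-- The agents of `S` describe the particles of the configuration `c`, in which no node is
occupied twice. -/
structure Represents {pick : Finset (Fin 10) → Fin 10} {n : ℕ} (S : Fin n → Agent)
    (c : Config (coating pick) n) : Prop where
  disjointed : c.Disjointed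
  describes : ∀ p, Describes (S p) (c.part p)

/-- Another agent shows a follow or a complaint indicator to the tail of the agent `p`.  If `p` is
contracted, it reads this indicator. -/
def Stimulated {n : ℕ} (S : Fin n → Agent) (p : Fin n) : Prop :=
  ∃ q, q ≠ p ∧ ((S q).Follows (S p).tail ∨ (S q).Complains (S p).tail)

namespace Represents

variable {pick : Finset (Fin 10) → Fin 10} {n : ℕ} {S : Fin n → Agent}
  {c : Config (coating pick) n}

theorem phase_eq (h : Represents S c) (p : Fin n) : (stateOf c p).phase = (S p).phase :=
  (h.describes p).phase

theorem shape_eq (h : Represents S c) (p : Fin n) :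
    (stateOf c p).shape = (S p).ext.map (· - (c.part p).orient) := (h.describes p).shape

theorem d_eq (h : Represents S c) (p : Fin n) :
    (stateOf c p).d = (S p).d - (c.part p).orient := (h.describes p).d

theorem tail_notMem (h : Represents S c) (p : Fin n) : (S p).tail ∉ c.obj := by
  rw [← (h.describes p).tail]
  exact Set.disjoint_left.mp (h.disjointed.1 p) (Particle.tail_mem_nodes _)

theorem eq_of_mem (h : Represents S c) {p q : Fin n} {w : Node} (hp : w ∈ (S p).nodes)
    (hq : w ∈ (S q).nodes) : p = q :=
  h.disjointed.eq_of_mem (by rwa [(h.describes p).nodes]) (by rwa [(h.describes q).nodes])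

theorem mem_occupied (h : Represents S c) {w : Node} :
    w ∈ c.occupied ↔ w ∈ c.obj ∨ ∃ p, w ∈ (S p).nodes := by
  simp only [Config.occupied, Set.mem_union, Set.mem_iUnion, (h.describes _).nodes]

theorem read_elim (h : Represents S c) {p : Fin n} {i : Fin 10} {f : Flag}
    (hf : reading c p i = some f) : ∃ w k, (c.part p).edge i = some (w, k) ∧ w ∈ (S p).nodes ∧
      ((w + dir k ∈ c.obj ∧ f = Flag.object) ∨
        ∃ q, q ≠ p ∧ w + dir k ∈ (S q).nodes ∧ FlagOf f (S q) (w + dir k) (k + 3)) := by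
  obtain ⟨w, k, hi, hf'⟩ := Config.read_eq_some hf
  refine ⟨w, k, hi, ?_, ?_⟩
  · rw [← (h.describes p).nodes]; exact ((Particle.exists_edge_iff _).mp ⟨_, hi⟩).1
  · rcases hf' with ⟨q, j, hqp, hj, rfl⟩ | ⟨hw, i, rfl⟩
    · refine Or.inr ⟨q, hqp, ?_, (h.describes q).flagOf hj⟩
      rw [← (h.describes q).nodes]; exact ((Particle.exists_edge_iff _).mp ⟨_, hj⟩).1
    · exact Or.inl ⟨hw, rfl⟩

theorem read_intro (h : Represents S c) {p q : Fin n} (hqp : q ≠ p) {w : Node} {k : Dir}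
    (hp : w ∈ (S p).nodes) (hq : w + dir k ∈ (S q).nodes) :
    ∃ i f, (c.part p).edge i = some (w, k) ∧ reading c p i = some f ∧
      FlagOf f (S q) (w + dir k) (k + 3) := by
  obtain ⟨i, j, hi, hj, hr⟩ := Config.exists_read h.disjointed hqp
    (by rwa [(h.describes p).nodes]) (by rwa [(h.describes q).nodes])
  exact ⟨i, _, hi, hr, (h.describes q).flagOf hj⟩

theorem edge_contracted (h : Represents S c) {p : Fin n} (hp : (S p).ext = none) {i : Fin 10}
    {w : Node} {k : Dir} : (c.part p).edge i = some (w, k) ↔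
      w = (S p).tail ∧ i = dirLabel (k - (c.part p).orient) := by
  rw [Particle.edge_contracted _ ((h.describes p).ext.trans hp), (h.describes p).tail]

theorem read_object (h : Represents S c) {p : Fin n} (hp : (S p).ext = none) (k : Dir) :
    reading c p (dirLabel (k - (c.part p).orient)) = some Flag.object ↔
      (S p).tail + dir k ∈ c.obj := by
  have he := (h.edge_contracted hp).mpr (⟨rfl, rfl⟩ : _ = _ ∧ _ = dirLabel (k - _))
  constructor
  · intro hf
    obtain ⟨w, k', hi, -, hf' | ⟨q, -, -, hf'⟩⟩ := h.read_elim hf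
    · rw [he] at hi
      cases hi
      exact hf'.1
    · exact absurd rfl hf'.ne_object
  · intro hk
    obtain ⟨i, hi⟩ := Config.flagAt_of_mem_obj h.disjointed (k + 3) hk
    exact (Config.read_of_edge he).trans hi

theorem sees_object (h : Represents S c) {p : Fin n} (hp : (S p).ext = none) :
    Sees (reading c p) (fun _ => True) (· = Flag.object) ↔ (S p).tail ∈ surface c.obj := by
  rw [mem_surface_iff]
  constructor
  · rintro ⟨i, -, f, hf, rfl⟩
    refine ⟨h.tail_notMem p, ?_⟩
    obtain ⟨w, k', hi, -, hf' | ⟨q, -, -, hf'⟩⟩ := h.read_elim hf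
    · rw [h.edge_contracted hp] at hi
      exact ⟨k', hi.1 ▸ hf'.1⟩
    · exact absurd rfl hf'.ne_object
  · rintro ⟨-, k, hk⟩
    exact ⟨_, trivial, _, (h.read_object hp k).mpr hk, rfl⟩

theorem sees_stimulus (h : Represents S c) {p : Fin n} (hp : (S p).ext = none) :
    Sees (reading c p) (fun _ => True) (fun f => f.Follow ∨ f.Complaint) ↔ Stimulated S p := by
  constructor
  · rintro ⟨i, -, f, hf, hst⟩
    obtain ⟨w, k, hi, -, ⟨-, rfl⟩ | ⟨q, hqp, hq, hf'⟩⟩ := h.read_elim hf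
    · rcases hst with h | h <;> cases h
    · rw [h.edge_contracted hp] at hi
      refine ⟨q, hqp, hst.imp ?_ ?_⟩
      · rw [hf'.follow]
        rintro ⟨h1, h2, h3⟩
        exact ⟨h1, by rw [← h2, ← h3, add_dir_opp, hi.1]⟩
      · rw [hf'.complaint]
        rintro ⟨h1, h2⟩
        exact ⟨_, h1, by rw [← h2, add_dir_opp, hi.1]⟩
  · rintro ⟨q, hqp, hst⟩
    obtain ⟨k, hk⟩ : ∃ k, (S q).head + dir k = (S p).tail ∧
        ((S q).phase = Phase.follow ∧ k = (S q).d ∨ (S q).comp = some k) := by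
      rcases hst with ⟨h1, h2⟩ | ⟨k, h1, h2⟩
      · exact ⟨_, h2, Or.inl ⟨h1, rfl⟩⟩
      · exact ⟨k, h2, Or.inr h1⟩
    have e1 : (S p).tail + dir (k + 3) = (S q).head := by rw [← hk.1, add_dir_opp]
    have e2 : k + 3 + 3 = k := by clear * -; decide +revert
    obtain ⟨i, f, -, hr, hf⟩ := h.read_intro hqp (S p).tail_mem_nodes (k := k + 3)
      (by rw [e1]; exact (S q).head_mem_nodes)
    refine ⟨i, trivial, f, hr, ?_⟩
    show f.Follow ∨ f.Complaint
    rw [hf.follow, hf.complaint, e1, e2]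
    rcases hk.2 with h' | h'
    · exact Or.inl ⟨h'.1, rfl, h'.2⟩
    · exact Or.inr ⟨h', rfl⟩

theorem sees_follow_tail (h : Represents S c) {p : Fin n} {a : Dir} (hp : (S p).ext = some a)
    {F : Flag → Prop} {F' : Agent → Prop}
    (hF : ∀ f s w k, FlagOf f s w k → (F f ↔ F' s)) :
    Sees (reading c p) (TailLabel (stateOf c p).shape) (fun f => f.Follow ∧ F f) ↔
      ∃ q, q ≠ p ∧ (S q).Follows (S p).tail ∧ F' (S q) := by
  constructor
  · rintro ⟨i, hi', f, hf, hfo, hF1⟩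
    obtain ⟨w, k, hi, -, ⟨-, rfl⟩ | ⟨q, hqp, hq, hf'⟩⟩ := h.read_elim hf
    · cases hfo
    · replace hi' := ((h.describes p).labelEdge_tail hi).mp hi'
      obtain ⟨h1, h2, h3⟩ := hf'.follow.mp hfo
      exact ⟨q, hqp, ⟨h1, by rw [← h2, ← h3, add_dir_opp, hi'.2]⟩, (hF _ _ _ _ hf').mp hF1⟩
  · rintro ⟨q, hqp, ⟨h1, h2⟩, h3⟩
    have e1 : (S p).tail + dir ((S q).d + 3) = (S q).head := by rw [← h2, add_dir_opp]
    have e2 : (S q).d + 3 + 3 = (S q).d := by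
      generalize (S q).d = k; clear * -; decide +revert
    obtain ⟨i, f, hi, hr, hf⟩ := h.read_intro hqp (S p).tail_mem_nodes (k := (S q).d + 3)
      (by rw [e1]; exact (S q).head_mem_nodes)
    refine ⟨i, ?_, f, hr, hf.follow.mpr ⟨h1, e1, e2⟩, (hF _ _ _ _ hf).mpr h3⟩
    exact ((h.describes p).labelEdge_tail hi).mpr ⟨by simp [hp], rfl⟩

theorem sees_inactive (h : Represents S c) {p : Fin n} :
    Sees (reading c p) (fun _ => True) Flag.Inactive ↔
      ∃ q, q ≠ p ∧ (S q).phase = Phase.inactive ∧ ∃ w ∈ (S p).nodes, ∃ k,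
        w + dir k ∈ (S q).nodes := by
  constructor
  · rintro ⟨i, -, f, hf, hin⟩
    obtain ⟨w, k, -, hw, ⟨-, rfl⟩ | ⟨q, hqp, hq, hf'⟩⟩ := h.read_elim hf
    · cases hin
    · exact ⟨q, hqp, hf'.inactive.mp hin, w, hw, k, hq⟩
  · rintro ⟨q, hqp, hq, w, hw, k, hk⟩
    obtain ⟨i, f, -, hr, hf⟩ := h.read_intro hqp hw hk
    exact ⟨i, trivial, f, hr, hf.inactive.mpr hq⟩

/-- A neighboring agent that is seen by a contracted one. -/
theorem read_active (h : Represents S c) {p : Fin n} (hp : (S p).ext = none) {i : Fin 10}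
    {f : Flag} (hf : reading c p i = some f) (hact : f.Active) :
    ∃ k q, q ≠ p ∧ i = dirLabel (k - (c.part p).orient) ∧ (S p).tail + dir k ∈ (S q).nodes ∧
      (S q).phase ≠ Phase.inactive := by
  obtain ⟨w, k, hi, hw, ⟨-, rfl⟩ | ⟨q, hqp, hq, hf'⟩⟩ := h.read_elim hf
  · cases hact
  · rw [h.edge_contracted hp] at hi
    exact ⟨k, q, hqp, hi.2, hi.1 ▸ hq, hf'.active.mp hact⟩

theorem skipObject_spec (r : Reading) (k : Dir) (i : Dir)
    (hi : r (dirLabel i) = some Flag.object) (hk : r (dirLabel k) ≠ some Flag.object) :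
    r (dirLabel (skipObject r 6 i)) ≠ some Flag.object ∧
      r (dirLabel (skipObject r 6 i + 1)) = some Flag.object := by
  classical
  have key : ∀ (m : ℕ) (i : Dir), r (dirLabel (i + 1)) = some Flag.object →
      (i - k).val ≤ m → r (dirLabel (skipObject r m i)) ≠ some Flag.object ∧
        r (dirLabel (skipObject r m i + 1)) = some Flag.object := by
    intro m
    induction m with
    | zero =>
      intro i hi him
      have : i = k := by
        have : i - k = 0 := Fin.ext (by simpa using him)
        exact sub_eq_zero.mp this
      subst this
      exact ⟨hk, hi⟩
    | succ m ih =>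
      intro i hi him
      rw [skipObject]
      split_ifs with h
      · refine ih (i - 1) (by rwa [sub_add_cancel]) ?_
        have hne : i ≠ k := fun h' => hk (h' ▸ h)
        clear ih hi h hk
        have : ∀ i k : Dir, i ≠ k → (i - 1 - k).val + 1 = (i - k).val := by decide
        have := this i k hne
        omega
      · exact ⟨h, hi⟩
  have : skipObject r 6 i = skipObject r 5 (i - 1) := by
    rw [skipObject, if_pos hi]
  rw [this]
  exact key 5 (i - 1) (by rwa [sub_add_cancel]) (by omega)

theorem surfaceDir_eq (h : Represents S c) {sd : Node → Dir} {pos : Node → ℤ}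
    (hsd : SurfaceCoordinates c.obj sd pos)
    (hpick : ∀ S : Finset (Fin 10), S.Nonempty → pick S ∈ S) {p : Fin n}
    (hp : (S p).ext = none) (hs : (S p).tail ∈ surface c.obj) :
    surfaceDir pick (reading c p) = sd (S p).tail - (c.part p).orient := by
  classical
  have hne : ({i | reading c p i = some Flag.object} : Finset (Fin 10)).Nonempty := by
    obtain ⟨-, k, hk⟩ := mem_surface_iff.mp hs
    exact ⟨_, Finset.mem_filter.mpr ⟨Finset.mem_univ _, (h.read_object hp k).mpr hk⟩⟩
  have hmem := (Finset.mem_filter.mp (hpick _ hne)).2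
  obtain ⟨w, k, hi, -⟩ := h.read_elim hmem
  rw [h.edge_contracted hp] at hi
  have hl : dirLabel (labelDir (pick {i | reading c p i = some Flag.object})) =
      pick {i | reading c p i = some Flag.object} := by
    rw [hi.2]; generalize k - _ = j; clear * -; decide +revert
  have hspec := skipObject_spec (reading c p) (sd (S p).tail - (c.part p).orient)
    (labelDir (pick {i | reading c p i = some Flag.object})) (by rw [hl]; exact hmem)
    (by rw [ne_eq, h.read_object hp]; exact hsd.notMem _ hs)
  have hdef : surfaceDir pick (reading c p) =
      skipObject (reading c p) 6 (labelDir (pick {i | reading c p i = some Flag.object})) := by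
    rw [surfaceDir]
  rw [← hdef] at hspec
  have e1 : surfaceDir pick (reading c p) =
    (surfaceDir pick (reading c p) + (c.part p).orient) - (c.part p).orient := by abel
  have e2 : surfaceDir pick (reading c p) + 1 =
    (surfaceDir pick (reading c p) + (c.part p).orient + 1) - (c.part p).orient := by abel
  rw [e2, h.read_object hp, ne_eq, e1, h.read_object hp, sub_add_cancel] at hspec
  rw [e1, hsd.unique _ hs _ hspec.1 hspec.2]

theorem forall_expandedTail_iff (h : Represents S c) {p : Fin n} (hp : (S p).ext = none)
    {k : Dir} (hk : (S p).tail + dir k ∉ c.obj) :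
    (∀ f, reading c p (dirLabel (k - (c.part p).orient)) = some f → f.ExpandedTail) ↔
      ∀ q, q ≠ p → (S p).tail + dir k ∈ (S q).nodes →
        (S q).ext ≠ none ∧ (S p).tail + dir k = (S q).tail := by
  have he := (h.edge_contracted hp).mpr (⟨rfl, rfl⟩ : _ = _ ∧ _ = dirLabel (k - _))
  constructor
  · intro hf q hqp hq
    obtain ⟨i, f, hi, hr, hf'⟩ := h.read_intro hqp (S p).tail_mem_nodes hq
    rw [h.edge_contracted hp] at hi
    rw [hi.2] at hr
    exact hf'.expandedTail.mp (hf f hr)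
  · intro hq f hf
    obtain ⟨w, k', hi, -, ⟨hw, -⟩ | ⟨q, hqp, hq', hf'⟩⟩ := h.read_elim hf
    · rw [he] at hi; cases hi; exact absurd hw hk
    · rw [he] at hi; cases hi
      exact hf'.expandedTail.mpr (hq q hqp hq')

end Represents

/-! ### The actions of agents -/

/-- The actions of the coating algorithm in terms of agents, for an object `C` with surface
directions `sd`. -/
inductive AgentStep (C : Set Node) (sd : Node → Dir) {n : ℕ} (S : Fin n → Agent) :
    Action n → (Fin n → Agent) → Prop
  | lead (p : Fin n) (hp : (S p).phase ≠ Phase.lead) (he : (S p).ext = none)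
      (hs : (S p).tail ∈ surface C) :
      AgentStep C sd S (Action.idle p)
        (Function.update S p { S p with phase := Phase.lead, comp := none })
  | follow (p q : Fin n) (k : Dir) (hp : (S p).phase = Phase.inactive) (he : (S p).ext = none)
      (hs : (S p).tail ∉ surface C) (hqp : q ≠ p) (hq : (S q).phase ≠ Phase.inactive)
      (hk : (S p).tail + dir k ∈ (S q).nodes) :
      AgentStep C sd S (Action.idle p)
        (Function.update S p { S p with phase := Phase.follow, d := k, comp := none })
  | complain (p q : Fin n) (hp : (S p).phase = Phase.lead) (he : (S p).ext = none)
      (hqp : q ≠ p) (hq : (S p).tail + dir (sd (S p).tail) ∈ (S q).nodes) :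
      AgentStep C sd S (Action.idle p)
        (Function.update S p { S p with comp := some (sd (S p).tail) })
  | expand (p : Fin n) (hp : (S p).phase = Phase.lead) (he : (S p).ext = none)
      (hst : Stimulated S p) (hfree : ∀ q, (S p).tail + dir (sd (S p).tail) ∉ (S q).nodes) :
      AgentStep C sd S (Action.single p)
        (Function.update S p { S p with ext := some (sd (S p).tail), comp := none })
  | contract (p : Fin n) (a : Dir) (he : (S p).ext = some a)
      (hf : ∀ q, q ≠ p → ¬ (S q).Follows (S p).tail)
      (hi : ∀ q, q ≠ p → (S q).phase = Phase.inactive → ∀ w ∈ (S p).nodes, ∀ k,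
        w + dir k ∉ (S q).nodes) :
      AgentStep C sd S (Action.single p)
        (Function.update S p { S p with tail := (S p).head, ext := none, comp := none })
  | handoverFollow (p q : Fin n) (a : Dir) (hpq : p ≠ q) (he : (S p).ext = some a)
      (hq : (S q).phase = Phase.follow) (hqe : (S q).ext = none)
      (hs : (S q).tail ∉ surface C) (hd : (S q).tail + dir (S q).d = (S p).tail) :
      AgentStep C sd S (Action.handover p q)
        (Function.update
          (Function.update S p { S p with tail := (S p).head, ext := none, comp := none })
          q { S q with ext := some (S q).d, d := a, comp := none })
  | handoverLead (p q : Fin n) (a : Dir) (hpq : p ≠ q) (he : (S p).ext = some a)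
      (hq : (S q).phase = Phase.lead) (hqe : (S q).ext = none) (hst : Stimulated S q)
      (hd : (S q).tail + dir (sd (S q).tail) = (S p).tail) :
      AgentStep C sd S (Action.handover p q)
        (Function.update
          (Function.update S p { S p with tail := (S p).head, ext := none, comp := none })
          q { S q with ext := some (sd (S q).tail), comp := none })

theorem turn_inactive {pick : Finset (Fin 10) → Fin 10} {s : State} (r : Reading)
    (hs : s.phase = Phase.inactive) : turn pick s r = inactiveTurn pick s r := by
  simp [turn, hs]

theorem turn_expanded {pick : Finset (Fin 10) → Fin 10} {s : State} (r : Reading) {a : Dir}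
    (hs : s.phase ≠ Phase.inactive) (ha : s.shape = some a) :
    turn pick s r = expandedTurn s a r := by
  rw [turn, ha]
  rcases h : s.phase <;> simp_all

theorem turn_follow {pick : Finset (Fin 10) → Fin 10} {s : State} (r : Reading)
    (hs : s.phase = Phase.follow) (ha : s.shape = none) :
    turn pick s r = followTurn s r := by
  simp [turn, hs, ha]

theorem turn_lead {pick : Finset (Fin 10) → Fin 10} {s : State} (r : Reading)
    (hs : s.phase = Phase.lead) (ha : s.shape = none) :
    turn pick s r = leadTurn pick s r := by
  simp [turn, hs, ha]

namespace Represents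

variable {pick : Finset (Fin 10) → Fin 10} {n : ℕ} {S : Fin n → Agent}
  {c : Config (coating pick) n} {p : Fin n} {t : Turn State Flag}

theorem mem_turns : t ∈ c.turns p ↔ turn pick (stateOf c p) (reading c p) = some t := Iff.rfl

theorem turns_inactive (h : Represents S c)
    (hpick : ∀ S : Finset (Fin 10), S.Nonempty → pick S ∈ S)
    (hp : (S p).phase = Phase.inactive) (he : (S p).ext = none) (ht : t ∈ c.turns p) :
    ((S p).tail ∈ surface c.obj ∧
      t = mkTurn { stateOf c p with phase := Phase.lead } none Move.idle) ∨
    ((S p).tail ∉ surface c.obj ∧ ∃ k q, q ≠ p ∧ (S p).tail + dir k ∈ (S q).nodes ∧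
      (S q).phase ≠ Phase.inactive ∧
      t = mkTurn { stateOf c p with phase := Phase.follow, d := k - (c.part p).orient } none
        Move.idle) := by
  classical
  rw [mem_turns, turn_inactive _ ((h.phase_eq p).trans hp), inactiveTurn] at ht
  split_ifs at ht with h1 h2
  · rw [h.sees_object he] at h1
    exact Or.inl ⟨h1, (Option.some.inj ht).symm⟩
  · rw [h.sees_object he] at h1
    refine Or.inr ⟨h1, ?_⟩
    obtain ⟨i, -, f, hf, hact⟩ := h2
    have hmem := hpick {i | ∃ f, reading c p i = some f ∧ f.Active}
      ⟨i, Finset.mem_filter.mpr ⟨Finset.mem_univ _, f, hf, hact⟩⟩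
    obtain ⟨f', hf', hact'⟩ := (Finset.mem_filter.mp hmem).2
    obtain ⟨k, q, hqp, hi, hk, hq⟩ := h.read_active he hf' hact'
    refine ⟨k, q, hqp, hk, hq, ?_⟩
    have hl : labelDir (dirLabel (k - (c.part p).orient)) = k - (c.part p).orient := by
      generalize k - _ = j; clear * -; decide +revert
    have ht := (Option.some.inj ht).symm
    rw [← hl, ← hi]
    exact ht

theorem turns_follow (h : Represents S c) (hp : (S p).phase = Phase.follow)
    (he : (S p).ext = none) (ht : t ∈ c.turns p) :
    ((S p).tail ∈ surface c.obj ∧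
      t = mkTurn { stateOf c p with phase := Phase.lead } none Move.idle) ∨
    ((S p).tail ∉ surface c.obj ∧ ∃ q a, q ≠ p ∧ (S p).tail + dir (S p).d ∈ (S q).nodes ∧
      (S q).ext = some a ∧
      t = mkTurn { stateOf c p with
        shape := some ((stateOf c p).d), d := a - (c.part p).orient } none
        (Move.expand (dirLabel ((stateOf c p).d)))) := by
  rw [mem_turns, turn_follow _ ((h.phase_eq p).trans hp) (by rw [h.shape_eq, he]; rfl), followTurn] at ht
  split_ifs at ht with h1
  · rw [h.sees_object he] at h1
    exact Or.inl ⟨h1, (Option.some.inj ht).symm⟩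
  · rw [h.sees_object he] at h1
    refine Or.inr ⟨h1, ?_⟩
    rw [Option.map_eq_some_iff] at ht
    obtain ⟨d', hd', rfl⟩ := ht
    rw [Option.bind_eq_some_iff] at hd'
    obtain ⟨f, hf, hfd⟩ := hd'
    obtain ⟨w, k, hi, hw, ⟨-, rfl⟩ | ⟨q, hqp, hq, hf'⟩⟩ := h.read_elim hf
    · cases hfd
    · rw [h.edge_contracted he] at hi
      have hk : (stateOf c p).d = k - (c.part p).orient := by
        have : Function.Injective dirLabel := by
          intro a b; clear * -; decide +revert
        exact this hi.2
      rw [hf'.contractionDir (c.part p).orient _ (by rw [hk, sub_add_cancel]),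
        Option.map_eq_some_iff] at hfd
      obtain ⟨a, ha, rfl⟩ := hfd
      refine ⟨q, a, hqp, ?_, ha, rfl⟩
      rw [h.d_eq, sub_left_inj] at hk
      rw [hk, ← hi.1]
      exact hq

theorem turns_expanded (h : Represents S c) {a : Dir} (hp : (S p).phase ≠ Phase.inactive)
    (he : (S p).ext = some a) :
    t ∈ c.turns p ↔
    ((∃ q, q ≠ p ∧ (S q).Follows (S p).tail ∧ (S q).ext = none) ∧
      t = mkTurn { stateOf c p with shape := none } none
        (Move.handoverContract (headContractLabel (a - (c.part p).orient)))) ∨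
    ((∀ q, q ≠ p → ¬ (S q).Follows (S p).tail) ∧
      (∀ q, q ≠ p → (S q).phase = Phase.inactive → ∀ w ∈ (S p).nodes, ∀ k,
        w + dir k ∉ (S q).nodes) ∧
      t = mkTurn { stateOf c p with shape := none } none
        (Move.contract (headContractLabel (a - (c.part p).orient)))) := by
  rw [mem_turns, turn_expanded (a := a - (c.part p).orient) _
    (by rw [h.phase_eq]; exact hp) (by rw [h.shape_eq, he]; rfl), expandedTurn]
  have e1 := h.sees_follow_tail he (F := Flag.Contracted) (F' := fun s => s.ext = none)
    (fun f s w k hf => hf.contracted)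
  have e2 := h.sees_follow_tail he (F := fun _ => True) (F' := fun _ => True)
    (fun f s w k hf => Iff.rfl)
  simp only [and_true] at e2
  rw [e1, e2, h.sees_inactive]
  split_ifs with h1 h2
  · rw [Option.some.injEq]
    constructor
    · rintro rfl; exact Or.inl ⟨h1, rfl⟩
    · rintro (⟨-, rfl⟩ | ⟨h2, -⟩)
      · rfl
      · obtain ⟨q, hq, hf, -⟩ := h1
        exact absurd hf (h2 q hq)
  · rw [Option.some.injEq]
    push Not at h2
    constructor
    · rintro rfl; exact Or.inr ⟨h2.1, h2.2, rfl⟩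
    · rintro (⟨h3, -⟩ | ⟨-, -, rfl⟩)
      · exact absurd h3 h1
      · rfl
  · constructor
    · intro h; cases h
    · rintro (⟨h3, -⟩ | ⟨h3, h4, -⟩)
      · exact absurd h3 h1
      · refine absurd ⟨?_, ?_⟩ h2
        · push Not; exact h3
        · push Not; exact h4

theorem turns_lead (h : Represents S c) {sd : Node → Dir} {pos : Node → ℤ}
    (hsd : SurfaceCoordinates c.obj sd pos)
    (hpick : ∀ S : Finset (Fin 10), S.Nonempty → pick S ∈ S)
    (hp : (S p).phase = Phase.lead) (he : (S p).ext = none) (hs : (S p).tail ∈ surface c.obj) :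
    t ∈ c.turns p ↔ Stimulated S p ∧
    (((∀ q, q ≠ p → (S p).tail + dir (sd (S p).tail) ∈ (S q).nodes →
        (S q).ext ≠ none ∧ (S p).tail + dir (sd (S p).tail) = (S q).tail) ∧
      t = mkTurn { stateOf c p with shape := some (sd (S p).tail - (c.part p).orient) } none
        (Move.expand (dirLabel (sd (S p).tail - (c.part p).orient)))) ∨
    ((∃ q, q ≠ p ∧ (S p).tail + dir (sd (S p).tail) ∈ (S q).nodes ∧
        ¬ ((S q).ext ≠ none ∧ (S p).tail + dir (sd (S p).tail) = (S q).tail)) ∧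
      t = mkTurn (stateOf c p) (some (sd (S p).tail - (c.part p).orient)) Move.idle)) := by
  rw [mem_turns, turn_lead _ ((h.phase_eq p).trans hp) (by rw [h.shape_eq, he]; rfl), leadTurn,
    h.surfaceDir_eq hsd hpick he hs, h.sees_stimulus he]
  split_ifs with h1 h2 <;> try rw [h.forall_expandedTail_iff he (hsd.notMem _ hs)] at h2
  · rw [Option.some.injEq]
    constructor
    · rintro rfl; exact ⟨h1, Or.inl ⟨h2, rfl⟩⟩
    · rintro ⟨-, ⟨-, rfl⟩ | ⟨⟨q, hq, hk, hn⟩, -⟩⟩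
      · rfl
      · exact absurd (h2 q hq hk) hn
  · rw [Option.some.injEq]
    constructor
    · rintro rfl
      refine ⟨h1, Or.inr ⟨?_, rfl⟩⟩
      by_contra hcon
      exact h2 fun q hq hk => by_contra fun h3 => hcon ⟨q, hq, hk, h3⟩
    · rintro ⟨-, ⟨h3, -⟩ | ⟨-, rfl⟩⟩
      · exact absurd h3 h2
      · rfl
  · simp [h1]

end Represents

theorem contractsTo_iff {A : Algorithm} {x : Particle A} {a : Dir} (hx : x.ext = some a)
    {u v : Node} :
    x.ContractsTo (headContractLabel (a - x.orient)) u v ↔ u = x.head ∧ v = x.tail := by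
  have he : x.edge (headContractLabel (a - x.orient)) = some (x.head, a) := by
    rw [x.edge_expanded hx]
    exact Or.inl ⟨labelEdge_headContractLabel _, rfl⟩
  constructor
  · rintro ⟨b, -, ⟨-, hu, hv⟩ | ⟨h, -, -⟩⟩
    · exact ⟨hu, hv⟩
    · rw [he] at h
      exact absurd (congrArg Prod.fst (Option.some.inj h)) (x.head_ne_tail hx)
  · rintro ⟨rfl, rfl⟩
    exact ⟨a, hx, Or.inl ⟨he, rfl, rfl⟩⟩

theorem expandsAlong_iff {A : Algorithm} {x : Particle A} (hx : x.ext = none) {j k : Dir} :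
    x.ExpandsAlong (dirLabel (j - x.orient)) k ↔ k = j := by
  have : Function.Injective dirLabel := by
    intro a b; clear * -; decide +revert
  rw [Particle.ExpandsAlong, x.edge_contracted hx, this.eq_iff, sub_left_inj]
  simp [hx, eq_comm]

theorem describes_update {pick : Finset (Fin 10) → Fin 10} {n : ℕ} {S : Fin n → Agent}
    {c : Config (coating pick) n} (h : ∀ p, Describes (S p) (c.part p)) {p : Fin n} {s : Agent}
    {x : Particle (coating pick)} (hx : Describes s x) (r : Fin n) :
    Describes (Function.update S p s r) ((c.update p x).part r) := by
  by_cases hr : r = p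
  · subst hr; simpa [Config.update] using hx
  · simpa [Config.update, hr] using h r

namespace Represents

variable {pick : Finset (Fin 10) → Fin 10} {n : ℕ} {S : Fin n → Agent}
  {c c' : Config (coating pick) n} {p : Fin n}

theorem describes_idle (h : Represents S c) {s : Agent} {st : State} {comp : Option Dir} {m : Move}
    (h1 : st.phase = s.phase) (h2 : st.shape = s.ext.map (· - (c.part p).orient))
    (h3 : st.d = s.d - (c.part p).orient) (h4 : s.tail = (S p).tail) (h5 : s.ext = (S p).ext)
    (h6 : comp = s.comp.map (· - (c.part p).orient)) :
    Describes s ((c.part p).assume (mkTurn st comp m)) where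
  phase := h1
  shape := h2
  d := h3
  tail := (h.describes p).tail.trans h4.symm
  ext := (h.describes p).ext.trans h5.symm
  flags := by subst h6; rfl

theorem describes_expand (h : Represents S c) {s : Agent} {st : State} {m : Move} {k : Dir}
    (h1 : st.phase = s.phase) (h2 : st.shape = some (k - (c.part p).orient))
    (h3 : st.d = s.d - (c.part p).orient) (h4 : s.tail = (S p).tail) (h5 : s.ext = some k)
    (h6 : s.comp = none) :
    Describes s { (c.part p).assume (mkTurn st none m) with ext := some k } where
  phase := h1
  shape := h2.trans (by rw [h5]; rfl)
  d := h3
  tail := (h.describes p).tail.trans h4.symm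
  ext := h5.symm
  flags := by rw [h6]; rfl

theorem describes_contract (h : Represents S c) {m : Move} {u : Node}
    (hu : u = (c.part p).head) :
    Describes { S p with tail := (S p).head, ext := none, comp := none }
      { (c.part p).assume (mkTurn { stateOf c p with shape := none } none m) with
        tail := u, ext := none } where
  phase := h.phase_eq p
  shape := rfl
  d := h.d_eq p
  tail := hu.trans (h.describes p).head
  ext := rfl
  flags := rfl

/-- Every action of the coating algorithm is an action of the agents. -/
theorem step (h : Represents S c) {sd : Node → Dir} {pos : Node → ℤ}
    (hsd : SurfaceCoordinates c.obj sd pos)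
    (hpick : ∀ S : Finset (Fin 10), S.Nonempty → pick S ∈ S)
    (hI : ∀ p, (S p).phase = Phase.inactive → (S p).ext = none)
    (hL : ∀ p, (S p).phase = Phase.lead → (S p).ext = none → (S p).tail ∈ surface c.obj)
    {a : Action n} (hst : Step c a c') :
    ∃ S', AgentStep c.obj sd S a S' ∧ (∀ p, Describes (S' p) (c'.part p)) ∧ c'.obj = c.obj := by
  have expand : ∀ (q : Fin n) (s : Turn State Flag) (j : Fin 10) (k : Dir), s ∈ c.turns q →
      s.move = Move.expand j → (c.part q).ExpandsAlong j k →
      ((S q).phase = Phase.follow ∧ (S q).ext = none ∧ (S q).tail ∉ surface c.obj ∧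
        k = (S q).d ∧ ∃ p a, p ≠ q ∧ (S q).tail + dir (S q).d ∈ (S p).nodes ∧
          (S p).ext = some a ∧ s = mkTurn { stateOf c q with
            shape := some (k - (c.part q).orient), d := a - (c.part q).orient } none
            (Move.expand j)) ∨
      ((S q).phase = Phase.lead ∧ (S q).ext = none ∧ Stimulated S q ∧
        k = sd (S q).tail ∧ s = mkTurn { stateOf c q with
            shape := some (k - (c.part q).orient) } none (Move.expand j)) := by
    intro q s j k hs hm hk
    have hqe : (S q).ext = none := (h.describes q).ext.symm.trans hk.1
    rcases hph : (S q).phase with _ | _ | _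
    · rcases h.turns_inactive hpick hph hqe hs with ⟨-, rfl⟩ | ⟨-, k, q, -, -, -, rfl⟩ <;> cases hm
    · refine Or.inl ⟨rfl, hqe, ?_⟩
      rcases h.turns_follow hph hqe hs with ⟨-, rfl⟩ | ⟨h1, p, a, hp, hmem, ha, rfl⟩
      · cases hm
      · cases hm
        rw [h.d_eq, expandsAlong_iff hk.1] at hk
        subst hk
        exact ⟨h1, rfl, p, a, hp, hmem, ha, by rw [h.d_eq]⟩
    · refine Or.inr ⟨rfl, hqe, ?_⟩
      rcases (h.turns_lead hsd hpick hph hqe (hL q hph hqe)).mp hs with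
        ⟨h1, ⟨-, rfl⟩ | ⟨-, rfl⟩⟩
      · cases hm
        rw [expandsAlong_iff hk.1] at hk
        subst hk
        exact ⟨h1, rfl, rfl⟩
      · cases hm
  have contract : ∀ (q : Fin n) (s : Turn State Flag) (j : Fin 10) (u v : Node), s ∈ c.turns q →
      (s.move = Move.contract j ∨ s.move = Move.handoverContract j) →
      (c.part q).ContractsTo j u v → ∃ a, (S q).ext = some a ∧ (S q).phase ≠ Phase.inactive ∧
        u = (c.part q).head ∧ v = (S q).tail ∧
        s = mkTurn { stateOf c q with shape := none } none s.move ∧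
        (s.move = Move.contract j → (∀ p, p ≠ q → ¬ (S p).Follows (S q).tail) ∧
          ∀ p, p ≠ q → (S p).phase = Phase.inactive → ∀ w ∈ (S q).nodes, ∀ k,
            w + dir k ∉ (S p).nodes) := by
    intro q s j u v hs hm hc
    obtain ⟨a, ha, -⟩ := id hc
    have hqe : (S q).ext = some a := (h.describes q).ext.symm.trans ha
    have hph : (S q).phase ≠ Phase.inactive := fun hph => by
      have := hI q hph; rw [hqe] at this; cases this
    refine ⟨a, hqe, hph, ?_⟩
    rcases (h.turns_expanded hph hqe).mp hs with ⟨-, rfl⟩ | ⟨h1, h2, rfl⟩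
    · rcases hm with hm | hm <;> cases hm
      rw [contractsTo_iff ha, (h.describes q).tail] at hc
      exact ⟨hc.1, hc.2, rfl, fun h => by cases h⟩
    · rcases hm with hm | hm <;> cases hm
      rw [contractsTo_iff ha, (h.describes q).tail] at hc
      exact ⟨hc.1, hc.2, rfl, fun _ => ⟨h1, h2⟩⟩
  cases hst with
  | idle p t ht hm =>
    change t ∈ c.turns p at ht
    rcases he : (S p).ext with _ | a
    · rcases hph : (S p).phase with _ | _ | _
      · rcases h.turns_inactive hpick hph he ht with ⟨h1, rfl⟩ | ⟨h1, k, q, hqp, hk, hq, rfl⟩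
        · exact ⟨_, AgentStep.lead p (by rw [hph]; decide) he h1, describes_update h.describes
            (h.describes_idle rfl (h.shape_eq p) (h.d_eq p) rfl rfl rfl), rfl⟩
        · exact ⟨_, AgentStep.follow p q k hph he h1 hqp hq hk, describes_update h.describes
            (h.describes_idle rfl (h.shape_eq p) rfl rfl rfl rfl), rfl⟩
      · rcases h.turns_follow hph he ht with ⟨h1, rfl⟩ | ⟨-, q, a, -, -, -, rfl⟩
        · exact ⟨_, AgentStep.lead p (by rw [hph]; decide) he h1, describes_update h.describes
            (h.describes_idle rfl (h.shape_eq p) (h.d_eq p) rfl rfl rfl), rfl⟩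
        · cases hm
      · rcases (h.turns_lead hsd hpick hph he (hL p hph he)).mp ht with
          ⟨h1, ⟨-, rfl⟩ | ⟨⟨q, hqp, hq, -⟩, rfl⟩⟩
        · cases hm
        · exact ⟨_, AgentStep.complain p q hph he hqp hq, describes_update h.describes
            (h.describes_idle (h.phase_eq p) (h.shape_eq p) (h.d_eq p) rfl rfl rfl), rfl⟩
    · have hph : (S p).phase ≠ Phase.inactive := fun hph => by
        have := hI p hph; rw [he] at this; cases this
      rcases (h.turns_expanded hph he).mp ht with ⟨-, rfl⟩ | ⟨-, -, rfl⟩ <;> cases hm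
  | expand p t i k ht hm he hfree =>
    have hfree' : ∀ q, (S p).tail + dir k ∉ (S q).nodes := fun q hq =>
      hfree (h.mem_occupied.mpr (Or.inr ⟨q, by rw [(h.describes p).tail]; exact hq⟩))
    rcases expand p t i k ht hm he with ⟨-, -, -, rfl, q, -, -, hq, -⟩ | ⟨hph, hpe, h1, rfl, ht'⟩
    · exact absurd hq (hfree' q)
    · refine ⟨_, AgentStep.expand p hph hpe h1 hfree', describes_update h.describes ?_, rfl⟩
      rw [ht']
      exact h.describes_expand (h.phase_eq p) rfl (h.d_eq p) rfl rfl rfl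
  | contract p t i u v ht hm hc =>
    obtain ⟨a, he, hph, hu, -, ht', h1⟩ := contract p t i u v ht (Or.inl hm) hc
    refine ⟨_, AgentStep.contract p a he (h1 hm).1 (h1 hm).2, describes_update h.describes ?_, rfl⟩
    rw [ht']
    exact h.describes_contract hu
  | handover p q hpq t s i j u k ht hs hmt hms he hc =>
    obtain ⟨a, hpe, hph, hu, hv, ht', -⟩ := contract p t i u _ ht hmt hc
    rw [(h.describes q).tail] at hv
    have hD := describes_update h.describes (p := p) (h.describes_contract hu (m := t.move))
    rw [← ht'] at hD
    rcases expand q s j k hs hms he with ⟨hqp, hqe, hqs, rfl, r, b, hrq, hr, hb, hs'⟩ |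
      ⟨hqp, hqe, h1, rfl, hs'⟩
    · obtain rfl : r = p := h.eq_of_mem hr (by rw [hv]; exact (S p).tail_mem_nodes)
      obtain rfl : b = a := Option.some.inj (hb.symm.trans hpe)
      refine ⟨_, AgentStep.handoverFollow r q b hpq hpe hqp hqe hqs hv,
        describes_update hD ?_, rfl⟩
      rw [hs']
      exact h.describes_expand (h.phase_eq q) rfl rfl rfl rfl rfl
    · refine ⟨_, AgentStep.handoverLead p q a hpq hpe hqp hqe h1 hv, describes_update hD ?_, rfl⟩
      rw [hs']
      exact h.describes_expand (h.phase_eq q) rfl (h.d_eq q) rfl rfl rfl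

end Represents

/-! ### The invariant -/

/-- The conditions on a single agent in the invariant.  The function `rank` decreases along the
directions in which the followers follow, off the surface. -/
structure Agent.Good (C : Set Node) (sd : Node → Dir) (rank : Node → ℕ) (s : Agent) : Prop where
  notMem : ∀ v ∈ s.nodes, v ∉ C
  inactive : s.phase = Phase.inactive → s.ext = none
  lead_tail : s.phase = Phase.lead → s.tail ∈ surface C
  lead_ext : ∀ a, s.phase = Phase.lead → s.ext = some a → a = sd s.tail
  follow_ext : ∀ a, s.phase = Phase.follow → s.ext = some a →
    s.tail ∉ surface C ∧ rank s.head < rank s.tail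
  follow_surface : s.phase = Phase.follow → s.head ∈ surface C → s.d = sd s.head
  follow_rank : s.phase = Phase.follow → s.head ∉ surface C →
    rank (s.head + dir s.d) < rank s.head
  comp : ∀ k, s.comp = some k → s.phase = Phase.lead ∧ s.ext = none ∧ k = sd s.tail

namespace Agent.Good

variable {C : Set Node} {sd : Node → Dir} {pos : Node → ℤ} {rank : Node → ℕ} {s : Agent}

theorem lead_of_tail_mem (h : s.Good C sd rank) {a : Dir} (he : s.ext = some a)
    (ht : s.tail ∈ surface C) : s.phase = Phase.lead := by
  rcases hp : s.phase with _ | _ | _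
  · rw [h.inactive hp] at he; cases he
  · exact absurd ht (h.follow_ext a hp he).1
  · rfl

theorem follow_of_tail_notMem (h : s.Good C sd rank) {a : Dir} (he : s.ext = some a)
    (ht : s.tail ∉ surface C) : s.phase = Phase.follow := by
  rcases hp : s.phase with _ | _ | _
  · rw [h.inactive hp] at he; cases he
  · rfl
  · exact absurd (h.lead_tail hp) ht

theorem not_inactive (h : s.Good C sd rank) {a : Dir} (he : s.ext = some a) :
    s.phase ≠ Phase.inactive := fun hp => by rw [h.inactive hp] at he; cases he

theorem head_mem (h : s.Good C sd rank) (hsd : SurfaceCoordinates C sd pos)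
    (ht : s.tail ∈ surface C) : s.head ∈ surface C := by
  rcases he : s.ext with _ | a
  · rwa [Agent.head_of_contracted he]
  · rw [Agent.head_of_expanded he, h.lead_ext a (h.lead_of_tail_mem he ht) he]
    exact hsd.next_mem ht

theorem pos_head (h : s.Good C sd rank) (hsd : SurfaceCoordinates C sd pos) {a : Dir}
    (he : s.ext = some a) (ht : s.tail ∈ surface C) : pos s.head = pos s.tail + 1 := by
  rw [Agent.head_of_expanded he, h.lead_ext a (h.lead_of_tail_mem he ht) he, hsd.pos_next _ ht]

/-- A follower does not follow itself. -/
theorem target_notMem (h : s.Good C sd rank) (hsd : SurfaceCoordinates C sd pos)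
    (hp : s.phase = Phase.follow) : s.head + dir s.d ∉ s.nodes := by
  rintro (ht | hh)
  · rcases he : s.ext with _ | a
    · rw [Agent.head_of_contracted he] at ht
      exact dir_ne_zero _ (add_eq_left.mp ht)
    · have h1 := h.follow_ext a hp he
      by_cases hs : s.head ∈ surface C
      · rw [h.follow_surface hp hs] at ht
        exact h1.1 (ht ▸ hsd.next_mem hs)
      · have h2 := h.follow_rank hp hs
        rw [ht] at h2
        omega
  · exact dir_ne_zero _ (add_eq_left.mp hh)

end Agent.Good

open Classical in
/-- The number of active agents. -/
noncomputable def activeCount {n : ℕ} (S : Fin n → Agent) : ℕ :=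
  (Finset.univ.filter fun p => (S p).phase ≠ Phase.inactive).card

open Classical in
/-- The number of agents whose heads lie on the surface behind the head of `p`. -/
noncomputable def behind (C : Set Node) (pos : Node → ℤ) {n : ℕ} (S : Fin n → Agent)
    (p : Fin n) : ℕ :=
  (Finset.univ.filter fun q => (S q).head ∈ surface C ∧ pos (S q).head < pos (S p).head).card

/-- The invariant of the coating algorithm.  The integer `b p` is the position on the surface from
which the displacement of the agent `p` is measured; an agent that enters the surface inherits it
from the agent whose tail it takes over.  The condition `line` says that the displacement is at
most twice the number of agents behind, with an exception for an expanded leader whose tail will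
be taken over by a follower. -/
structure Invariant (C : Set Node) (sd : Node → Dir) (pos : Node → ℤ) {n : ℕ} (rank : Node → ℕ)
    (b : Fin n → ℤ) (S : Fin n → Agent) : Prop where
  good : ∀ p, (S p).Good C sd rank
  disjoint : ∀ p q v, v ∈ (S p).nodes → v ∈ (S q).nodes → p = q
  target : ∀ p, (S p).phase = Phase.follow →
    ∃ q, (S q).phase ≠ Phase.inactive ∧ (S p).head + dir (S p).d ∈ (S q).nodes
  rank_surface : ∀ v ∈ surface C, rank v = 0
  rank_le : ∀ v, rank v ≤ activeCount S
  base_mono : ∀ p q, (S p).head ∈ surface C → (S q).head ∈ surface C →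
    pos (S p).head < pos (S q).head → b p ≤ b q
  base_le : ∀ p, ∀ v ∈ (S p).nodes, v ∈ surface C → b p ≤ pos v
  line : ∀ p, (S p).head ∈ surface C → pos (S p).head - b p ≤ 2 * behind C pos S p ∨
    ((S p).phase = Phase.lead ∧ (S p).ext ≠ none ∧
      pos (S p).head - b p ≤ 2 * behind C pos S p + 1 ∧
      ∃ q, (S q).Follows (S p).tail ∧ (S q).head ∉ surface C)
  cut : ∀ T : Set (Fin n), T.Nonempty → (∀ p ∈ T, (S p).phase = Phase.inactive) →
    ∃ p ∈ T, (S p).tail ∈ surface C ∨ ∃ q, q ∉ T ∧ ∃ k, (S p).tail + dir k ∈ (S q).nodes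

section

variable {C : Set Node} {sd : Node → Dir} {pos : Node → ℤ} {n : ℕ} {rank : Node → ℕ}
  {b : Fin n → ℤ} {S : Fin n → Agent}

theorem behind_mono {S' : Fin n → Agent} {p p' : Fin n}
    (h : ∀ q, (S q).head ∈ surface C → pos (S q).head < pos (S p).head →
      (S' q).head ∈ surface C ∧ pos (S' q).head < pos (S' p').head) :
    behind C pos S p ≤ behind C pos S' p' := by
  classical
  refine Finset.card_le_card fun q hq => ?_
  simp only [Finset.mem_filter, Finset.mem_univ, true_and] at hq ⊢
  exact h q hq.1 hq.2

theorem behind_add_one_le {p q : Fin n} {S' : Fin n → Agent}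
    (hq' : (S' q).head ∈ surface C) (hqp' : pos (S' q).head < pos (S' p).head) {r : Fin n}
    (h : ∀ s, (S s).head ∈ surface C → pos (S s).head < pos (S r).head →
      s ≠ q ∧ (S' s).head ∈ surface C ∧ pos (S' s).head < pos (S' p).head) :
    behind C pos S r + 1 ≤ behind C pos S' p := by
  classical
  rw [behind, behind, ← Finset.card_insert_of_notMem (a := q)]
  · refine Finset.card_le_card fun s hs => ?_
    simp only [Finset.mem_filter, Finset.mem_univ, true_and, Finset.mem_insert] at hs ⊢
    rcases hs with rfl | hs
    · exact ⟨hq', hqp'⟩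
    · exact (h s hs.1 hs.2).2
  · intro hq
    simp only [Finset.mem_filter, Finset.mem_univ, true_and] at hq
    exact (h q hq.1 hq.2).1 rfl

theorem behind_lt {p q : Fin n} (hq : (S q).head ∈ surface C)
    (h : pos (S q).head < pos (S p).head) : behind C pos S q + 1 ≤ behind C pos S p :=
  behind_add_one_le hq h fun _ hs hs' =>
    ⟨fun hsq => lt_irrefl _ (hsq ▸ hs'), hs, hs'.trans h⟩

theorem behind_le (p : Fin n) : behind C pos S p ≤ n := by
  classical
  exact (Finset.card_filter_le _ _).trans (by simp)

theorem activeCount_mono {S' : Fin n → Agent}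
    (h : ∀ p, (S' p).phase = Phase.inactive → (S p).phase = Phase.inactive) :
    activeCount S ≤ activeCount S' := by
  classical
  refine Finset.card_le_card fun q hq => ?_
  simp only [Finset.mem_filter, Finset.mem_univ, true_and] at hq ⊢
  exact fun h' => hq (h q h')

theorem activeCount_add_one_le {S' : Fin n → Agent}
    (h : ∀ p, (S' p).phase = Phase.inactive → (S p).phase = Phase.inactive) {p : Fin n}
    (hp : (S p).phase = Phase.inactive) (hp' : (S' p).phase ≠ Phase.inactive) :
    activeCount S + 1 ≤ activeCount S' := by
  classical
  rw [activeCount, activeCount, ← Finset.card_insert_of_notMem (a := p)]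
  · refine Finset.card_le_card fun q hq => ?_
    simp only [Finset.mem_filter, Finset.mem_univ, true_and, Finset.mem_insert] at hq ⊢
    rcases hq with rfl | hq
    · exact hp'
    · exact fun h' => hq (h q h')
  · simp [hp]

theorem activeCount_le : activeCount S ≤ n := by
  classical
  exact (Finset.card_filter_le _ _).trans (by simp)

theorem cut_of_step {S' : Fin n → Agent}
    (h : ∀ T : Set (Fin n), T.Nonempty → (∀ p ∈ T, (S p).phase = Phase.inactive) →
      ∃ p ∈ T, (S p).tail ∈ surface C ∨ ∃ q, q ∉ T ∧ ∃ k, (S p).tail + dir k ∈ (S q).nodes)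
    (hI : ∀ p, (S' p).phase = Phase.inactive →
      (S p).phase = Phase.inactive ∧ (S' p).tail = (S p).tail)
    (hocc : ∀ p q k, p ≠ q → (S p).phase = Phase.inactive → (S p).tail + dir k ∈ (S q).nodes →
      ∃ r, (S p).tail + dir k ∈ (S' r).nodes ∧ (r = q ∨ (S' r).phase ≠ Phase.inactive))
    (T : Set (Fin n)) (hT : T.Nonempty) (hTI : ∀ p ∈ T, (S' p).phase = Phase.inactive) :
    ∃ p ∈ T, (S' p).tail ∈ surface C ∨ ∃ q, q ∉ T ∧ ∃ k, (S' p).tail + dir k ∈ (S' q).nodes := by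
  obtain ⟨p, hp, h1 | ⟨q, hq, k, hk⟩⟩ := h T hT fun p hp => (hI p (hTI p hp)).1
  · exact ⟨p, hp, Or.inl (by rwa [(hI p (hTI p hp)).2])⟩
  · refine ⟨p, hp, Or.inr ?_⟩
    rw [(hI p (hTI p hp)).2]
    obtain ⟨r, hr, rfl | hr'⟩ := hocc p q k (by rintro rfl; exact hq hp) (hI p (hTI p hp)).1 hk
    · exact ⟨r, hq, k, hr⟩
    · exact ⟨r, fun h => hr' (hTI r h), k, hr⟩

namespace Invariant

theorem displacement_le (h : Invariant C sd pos rank b S) {p : Fin n}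
    (hs : (S p).head ∈ surface C) (he : (S p).ext = none ∨ (S p).phase ≠ Phase.lead) :
    pos (S p).head - b p ≤ 2 * behind C pos S p := by
  rcases h.line p hs with h1 | ⟨h1, h2, -⟩
  · exact h1
  · rcases he with h3 | h3
    · exact absurd h3 h2
    · exact absurd h1 h3

theorem mem_head_unique (h : Invariant C sd pos rank b S) {p q : Fin n}
    (hpq : (S p).head = (S q).head) : p = q :=
  h.disjoint p q _ (S p).head_mem_nodes (hpq ▸ (S q).head_mem_nodes)

/-- Actions that do not move any agent preserve the invariant. -/
theorem idle {S' : Fin n → Agent} {rank' : Node → ℕ} (h : Invariant C sd pos rank b S)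
    (htail : ∀ r, (S' r).tail = (S r).tail) (hext : ∀ r, (S' r).ext = (S r).ext)
    (hgood : ∀ r, (S' r).Good C sd rank')
    (hact : ∀ r, (S' r).phase = Phase.inactive → (S r).phase = Phase.inactive)
    (hrs : ∀ v ∈ surface C, rank' v = 0) (hrl : ∀ v, rank' v ≤ activeCount S')
    (htarget : ∀ r, (S' r).phase = Phase.follow →
      ∃ q, (S q).phase ≠ Phase.inactive ∧ (S r).head + dir (S' r).d ∈ (S q).nodes)
    (hlead : ∀ r, (S r).phase = Phase.lead → (S' r).phase = Phase.lead)
    (hfollow : ∀ r, (S r).phase = Phase.follow → (S r).head ∉ surface C →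
      (S' r).phase = Phase.follow ∧ (S' r).d = (S r).d) :
    Invariant C sd pos rank' b S' := by
  have hhead : ∀ r, (S' r).head = (S r).head := fun r => by
    simp only [Agent.head, htail, hext]
  have hnodes : ∀ r, (S' r).nodes = (S r).nodes := fun r => by
    simp only [Agent.nodes, htail, hhead]
  have hbehind : ∀ r, behind C pos S' r = behind C pos S r := fun r =>
    le_antisymm (behind_mono fun q => by simp only [hhead]; exact fun h1 h2 => ⟨h1, h2⟩)
      (behind_mono fun q => by simp only [hhead]; exact fun h1 h2 => ⟨h1, h2⟩)
  refine ⟨hgood, ?_, ?_, hrs, hrl, ?_, ?_, ?_, ?_⟩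
  · simpa only [hnodes] using h.disjoint
  · intro r hr
    obtain ⟨q, hq, hq'⟩ := htarget r hr
    exact ⟨q, fun h' => hq (hact q h'), by rwa [hhead, hnodes]⟩
  · simpa only [hhead] using h.base_mono
  · simpa only [hnodes] using h.base_le
  · intro r hr
    simp only [hhead, hbehind, htail, hext] at hr ⊢
    refine (h.line r hr).imp_right ?_
    rintro ⟨h1, h2, h3, q, ⟨h4, h5⟩, h6⟩
    have := hfollow q h4 h6
    exact ⟨hlead r h1, h2, h3, q, ⟨this.1, by rw [hhead, this.2, h5]⟩, h6⟩
  · exact cut_of_step h.cut (fun p hp => ⟨hact p hp, htail p⟩) fun p q k _ _ hk =>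
      ⟨q, by rwa [hnodes], Or.inl rfl⟩

end Invariant

end

/-! ### Preservation of the invariant -/

/-- The agent after a contraction out of its tail. -/
def Agent.contract (s : Agent) : Agent := { s with tail := s.head, ext := none, comp := none }

/-- The agent after an expansion in direction `k`, with a new direction `d`. -/
def Agent.expand (s : Agent) (k d : Dir) : Agent := { s with ext := some k, d := d, comp := none }

namespace Agent

variable {s : Agent}

theorem head_contract : s.contract.head = s.head := rfl

theorem mem_nodes_contract {v : Node} : v ∈ s.contract.nodes ↔ v = s.head := by
  rw [nodes, head_contract]
  exact or_self_iff

theorem head_expand {k d : Dir} : (s.expand k d).head = s.tail + dir k := rfl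

theorem mem_nodes_expand {k d : Dir} {v : Node} :
    v ∈ (s.expand k d).nodes ↔ v = s.tail ∨ v = s.tail + dir k := Iff.rfl

namespace Good

variable {C : Set Node} {sd : Node → Dir} {pos : Node → ℤ} {rank : Node → ℕ}

theorem contract (h : s.Good C sd rank) (hsd : SurfaceCoordinates C sd pos) :
    s.contract.Good C sd rank where
  notMem v hv := by rw [mem_nodes_contract] at hv; exact hv ▸ h.notMem _ s.head_mem_nodes
  inactive _ := rfl
  lead_tail hp := h.head_mem hsd (h.lead_tail hp)
  lead_ext a _ he := by cases he
  follow_ext a _ he := by cases he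
  follow_surface := h.follow_surface
  follow_rank := h.follow_rank
  comp k hk := by cases hk

theorem expand_lead (h : s.Good C sd rank) (hsd : SurfaceCoordinates C sd pos)
    (hp : s.phase = Phase.lead) : (s.expand (sd s.tail) s.d).Good C sd rank where
  notMem v hv := by
    rw [mem_nodes_expand] at hv
    rcases hv with rfl | rfl
    · exact h.notMem _ s.tail_mem_nodes
    · exact hsd.notMem _ (h.lead_tail hp)
  inactive hp' := by rw [show (s.expand (sd s.tail) s.d).phase = s.phase from rfl, hp] at hp'; cases hp'
  lead_tail _ := h.lead_tail hp
  lead_ext a _ he := by cases he; rfl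
  follow_ext a hp' := by
    rw [show (s.expand (sd s.tail) s.d).phase = s.phase from rfl, hp] at hp'; cases hp'
  follow_surface hp' := by
    rw [show (s.expand (sd s.tail) s.d).phase = s.phase from rfl, hp] at hp'; cases hp'
  follow_rank hp' := by
    rw [show (s.expand (sd s.tail) s.d).phase = s.phase from rfl, hp] at hp'; cases hp'
  comp k hk := by cases hk

theorem expand_follow (h : s.Good C sd rank) {t : Agent} (ht : t.Good C sd rank)
    (hp : s.phase = Phase.follow) (he : s.ext = none) (hs : s.tail ∉ surface C) {a : Dir}
    (hte : t.ext = some a) (hd : s.tail + dir s.d = t.tail) :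
    (s.expand s.d a).Good C sd rank where
  notMem v hv := by
    rw [mem_nodes_expand, hd] at hv
    rcases hv with rfl | rfl
    · exact h.notMem _ s.tail_mem_nodes
    · exact ht.notMem _ t.tail_mem_nodes
  inactive hp' := by rw [show (s.expand s.d a).phase = s.phase from rfl, hp] at hp'; cases hp'
  lead_tail hp' := by rw [show (s.expand s.d a).phase = s.phase from rfl, hp] at hp'; cases hp'
  lead_ext a hp' := by rw [show (s.expand s.d _).phase = s.phase from rfl, hp] at hp'; cases hp'
  follow_ext _ _ _ := by
    refine ⟨hs, ?_⟩
    have := h.follow_rank hp (by rwa [head_of_contracted he])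
    rwa [head_of_contracted he] at this
  follow_surface _ hh := by
    rw [head_expand, hd] at hh ⊢
    exact ht.lead_ext a (ht.lead_of_tail_mem hte hh) hte
  follow_rank _ hh := by
    rw [head_expand, hd] at hh ⊢
    have := (ht.follow_ext a (ht.follow_of_tail_notMem hte hh) hte).2
    rwa [head_of_expanded hte] at this
  comp k hk := by cases hk

end Good

end Agent

variable {C : Set Node} {sd : Node → Dir} {pos : Node → ℤ} {n : ℕ} {rank : Node → ℕ}
  {b : Fin n → ℤ} {S S' : Fin n → Agent}

theorem disjoint_of_step (h : ∀ p q v, v ∈ (S p).nodes → v ∈ (S q).nodes → p = q) {m : Fin n}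
    {w : Node} (hsub : ∀ r v, v ∈ (S' r).nodes → v ∈ (S r).nodes ∨ (r = m ∧ v = w))
    (hw : ∀ r, w ∈ (S' r).nodes → r = m) (p q : Fin n) (v : Node) (hp : v ∈ (S' p).nodes)
    (hq : v ∈ (S' q).nodes) : p = q := by
  rcases hsub p v hp with hp' | ⟨rfl, rfl⟩
  · rcases hsub q v hq with hq' | ⟨rfl, rfl⟩
    · exact h p q v hp' hq'
    · exact hw p hp
  · exact (hw q hq).symm

namespace Invariant

/-- An agent contracts only if nobody follows to its tail and no inactive agent is adjacent, so that
no link of the configuration is lost. -/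
theorem contract (h : Invariant C sd pos rank b S) (hsd : SurfaceCoordinates C sd pos)
    {p : Fin n} {a : Dir} (he : (S p).ext = some a)
    (hf : ∀ q, q ≠ p → ¬ (S q).Follows (S p).tail)
    (hi : ∀ q, q ≠ p → (S q).phase = Phase.inactive → ∀ w ∈ (S p).nodes, ∀ k,
      w + dir k ∉ (S q).nodes) (hp' : S' p = (S p).contract) (hr' : ∀ r, r ≠ p → S' r = S r) :
    Invariant C sd pos rank b S' := by
  have hhead : ∀ r, (S' r).head = (S r).head := fun r => by
    by_cases hr : r = p
    · subst hr; rw [hp']; rfl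
    · rw [hr' r hr]
  have hphase : ∀ r, (S' r).phase = (S r).phase := fun r => by
    by_cases hr : r = p
    · subst hr; rw [hp']; rfl
    · rw [hr' r hr]
  have hd : ∀ r, (S' r).d = (S r).d := fun r => by
    by_cases hr : r = p
    · subst hr; rw [hp']; rfl
    · rw [hr' r hr]
  have hnodes : ∀ r, ∀ v ∈ (S' r).nodes, v ∈ (S r).nodes := fun r v hv => by
    by_cases hr : r = p
    · subst hr
      rw [hp', Agent.mem_nodes_contract] at hv
      exact hv ▸ (S r).head_mem_nodes
    · rwa [hr' r hr] at hv
  have hocc : ∀ r, ∀ v ∈ (S r).nodes, v ≠ (S p).tail → v ∈ (S' r).nodes := fun r v hv hvp => by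
    by_cases hr : r = p
    · subst hr
      rw [hp', Agent.mem_nodes_contract]
      exact hv.resolve_left hvp
    · rwa [hr' r hr]
  have hbehind : ∀ r, behind C pos S r ≤ behind C pos S' r := fun r =>
    behind_mono fun q => by simp only [hhead]; exact fun h1 h2 => ⟨h1, h2⟩
  refine ⟨?_, fun r s v hr hs => h.disjoint r s v (hnodes r v hr) (hnodes s v hs), ?_,
    h.rank_surface, fun v => (h.rank_le v).trans (activeCount_mono fun r hr => by rwa [← hphase]),
    ?_, fun r v hv => h.base_le r v (hnodes r v hv), ?_, ?_⟩
  · intro r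
    by_cases hr : r = p
    · subst hr; rw [hp']; exact (h.good r).contract hsd
    · rw [hr' r hr]; exact h.good r
  · intro r hr
    rw [hphase] at hr
    rw [hhead, hd]
    obtain ⟨q, hq, hq'⟩ := h.target r hr
    refine ⟨q, by rwa [hphase], hocc q _ hq' fun hv => ?_⟩
    by_cases hrp : r = p
    · subst hrp
      exact (h.good r).target_notMem hsd hr (hv ▸ (S r).tail_mem_nodes)
    · exact hf r hrp ⟨hr, hv⟩
  · simpa only [hhead] using h.base_mono
  · intro r hr
    rw [hhead] at hr ⊢
    have hb := hbehind r
    rcases h.line r hr with h1 | ⟨h1, h2, h3, q, h4, h5⟩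
    · exact Or.inl (by omega)
    · by_cases hrp : r = p
      · subst hrp
        refine absurd h4 (hf q ?_)
        rintro rfl
        have := h4.1
        rw [h1] at this
        cases this
      · rw [hphase, hr' r hrp]
        exact Or.inr ⟨h1, h2, by omega, q, ⟨by rw [hphase]; exact h4.1, by rw [hhead, hd]; exact h4.2⟩,
          by rwa [hhead]⟩
  · refine cut_of_step h.cut (fun r hr => ⟨by rwa [← hphase], ?_⟩) fun r q k hrq hr hk => ?_
    · by_cases hrp : r = p
      · subst hrp; rw [hphase] at hr; exact absurd hr ((h.good r).not_inactive he)
      · rw [hr' r hrp]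
    · refine ⟨q, hocc q _ hk fun hv => ?_, Or.inl rfl⟩
      obtain rfl : q = p := h.disjoint q p _ hk (hv ▸ (S p).tail_mem_nodes)
      exact hi r hrq hr _ hk (k + 3) (by rw [add_dir_opp]; exact (S r).tail_mem_nodes)

/-- A stimulated leader has someone right behind it, or a follower that will take over its
place. -/
theorem stimulated (h : Invariant C sd pos rank b S) (hsd : SurfaceCoordinates C sd pos)
    {p : Fin n} (hp : (S p).phase = Phase.lead) (he : (S p).ext = none) (hst : Stimulated S p) :
    pos (S p).tail + 1 - b p ≤ 2 * behind C pos S p ∨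
      ((pos (S p).tail - b p ≤ 2 * behind C pos S p) ∧
        ∃ q, (S q).Follows (S p).tail ∧ (S q).head ∉ surface C) := by
  have hs := (h.good p).lead_tail hp
  have hhp := Agent.head_of_contracted he
  have key : ∀ q, (S q).head ∈ surface C → (S q).head + dir (sd (S q).head) = (S p).tail →
      ((S q).ext = none ∨ (S q).phase ≠ Phase.lead) →
      pos (S p).tail + 1 - b p ≤ 2 * behind C pos S p := by
    intro q hq hqp hq'
    have h1 := hsd.pos_next _ hq
    rw [hqp] at h1
    have h2 := h.displacement_le hq hq'
    have hlt : pos (S q).head < pos (S p).head := by rw [hhp]; omega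
    have h3 := h.base_mono q p hq (by rwa [hhp]) hlt
    have h4 := behind_lt (C := C) (S := S) (p := p) hq hlt
    omega
  obtain ⟨q, hqp, ⟨h1, h2⟩ | ⟨k, h1, h2⟩⟩ := hst
  · by_cases hq : (S q).head ∈ surface C
    · left
      rw [(h.good q).follow_surface h1 hq] at h2
      exact key q hq h2 (Or.inr (by rw [h1]; decide))
    · right
      have := h.displacement_le (p := p) (by rwa [hhp]) (Or.inl he)
      rw [hhp] at this
      exact ⟨this, q, ⟨h1, h2⟩, hq⟩
  · left
    obtain ⟨h3, h4, h5⟩ := (h.good q).comp k h1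
    have hh := Agent.head_of_contracted h4
    have hq : (S q).head ∈ surface C := by rw [hh]; exact (h.good q).lead_tail h3
    refine key q hq ?_ (Or.inl h4)
    rw [← h2, h5, hh]

/-- The order on the surface does not change when an agent advances to a free node. -/
theorem advance_order (hsd : SurfaceCoordinates C sd pos) {m : Fin n}
    (hm : (S m).head ∈ surface C) (hm' : (S' m).head = (S m).head + dir (sd (S m).head))
    (hr' : ∀ r, r ≠ m → (S' r).head = (S r).head)
    (hinj : ∀ r, (S r).head = (S m).head → r = m)
    (hfree : ∀ r, r ≠ m → (S r).head ≠ (S m).head + dir (sd (S m).head)) (r : Fin n) :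
    ((S' r).head ∈ surface C ↔ (S r).head ∈ surface C) ∧
    ∀ s, (S r).head ∈ surface C → (S s).head ∈ surface C →
      (pos (S' r).head < pos (S' s).head ↔ pos (S r).head < pos (S s).head) := by
  have hn := hsd.next_mem hm
  have hpos := hsd.pos_next _ hm
  have ne1 : ∀ r, r ≠ m → (S r).head ∈ surface C → pos (S r).head ≠ pos (S m).head := fun r hr h1 h2 =>
    hr (hinj r (hsd.injOn h1 hm h2))
  have ne2 : ∀ r, r ≠ m → (S r).head ∈ surface C → pos (S r).head ≠ pos (S m).head + 1 :=
    fun r hr h1 h2 => hfree r hr (hsd.injOn h1 hn (by rw [h2, hpos]))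
  constructor
  · by_cases hr : r = m
    · subst hr; rw [hm']; exact ⟨fun _ => hm, fun _ => hn⟩
    · rw [hr' r hr]
  · intro s h1 h2
    by_cases hr : r = m <;> by_cases hs : s = m
    · rw [hr, hs]; simp
    · have := ne2 s hs h2
      have := ne1 s hs h2
      rw [hr, hr' s hs, hm', hpos]; omega
    · have := ne2 r hr h1
      have := ne1 r hr h1
      rw [hs, hr' r hr, hm', hpos]; omega
    · rw [hr' r hr, hr' s hs]

/-- A leader that advances to a free node is stimulated, which bounds its new displacement. -/
theorem expand (h : Invariant C sd pos rank b S) (hsd : SurfaceCoordinates C sd pos)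
    {p : Fin n} (hp : (S p).phase = Phase.lead) (he : (S p).ext = none) (hst : Stimulated S p)
    (hfree : ∀ q, (S p).tail + dir (sd (S p).tail) ∉ (S q).nodes)
    (hp' : S' p = (S p).expand (sd (S p).tail) (S p).d) (hr' : ∀ r, r ≠ p → S' r = S r) :
    Invariant C sd pos rank b S' := by
  have hhp := Agent.head_of_contracted he
  have hs := (h.good p).lead_tail hp
  have hphase : ∀ r, (S' r).phase = (S r).phase := fun r => by
    by_cases hr : r = p
    · subst hr; rw [hp']; rfl
    · rw [hr' r hr]
  have htail : ∀ r, (S' r).tail = (S r).tail := fun r => by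
    by_cases hr : r = p
    · subst hr; rw [hp']; rfl
    · rw [hr' r hr]
  have hocc : ∀ r, ∀ v ∈ (S r).nodes, v ∈ (S' r).nodes := fun r v hv => by
    by_cases hr : r = p
    · subst hr
      rw [Agent.nodes_of_contracted he] at hv
      rw [hp', Agent.mem_nodes_expand]
      exact Or.inl hv
    · rwa [hr' r hr]
  have hhead' : (S' p).head = (S p).tail + dir (sd (S p).tail) := by rw [hp']; rfl
  have hord := advance_order (S := S) (S' := S') hsd (m := p) (by rwa [hhp])
    (by rw [hhead', hhp]) (fun r hr => by rw [hr' r hr]) (fun r hr => h.mem_head_unique hr)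
    (fun r _ hr => hfree r (by rw [← hhp, ← hr]; exact (S r).head_mem_nodes))
  have hbehind : ∀ r, (S r).head ∈ surface C → behind C pos S r ≤ behind C pos S' r := fun r hr =>
    behind_mono fun q hq hqr => ⟨(hord q).1.mpr hq, ((hord q).2 r hq hr).mpr hqr⟩
  refine ⟨?_, ?_, ?_, h.rank_surface,
    fun v => (h.rank_le v).trans (activeCount_mono fun r hr => by rwa [← hphase]), ?_, ?_, ?_, ?_⟩
  · intro r
    by_cases hr : r = p
    · subst hr; rw [hp']; exact (h.good r).expand_lead hsd hp
    · rw [hr' r hr]; exact h.good r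
  · refine disjoint_of_step h.disjoint (m := p) (w := (S p).tail + dir (sd (S p).tail)) ?_ ?_
    · intro r v hv
      by_cases hr : r = p
      · subst hr
        rw [hp', Agent.mem_nodes_expand] at hv
        exact hv.imp (fun h' : v = _ => h' ▸ (S r).tail_mem_nodes) fun h' => ⟨rfl, h'⟩
      · rw [hr' r hr] at hv; exact Or.inl hv
    · intro r hr
      by_contra hrp
      rw [hr' r hrp] at hr
      exact hfree r hr
  · intro r hr
    rw [hphase] at hr
    have hrp : r ≠ p := by rintro rfl; rw [hp] at hr; cases hr
    obtain ⟨q, hq, hq'⟩ := h.target r hr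
    rw [hr' r hrp]
    exact ⟨q, by rwa [hphase], hocc q _ hq'⟩
  · intro r s hr hs hrs
    rw [(hord r).1] at hr
    rw [(hord s).1] at hs
    exact h.base_mono r s hr hs (((hord r).2 s hr hs).mp hrs)
  · intro r v hv hvs
    by_cases hr : r = p
    · subst hr
      rw [hp', Agent.mem_nodes_expand] at hv
      have := h.base_le r _ (S r).tail_mem_nodes hs
      rcases hv with rfl | rfl
      · exact this
      · rw [hsd.pos_next _ hs]; omega
    · rw [hr' r hr] at hv; exact h.base_le r v hv hvs
  · have hw : ∀ q v, (S q).Follows v → (S q).head ∉ surface C →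
        (S' q).Follows v ∧ (S' q).head ∉ surface C := by
      intro q v hq1 hq2
      have hqp : q ≠ p := by rintro rfl; exact hq2 (by rwa [hhp])
      rw [hr' q hqp]
      exact ⟨hq1, hq2⟩
    intro r hr
    rw [(hord r).1] at hr
    have hb := hbehind r hr
    by_cases hrp : r = p
    · subst hrp
      rw [hhead', hsd.pos_next _ hs]
      rcases h.stimulated hsd hp he hst with h1 | ⟨h1, q, hq1, hq2⟩
      · left; omega
      · obtain ⟨hq1, hq2⟩ := hw q _ hq1 hq2
        refine Or.inr ⟨by rwa [hphase], ?_, by omega, q, ?_, hq2⟩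
        · rw [hp']; exact Option.some_ne_none _
        · rwa [htail]
    · rw [hr' r hrp]
      rcases h.line r hr with h1 | ⟨h1, h2, h3, q, hq1, hq2⟩
      · left; omega
      · obtain ⟨hq1, hq2⟩ := hw q _ hq1 hq2
        exact Or.inr ⟨h1, h2, by omega, q, hq1, hq2⟩
  · exact cut_of_step h.cut (fun r hr => ⟨by rwa [← hphase], htail r⟩) fun r q k hrq hr hk =>
      ⟨q, hocc q _ hk, Or.inl rfl⟩

/-- The part of the invariant that does not concern the surface is preserved by a handover. -/
theorem handover (h : Invariant C sd pos rank b S) (hsd : SurfaceCoordinates C sd pos)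
    {p q : Fin n} {a k d : Dir} {b' : Fin n → ℤ} (hpq : p ≠ q) (he : (S p).ext = some a)
    (hq : (S q).phase ≠ Phase.inactive) (hqe : (S q).ext = none)
    (hk : (S q).tail + dir k = (S p).tail) (hp' : S' p = (S p).contract)
    (hq' : S' q = (S q).expand k d) (hr' : ∀ r, r ≠ p → r ≠ q → S' r = S r)
    (hgood : ((S q).expand k d).Good C sd rank)
    (htarget : (S q).phase = Phase.follow → (S p).tail + dir d = (S p).head)
    (hmono : ∀ r s, (S' r).head ∈ surface C → (S' s).head ∈ surface C →
      pos (S' r).head < pos (S' s).head → b' r ≤ b' s)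
    (hle : ∀ r, ∀ v ∈ (S' r).nodes, v ∈ surface C → b' r ≤ pos v)
    (hline : ∀ p, (S' p).head ∈ surface C → pos (S' p).head - b' p ≤ 2 * behind C pos S' p ∨
      ((S' p).phase = Phase.lead ∧ (S' p).ext ≠ none ∧
        pos (S' p).head - b' p ≤ 2 * behind C pos S' p + 1 ∧
        ∃ q, (S' q).Follows (S' p).tail ∧ (S' q).head ∉ surface C)) :
    Invariant C sd pos rank b' S' := by
  have hphase : ∀ r, (S' r).phase = (S r).phase := fun r => by
    by_cases hr : r = p
    · subst hr; rw [hp']; rfl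
    · by_cases hrq : r = q
      · subst hrq; rw [hq']; rfl
      · rw [hr' r hr hrq]
  have hpa := (h.good p).not_inactive he
  have hocc : ∀ s, ∀ w ∈ (S s).nodes,
      ∃ r, w ∈ (S' r).nodes ∧ (r = s ∨ (S' r).phase ≠ Phase.inactive) := by
    intro s w hw
    by_cases hs : s = p
    · subst hs
      rcases hw with rfl | hw
      · refine ⟨q, ?_, Or.inr (by rwa [hphase])⟩
        rw [hq', Agent.mem_nodes_expand]
        exact Or.inr hk.symm
      · refine ⟨s, ?_, Or.inl rfl⟩
        rw [hp', Agent.mem_nodes_contract]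
        exact hw
    · refine ⟨s, ?_, Or.inl rfl⟩
      by_cases hsq : s = q
      · subst hsq
        rw [Agent.nodes_of_contracted hqe] at hw
        rw [hq', Agent.mem_nodes_expand]
        exact Or.inl hw
      · rwa [hr' s hs hsq]
  refine ⟨?_, ?_, ?_, h.rank_surface,
    fun v => (h.rank_le v).trans (activeCount_mono fun r hr => by rwa [← hphase]), hmono, hle,
    hline, ?_⟩
  · intro r
    by_cases hr : r = p
    · subst hr; rw [hp']; exact (h.good r).contract hsd
    · by_cases hrq : r = q
      · subst hrq; rwa [hq']
      · rw [hr' r hr hrq]; exact h.good r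
  · refine disjoint_of_step h.disjoint (m := q) (w := (S p).tail) ?_ ?_
    · intro r v hv
      by_cases hr : r = p
      · subst hr
        rw [hp', Agent.mem_nodes_contract] at hv
        exact Or.inl (hv ▸ (S r).head_mem_nodes)
      · by_cases hrq : r = q
        · subst hrq
          rw [hq', Agent.mem_nodes_expand, hk] at hv
          exact hv.imp (fun h' : v = _ => h' ▸ (S r).tail_mem_nodes) fun h' => ⟨rfl, h'⟩
        · rw [hr' r hr hrq] at hv; exact Or.inl hv
    · intro r hr
      by_contra hrq
      by_cases hrp : r = p
      · subst hrp
        rw [hp', Agent.mem_nodes_contract] at hr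
        exact Agent.head_ne_tail he hr.symm
      · rw [hr' r hrp hrq] at hr
        exact hrp (h.disjoint r p _ hr (S p).tail_mem_nodes)
  · intro r hr
    rw [hphase] at hr
    by_cases hrq : r = q
    · subst hrq
      refine ⟨p, by rwa [hphase], ?_⟩
      rw [hq', hp', Agent.mem_nodes_contract, Agent.head_expand, hk]
      exact htarget hr
    · have e : (S' r).head = (S r).head ∧ (S' r).d = (S r).d := by
        by_cases hrp : r = p
        · subst hrp; rw [hp']; exact ⟨rfl, rfl⟩
        · rw [hr' r hrp hrq]; exact ⟨rfl, rfl⟩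
      rw [e.1, e.2]
      obtain ⟨s, hs, hw⟩ := h.target r hr
      obtain ⟨t, ht, ht'⟩ := hocc s _ hw
      refine ⟨t, ?_, ht⟩
      rcases ht' with rfl | ht'
      · rwa [hphase]
      · exact ht'
  · refine cut_of_step h.cut (fun r hr => ?_) fun r s k _ _ hk => hocc s _ hk
    rw [hphase] at hr
    refine ⟨hr, ?_⟩
    by_cases hrp : r = p
    · subst hrp; exact absurd hr hpa
    · by_cases hrq : r = q
      · subst hrq; exact absurd hr hq
      · rw [hr' r hrp hrq]

theorem handoverLead (h : Invariant C sd pos rank b S) (hsd : SurfaceCoordinates C sd pos)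
    {p q : Fin n} {a : Dir} (hpq : p ≠ q) (he : (S p).ext = some a)
    (hq : (S q).phase = Phase.lead) (hqe : (S q).ext = none) (hst : Stimulated S q)
    (hd : (S q).tail + dir (sd (S q).tail) = (S p).tail) (hp' : S' p = (S p).contract)
    (hq' : S' q = (S q).expand (sd (S q).tail) (S q).d)
    (hr' : ∀ r, r ≠ p → r ≠ q → S' r = S r) : Invariant C sd pos rank b S' := by
  have hhq := Agent.head_of_contracted hqe
  have hqs := (h.good q).lead_tail hq
  have hpt : (S p).tail ∈ surface C := hd ▸ hsd.next_mem hqs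
  have hpl := (h.good p).lead_of_tail_mem he hpt
  have hph := (h.good p).head_mem hsd hpt
  have hpp := (h.good p).pos_head hsd he hpt
  have hqp := hsd.pos_next _ hqs
  rw [hd] at hqp
  have hhead : ∀ r, r ≠ q → (S' r).head = (S r).head := fun r hr => by
    by_cases hrp : r = p
    · subst hrp; rw [hp']; rfl
    · rw [hr' r hrp hr]
  have hhead' : (S' q).head = (S p).tail := by rw [hq', Agent.head_expand, hd]
  have hphase : ∀ r, (S' r).phase = (S r).phase := fun r => by
    by_cases hr : r = p
    · subst hr; rw [hp']; rfl
    · by_cases hrq : r = q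
      · subst hrq; rw [hq']; rfl
      · rw [hr' r hr hrq]
  have hnot : ∀ r, r ≠ q → (S r).head ≠ (S q).head + dir (sd (S q).head) := by
    intro r hr hr2
    rw [hhq, hd] at hr2
    obtain rfl : r = p := h.disjoint r p _ (hr2 ▸ (S r).head_mem_nodes) (S p).tail_mem_nodes
    exact Agent.head_ne_tail he hr2
  have hord := advance_order (S := S) (S' := S') hsd (m := q) (by rwa [hhq])
    (by rw [hhead', hhq, hd]) hhead (fun r hr => h.mem_head_unique hr) hnot
  have hbehind : ∀ r, (S r).head ∈ surface C → behind C pos S r ≤ behind C pos S' r := fun r hr =>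
    behind_mono fun q hq hqr => ⟨(hord q).1.mpr hq, ((hord q).2 r hq hr).mpr hqr⟩
  have hw : ∀ s v, (S s).Follows v → (S s).head ∉ surface C →
      (S' s).Follows v ∧ (S' s).head ∉ surface C := by
    intro s v hs1 hs2
    have hsq : s ≠ q := by rintro rfl; exact hs2 (by rwa [hhq])
    have hsp : s ≠ p := by rintro rfl; exact hs2 hph
    rw [hr' s hsp hsq]
    exact ⟨hs1, hs2⟩
  refine h.handover hsd hpq he (by rw [hq]; decide) hqe hd hp' hq' hr'
    ((h.good q).expand_lead hsd hq) (fun h' => by rw [hq] at h'; cases h') ?_ ?_ ?_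
  · intro r s hr hs hrs
    rw [(hord r).1] at hr
    rw [(hord s).1] at hs
    exact h.base_mono r s hr hs (((hord r).2 s hr hs).mp hrs)
  · intro r v hv hvs
    by_cases hrp : r = p
    · subst hrp
      rw [hp', Agent.mem_nodes_contract] at hv
      exact h.base_le r v (hv ▸ (S r).head_mem_nodes) hvs
    · by_cases hrq : r = q
      · subst hrq
        have := h.base_le r _ (S r).tail_mem_nodes hqs
        rw [hq', Agent.mem_nodes_expand, hd] at hv
        rcases hv with rfl | rfl
        · exact this
        · omega
      · rw [hr' r hrp hrq] at hv; exact h.base_le r v hv hvs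
  · intro r hr
    rw [(hord r).1] at hr
    have hb := hbehind r hr
    by_cases hrq : r = q
    · subst hrq
      rw [hhead', hqp]
      rcases h.stimulated hsd hq hqe hst with h1 | ⟨h1, s, hs1, hs2⟩
      · left; omega
      · obtain ⟨hs1, hs2⟩ := hw s _ hs1 hs2
        refine Or.inr ⟨by rwa [hphase], ?_, by omega, s, ?_, hs2⟩
        · rw [hq']; exact Option.some_ne_none _
        · rwa [hq']
    · rw [hhead r hrq]
      by_cases hrp : r = p
      · subst hrp
        left
        rcases h.line r hr with h1 | ⟨-, -, h1, -⟩
        · omega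
        · have h2 := h.displacement_le (p := q) (by rwa [hhq]) (Or.inl hqe)
          have hlt : pos (S q).head < pos (S r).head := by rw [hhq]; omega
          have h3 := h.base_mono q r (by rwa [hhq]) hr hlt
          have h4 := behind_lt (C := C) (S := S) (p := r) (by rwa [hhq]) hlt
          rw [hhq] at h2
          omega
      · rcases h.line r hr with h1 | ⟨h1, h2, h3, s, hs1, hs2⟩
        · left; omega
        · obtain ⟨hs1, hs2⟩ := hw s _ hs1 hs2
          rw [hr' r hrp hrq]
          exact Or.inr ⟨h1, h2, by omega, s, hs1, hs2⟩

/-- A follower that takes over the tail of another agent inherits the base of that agent.  If this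
tail lies on the surface, the follower enters the surface there, and the head of the other agent
has one more agent behind it. -/
theorem handoverFollow (h : Invariant C sd pos rank b S) (hsd : SurfaceCoordinates C sd pos)
    {p q : Fin n} {a : Dir} (hpq : p ≠ q) (he : (S p).ext = some a)
    (hq : (S q).phase = Phase.follow) (hqe : (S q).ext = none) (hqs : (S q).tail ∉ surface C)
    (hd : (S q).tail + dir (S q).d = (S p).tail) (hp' : S' p = (S p).contract)
    (hq' : S' q = (S q).expand (S q).d a)
    (hr' : ∀ r, r ≠ p → r ≠ q → S' r = S r) :
    Invariant C sd pos rank (Function.update b q (b p)) S' := by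
  have hhq := Agent.head_of_contracted hqe
  have hbq : Function.update b q (b p) q = b p := Function.update_self ..
  have hbr : ∀ r, r ≠ q → Function.update b q (b p) r = b r := fun r hr =>
    Function.update_of_ne hr ..
  have hhead : ∀ r, r ≠ q → (S' r).head = (S r).head := fun r hr => by
    by_cases hrp : r = p
    · subst hrp; rw [hp']; rfl
    · rw [hr' r hrp hr]
  have hhead' : (S' q).head = (S p).tail := by rw [hq', Agent.head_expand, hd]
  have hnot : ∀ r, (S r).head ≠ (S p).tail := by
    intro r hr2
    obtain rfl : r = p := h.disjoint r p _ (hr2 ▸ (S r).head_mem_nodes) (S p).tail_mem_nodes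
    exact Agent.head_ne_tail he hr2
  -- If the tail of `p` lies on the surface, no head has a position between those of its nodes.
  have hgap : (S p).tail ∈ surface C → (S p).head ∈ surface C ∧
      pos (S p).head = pos (S p).tail + 1 ∧
      ∀ r, r ≠ p → (S r).head ∈ surface C → pos (S r).head ≠ pos (S p).tail + 1 ∧
        pos (S r).head ≠ pos (S p).tail := by
    intro ht
    have h1 := (h.good p).pos_head hsd he ht
    have h2 := (h.good p).head_mem hsd ht
    exact ⟨h2, h1, fun r hr hrs => ⟨fun h3 => hr (h.mem_head_unique
      (hsd.injOn hrs h2 (by rw [h1, h3]))), fun h3 => hnot r (hsd.injOn hrs ht h3)⟩⟩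
  have hne : ∀ r, (S r).head ∈ surface C → r ≠ q := by
    rintro r hr rfl; rw [hhq] at hr; exact hqs hr
  have hbehind : ∀ r, r ≠ q → behind C pos S r ≤ behind C pos S' r := fun r hr =>
    behind_mono fun s hs hsr => by rw [hhead s (hne s hs), hhead r hr]; exact ⟨hs, hsr⟩
  refine h.handover hsd hpq he (by rw [hq]; decide) hqe hd hp' hq' hr'
    ((h.good q).expand_follow (h.good p) hq hqe hqs he hd)
    (fun _ => (Agent.head_of_expanded he).symm) ?_ ?_ ?_
  · intro r s hr hs hrs
    by_cases hrq : r = q <;> by_cases hsq : s = q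
    · rw [hrq, hsq]
    · subst hrq
      rw [hhead'] at hr hrs
      rw [hhead s hsq] at hs hrs
      obtain ⟨h1, h2, h3⟩ := hgap hr
      rw [hbq, hbr s hsq]
      by_cases hsp : s = p
      · rw [hsp]
      · have := h3 s hsp hs
        exact h.base_mono p s h1 hs (by omega)
    · subst hsq
      rw [hhead'] at hs hrs
      rw [hhead r hrq] at hr hrs
      obtain ⟨h1, h2, h3⟩ := hgap hs
      rw [hbq, hbr r hrq]
      exact h.base_mono r p hr h1 (by omega)
    · rw [hhead r hrq] at hr hrs
      rw [hhead s hsq] at hs hrs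
      rw [hbr r hrq, hbr s hsq]
      exact h.base_mono r s hr hs hrs
  · intro r v hv hvs
    by_cases hrq : r = q
    · subst hrq
      rw [hq', Agent.mem_nodes_expand, hd] at hv
      rw [hbq]
      rcases hv with rfl | rfl
      · exact absurd hvs hqs
      · exact h.base_le p _ (S p).tail_mem_nodes hvs
    · rw [hbr r hrq]
      by_cases hrp : r = p
      · subst hrp
        rw [hp', Agent.mem_nodes_contract] at hv
        exact h.base_le r v (hv ▸ (S r).head_mem_nodes) hvs
      · rw [hr' r hrp hrq] at hv; exact h.base_le r v hv hvs
  · intro r hr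
    by_cases hrq : r = q
    · subst hrq
      left
      rw [hhead'] at hr ⊢
      obtain ⟨h1, h2, h3⟩ := hgap hr
      have hb : behind C pos S p ≤ behind C pos S' r := behind_mono fun s hs hsp => by
        rw [hhead s (hne s hs), hhead']
        refine ⟨hs, ?_⟩
        by_cases hsp' : s = p
        · subst hsp'; exact absurd hsp (lt_irrefl _)
        · have := h3 s hsp' hs
          omega
      rw [hbq]
      rcases h.line p h1 with h4 | ⟨-, -, h4, -⟩ <;> omega
    · rw [hhead r hrq] at hr ⊢
      rw [hbr r hrq]
      have hb := hbehind r hrq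
      rcases h.line r hr with h1 | ⟨h1, h2, h3, s, hs1, hs2⟩
      · left; omega
      · by_cases hrp : r = p
        · subst hrp
          left
          have ht := (h.good r).lead_tail h1
          obtain ⟨h4, h5, h6⟩ := hgap ht
          have : behind C pos S r + 1 ≤ behind C pos S' r :=
            behind_add_one_le (q := q) (by rwa [hhead']) (by rw [hhead', hhead r hrq]; omega)
              fun s hs hsr => ⟨hne s hs, by rw [hhead s (hne s hs), hhead r hrq]; exact ⟨hs, hsr⟩⟩
          omega
        · right
          have hsq : s ≠ q := by
            rintro rfl
            have := hs1.2
            rw [hhq, hd] at this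
            exact hrp (h.disjoint r p _ (this ▸ (S r).tail_mem_nodes) (S p).tail_mem_nodes)
          have e : (S' s).Follows (S r).tail := by
            by_cases hsp : s = p
            · subst hsp; rw [hp']; exact hs1
            · rwa [hr' s hsp hsq]
          rw [hr' r hrp hrq]
          exact ⟨h1, h2, by omega, s, e, by rwa [hhead s hsq]⟩

end Invariant

/-! ### The potential -/

open Classical in
/-- The potential of an occupied node: on the surface it decreases with the displacement, and off
the surface it decreases with the rank. -/
noncomputable def nodePotential (C : Set Node) (pos : Node → ℤ) (n : ℕ) (rank : Node → ℕ) (β : ℤ)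
    (v : Node) : ℤ :=
  if v ∈ surface C then 2 * n + 2 - (pos v - β) else 2 * n + 2 + rank v

/-- The potential of a phase.  It makes up for the rank that an agent obtains when it becomes a
follower. -/
def phasePotential (n : ℕ) : Phase → ℤ
  | Phase.inactive => 2 * n + 2
  | Phase.follow => 1
  | Phase.lead => 0

noncomputable def agentPotential (C : Set Node) (pos : Node → ℤ) (n : ℕ) (rank : Node → ℕ) (β : ℤ)
    (s : Agent) : ℤ :=
  phasePotential n s.phase + nodePotential C pos n rank β s.tail
    + nodePotential C pos n rank β s.head

/-- The potential, which every action but the complaints decreases by at least the number of its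
movements. -/
noncomputable def potential (C : Set Node) (pos : Node → ℤ) {n : ℕ} (rank : Node → ℕ)
    (b : Fin n → ℤ) (S : Fin n → Agent) : ℤ :=
  ∑ p, agentPotential C pos n rank (b p) (S p)

variable {C : Set Node} {sd : Node → Dir} {pos : Node → ℤ} {n : ℕ} {rank rank' : Node → ℕ}
  {b b' : Fin n → ℤ} {S S' : Fin n → Agent} {a : Action n}

theorem nodePotential_mem {β : ℤ} {v : Node} (h : v ∈ surface C) :
    nodePotential C pos n rank β v = 2 * n + 2 - (pos v - β) := if_pos h

theorem nodePotential_notMem {β : ℤ} {v : Node} (h : v ∉ surface C) :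
    nodePotential C pos n rank β v = 2 * n + 2 + rank v := if_neg h

theorem potential_add_le (k : ℤ) (p : Fin n)
    (h : ∀ r, agentPotential C pos n rank' (b' r) (S' r) + (if r = p then k else 0) ≤
      agentPotential C pos n rank (b r) (S r)) :
    potential C pos rank' b' S' + k ≤ potential C pos rank b S := by
  have := Finset.sum_le_sum fun r (_ : r ∈ Finset.univ) => h r
  rwa [Finset.sum_add_distrib, Finset.sum_ite_eq' Finset.univ p, if_pos (Finset.mem_univ p)] at this

theorem nodePotential_lt {β : ℤ} {v w : Node} (h : rank w < rank v) (hv : v ∉ surface C)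
    (hw : w ∈ surface C → β ≤ pos w) (β' : ℤ) :
    nodePotential C pos n rank β w + 1 ≤ nodePotential C pos n rank β' v := by
  rw [nodePotential_notMem hv]
  by_cases hws : w ∈ surface C
  · have := hw hws
    rw [nodePotential_mem hws]; omega
  · rw [nodePotential_notMem hws]; omega

namespace Invariant

/-- The potential of the head is smaller than the one of the tail. -/
theorem nodePotential_head (h : Invariant C sd pos rank b S) (hsd : SurfaceCoordinates C sd pos)
    {p : Fin n} {k : Dir} (he : (S p).ext = some k) :
    nodePotential C pos n rank (b p) (S p).head + 1 ≤
      nodePotential C pos n rank (b p) (S p).tail := by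
  by_cases ht : (S p).tail ∈ surface C
  · rw [nodePotential_mem ht, nodePotential_mem ((h.good p).head_mem hsd ht),
      (h.good p).pos_head hsd he ht]
    omega
  · exact nodePotential_lt ((h.good p).follow_ext k ((h.good p).follow_of_tail_notMem he ht) he).2
      ht (fun hs => h.base_le p _ (S p).head_mem_nodes hs) _

theorem agentPotential_contract (h : Invariant C sd pos rank b S)
    (hsd : SurfaceCoordinates C sd pos) {p : Fin n} {k : Dir} (he : (S p).ext = some k) :
    agentPotential C pos n rank (b p) (S p).contract + 1 ≤
      agentPotential C pos n rank (b p) (S p) := by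
  have h1 := h.nodePotential_head hsd he
  have h2 : agentPotential C pos n rank (b p) (S p).contract =
    phasePotential n (S p).phase + nodePotential C pos n rank (b p) (S p).head
    + nodePotential C pos n rank (b p) (S p).head := rfl
  rw [h2, agentPotential]
  omega

theorem agentPotential_expand_lead (h : Invariant C sd pos rank b S)
    (hsd : SurfaceCoordinates C sd pos) {p : Fin n} (hp : (S p).phase = Phase.lead)
    (he : (S p).ext = none) :
    agentPotential C pos n rank (b p) ((S p).expand (sd (S p).tail) (S p).d) + 1 ≤
      agentPotential C pos n rank (b p) (S p) := by
  have hs := (h.good p).lead_tail hp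
  have h2 : agentPotential C pos n rank (b p) ((S p).expand (sd (S p).tail) (S p).d) =
    phasePotential n (S p).phase + nodePotential C pos n rank (b p) (S p).tail
    + nodePotential C pos n rank (b p) ((S p).tail + dir (sd (S p).tail)) := rfl
  rw [h2, agentPotential, Agent.head_of_contracted he, nodePotential_mem hs,
    nodePotential_mem (hsd.next_mem hs), hsd.pos_next _ hs]
  omega

theorem agentPotential_nonneg (h : Invariant C sd pos rank b S)
    (hsd : SurfaceCoordinates C sd pos) (p : Fin n) :
    0 ≤ agentPotential C pos n rank (b p) (S p) := by
  have h0 : 0 ≤ phasePotential n (S p).phase := by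
    cases (S p).phase <;> simp [phasePotential]; omega
  have h1 : 0 ≤ nodePotential C pos n rank (b p) (S p).head := by
    by_cases hs : (S p).head ∈ surface C
    · rw [nodePotential_mem hs]
      have hn : behind C pos S p ≤ n := behind_le p
      rcases h.line p hs with h1 | ⟨-, -, h1, -⟩ <;> omega
    · rw [nodePotential_notMem hs]; omega
  have h2 : nodePotential C pos n rank (b p) (S p).head ≤
      nodePotential C pos n rank (b p) (S p).tail := by
    rcases he : (S p).ext with _ | k
    · rw [Agent.head_of_contracted he]
    · have := h.nodePotential_head hsd he; omega
  rw [agentPotential]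
  omega

theorem potential_nonneg (h : Invariant C sd pos rank b S) (hsd : SurfaceCoordinates C sd pos) :
    0 ≤ potential C pos rank b S := Finset.sum_nonneg fun p _ => h.agentPotential_nonneg hsd p

theorem lead (h : Invariant C sd pos rank b S) {p : Fin n} (hp : (S p).phase ≠ Phase.lead)
    (he : (S p).ext = none) (hs : (S p).tail ∈ surface C)
    (hp' : S' p = { S p with phase := Phase.lead, comp := none })
    (hr' : ∀ r, r ≠ p → S' r = S r) :
    Invariant C sd pos rank b S' ∧ potential C pos rank b S' + 1 ≤ potential C pos rank b S := by
  have hact : ∀ r, (S' r).phase = Phase.inactive → (S r).phase = Phase.inactive := by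
    intro r hr
    by_cases hrp : r = p
    · subst hrp; rw [hp'] at hr; cases hr
    · rwa [hr' r hrp] at hr
  constructor
  · refine h.idle ?_ ?_ ?_ hact h.rank_surface
      (fun v => (h.rank_le v).trans (activeCount_mono hact)) ?_ ?_ ?_
    · intro r
      by_cases hrp : r = p
      · subst hrp; rw [hp']
      · rw [hr' r hrp]
    · intro r
      by_cases hrp : r = p
      · subst hrp; rw [hp']
      · rw [hr' r hrp]
    · intro r
      by_cases hrp : r = p
      · subst hrp
        rw [hp']
        refine ⟨(h.good r).notMem, ?_, fun _ => hs, ?_, ?_, ?_, ?_, ?_⟩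
        · intro h; cases h
        · intro a _ ha; exact absurd (he.symm.trans ha) (by simp)
        · intro a h; cases h
        · intro h; cases h
        · intro h; cases h
        · intro k h; cases h
      · rw [hr' r hrp]; exact h.good r
    · intro r hr
      by_cases hrp : r = p
      · subst hrp; rw [hp'] at hr; cases hr
      · rw [hr' r hrp] at hr ⊢; exact h.target r hr
    · intro r hr
      by_cases hrp : r = p
      · subst hrp; rw [hp']
      · rwa [hr' r hrp]
    · intro r hr hh
      by_cases hrp : r = p
      · subst hrp; rw [Agent.head_of_contracted he] at hh; exact absurd hs hh
      · rw [hr' r hrp]; exact ⟨hr, rfl⟩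
  · refine potential_add_le 1 p fun r => ?_
    by_cases hrp : r = p
    · subst hrp
      rw [if_pos rfl, hp']
      have e : agentPotential C pos n rank (b r) { S r with phase := Phase.lead, comp := none } =
        0 + nodePotential C pos n rank (b r) (S r).tail
          + nodePotential C pos n rank (b r) (S r).head := rfl
      rw [e, agentPotential]
      have : 1 ≤ phasePotential n (S r).phase := by
        rcases hph : (S r).phase with _ | _ | _
        · simp only [phasePotential]; omega
        · simp [phasePotential]
        · exact absurd hph hp
      omega
    · rw [if_neg hrp, hr' r hrp, add_zero]

/-- A new follower obtains a rank that exceeds all the previous ones; the bound of the ranks by the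
number of active agents makes this affordable. -/
theorem follow (h : Invariant C sd pos rank b S) {p q : Fin n} {k : Dir}
    (hp : (S p).phase = Phase.inactive) (he : (S p).ext = none) (hs : (S p).tail ∉ surface C)
    (hqp : q ≠ p) (hq : (S q).phase ≠ Phase.inactive) (hk : (S p).tail + dir k ∈ (S q).nodes)
    (hp' : S' p = { S p with phase := Phase.follow, d := k, comp := none })
    (hr' : ∀ r, r ≠ p → S' r = S r) :
    ∃ rank', Invariant C sd pos rank' b S' ∧
      potential C pos rank' b S' + 1 ≤ potential C pos rank b S := by
  classical
  have hact : ∀ r, (S' r).phase = Phase.inactive → (S r).phase = Phase.inactive := by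
    intro r hr
    by_cases hrp : r = p
    · subst hrp; exact hp
    · rwa [hr' r hrp] at hr
  have hcount : activeCount S + 1 ≤ activeCount S' :=
    activeCount_add_one_le hact hp (by rw [hp']; exact Phase.noConfusion)
  have hhp := Agent.head_of_contracted he
  have ne_tail : ∀ r v, r ≠ p → v ∈ (S r).nodes → v ≠ (S p).tail := fun r v hr hv h' =>
    hr (h.disjoint r p v hv (h' ▸ (S p).tail_mem_nodes))
  let rank' : Node → ℕ := Function.update rank (S p).tail (activeCount S + 1)
  have hrank : ∀ r v, r ≠ p → v ∈ (S r).nodes → rank' v = rank v := fun r v hr hv =>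
    Function.update_of_ne (ne_tail r v hr hv) ..
  have hrank' : rank' (S p).tail = activeCount S + 1 := Function.update_self ..
  refine ⟨rank', ?_, ?_⟩
  · refine h.idle ?_ ?_ ?_ hact ?_ ?_ ?_ ?_ ?_
    · intro r
      by_cases hrp : r = p
      · subst hrp; rw [hp']
      · rw [hr' r hrp]
    · intro r
      by_cases hrp : r = p
      · subst hrp; rw [hp']
      · rw [hr' r hrp]
    · intro r
      by_cases hrp : r = p
      · subst hrp
        rw [hp']
        refine ⟨(h.good r).notMem, ?_, ?_, ?_, ?_, ?_, ?_, ?_⟩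
        · intro h; cases h
        · intro h; cases h
        · intro a h; cases h
        · intro a _ ha; exact absurd (he.symm.trans ha) (by simp)
        · intro _ hh
          exact absurd (show (S r).head ∈ surface C from hh) (by rwa [hhp])
        · intro _ _
          show rank' ((S r).head + dir k) < rank' (S r).head
          rw [hhp, hrank', hrank q _ hqp hk]
          exact Nat.lt_succ_of_le (h.rank_le _)
        · intro k h; cases h
      · rw [hr' r hrp]
        have hg := h.good r
        refine ⟨hg.notMem, hg.inactive, hg.lead_tail, hg.lead_ext, ?_, hg.follow_surface, ?_,
          hg.comp⟩
        · rw [hrank r _ hrp (S r).tail_mem_nodes, hrank r _ hrp (S r).head_mem_nodes]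
          exact hg.follow_ext
        · intro hf hh
          obtain ⟨s, hs1, hs2⟩ := h.target r hf
          have hsp : s ≠ p := by rintro rfl; exact hs1 hp
          rw [hrank s _ hsp hs2, hrank r _ hrp (S r).head_mem_nodes]
          exact hg.follow_rank hf hh
    · intro v hv
      have : v ≠ (S p).tail := by rintro rfl; exact hs hv
      exact (Function.update_of_ne this ..).trans (h.rank_surface v hv)
    · intro v
      by_cases hv : v = (S p).tail
      · rw [hv, hrank']; exact hcount
      · have : rank' v = rank v := Function.update_of_ne hv ..
        rw [this]
        exact (h.rank_le v).trans (by omega)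
    · intro r hr
      by_cases hrp : r = p
      · subst hrp
        refine ⟨q, hq, ?_⟩
        rw [hp', hhp]
        exact hk
      · rw [hr' r hrp] at hr ⊢; exact h.target r hr
    · intro r hr
      by_cases hrp : r = p
      · subst hrp; rw [hp] at hr; cases hr
      · rwa [hr' r hrp]
    · intro r hr hh
      by_cases hrp : r = p
      · subst hrp; rw [hp] at hr; cases hr
      · rw [hr' r hrp]; exact ⟨hr, rfl⟩
  · refine potential_add_le 1 p fun r => ?_
    by_cases hrp : r = p
    · subst hrp
      rw [if_pos rfl, hp']
      have e : agentPotential C pos n rank' (b r)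
          { S r with phase := Phase.follow, d := k, comp := none } =
        1 + nodePotential C pos n rank' (b r) (S r).tail
          + nodePotential C pos n rank' (b r) (S r).head := rfl
      rw [e, agentPotential, hhp, nodePotential_notMem hs, nodePotential_notMem hs, hp, hrank',
        phasePotential]
      have : activeCount S' ≤ n := activeCount_le
      omega
    · rw [if_neg hrp, hr' r hrp, add_zero]
      have e : ∀ v ∈ (S r).nodes, nodePotential C pos n rank' (b r) v =
          nodePotential C pos n rank (b r) v := fun v hv => by
        simp only [nodePotential, hrank r v hrp hv]
      rw [agentPotential, agentPotential, e _ (S r).tail_mem_nodes, e _ (S r).head_mem_nodes]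

theorem complain (h : Invariant C sd pos rank b S) {p : Fin n} (hp : (S p).phase = Phase.lead)
    (he : (S p).ext = none) (hp' : S' p = { S p with comp := some (sd (S p).tail) })
    (hr' : ∀ r, r ≠ p → S' r = S r) :
    Invariant C sd pos rank b S' ∧ potential C pos rank b S' = potential C pos rank b S := by
  have hfield : ∀ r, (S' r).phase = (S r).phase ∧ (S' r).tail = (S r).tail ∧
      (S' r).ext = (S r).ext ∧ (S' r).d = (S r).d ∧ (S' r).head = (S r).head ∧
      (S' r).nodes = (S r).nodes := by
    intro r
    by_cases hrp : r = p
    · subst hrp; rw [hp']; exact ⟨rfl, rfl, rfl, rfl, rfl, rfl⟩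
    · rw [hr' r hrp]; exact ⟨rfl, rfl, rfl, rfl, rfl, rfl⟩
  constructor
  · refine h.idle (fun r => (hfield r).2.1) (fun r => (hfield r).2.2.1) ?_
      (fun r => by rw [(hfield r).1]; exact id) h.rank_surface
      (fun v => (h.rank_le v).trans (activeCount_mono fun r => by rw [(hfield r).1]; exact id))
      (fun r hr => ?_) (fun r => by rw [(hfield r).1]; exact id)
      (fun r hr _ => by rw [(hfield r).1]; exact ⟨hr, (hfield r).2.2.2.1⟩)
    · intro r
      by_cases hrp : r = p
      · subst hrp
        rw [hp']
        have hg := h.good r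
        refine ⟨hg.notMem, hg.inactive, hg.lead_tail, hg.lead_ext, hg.follow_ext,
          hg.follow_surface, hg.follow_rank, ?_⟩
        intro k hk
        exact ⟨hp, he, (Option.some.inj hk).symm⟩
      · rw [hr' r hrp]; exact h.good r
    · rw [(hfield r).1] at hr
      rw [(hfield r).2.2.2.1]
      exact h.target r hr
  · simp only [potential, agentPotential, hfield]

theorem add_zero_le_of_add_one_le {x y : ℤ} (h : x + 1 ≤ y) : x + ((0 : ℕ) : ℤ) ≤ y := by
  push_cast; omega

theorem add_two_le_of_add_one_le {x y z : ℤ} (h : x + 1 ≤ y) (h' : y + 1 ≤ z) :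
    x + 1 ≤ z ∧ x + ((2 : ℕ) : ℤ) ≤ z := by
  push_cast; omega

/-- Every action preserves the invariant, and unless it is a complaint it decreases the
potential. -/
theorem step (h : Invariant C sd pos rank b S) (hsd : SurfaceCoordinates C sd pos)
    (hst : AgentStep C sd S a S') :
    ∃ rank' b', Invariant C sd pos rank' b' S' ∧
      ((∃ p q, a = Action.idle p ∧ (S p).phase = Phase.lead ∧ (S p).ext = none ∧ q ≠ p ∧
          (S p).tail + dir (sd (S p).tail) ∈ (S q).nodes ∧
          S' = Function.update S p { S p with comp := some (sd (S p).tail) } ∧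
          potential C pos rank' b' S' = potential C pos rank b S) ∨
        (potential C pos rank' b' S' + 1 ≤ potential C pos rank b S ∧
          potential C pos rank' b' S' + a.movements ≤ potential C pos rank b S)) := by
  cases hst with
  | lead p hp he hs =>
    obtain ⟨h1, h2⟩ := h.lead hp he hs (Function.update_self ..)
      (fun r hr => Function.update_of_ne hr ..)
    exact ⟨rank, b, h1, Or.inr ⟨h2, add_zero_le_of_add_one_le h2⟩⟩
  | follow p q k hp he hs hqp hq hk =>
    obtain ⟨rank', h1, h2⟩ := h.follow hp he hs hqp hq hk (Function.update_self ..)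
      (fun r hr => Function.update_of_ne hr ..)
    exact ⟨rank', b, h1, Or.inr ⟨h2, add_zero_le_of_add_one_le h2⟩⟩
  | complain p q hp he hqp hq =>
    obtain ⟨h1, h2⟩ := h.complain hp he (Function.update_self ..)
      (fun r hr => Function.update_of_ne hr ..)
    exact ⟨rank, b, h1, Or.inl ⟨p, q, rfl, hp, he, hqp, hq, rfl, h2⟩⟩
  | expand p hp he hst hfree =>
    have hp' := Function.update_self p ((S p).expand (sd (S p).tail) (S p).d) S
    have hr' : ∀ r, r ≠ p →
      Function.update S p ((S p).expand (sd (S p).tail) (S p).d) r = S r := fun r hr =>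
        Function.update_of_ne hr ..
    refine ⟨rank, b, h.expand hsd hp he hst hfree hp' hr', Or.inr ?_⟩
    have := potential_add_le (C := C) (pos := pos) (rank := rank) (b := b) (rank' := rank)
        (b' := b) (S := S) (S' := Function.update S p ((S p).expand (sd (S p).tail) (S p).d))
        1 p fun r => by
      by_cases hrp : r = p
      · subst hrp
        rw [if_pos rfl, hp']
        exact h.agentPotential_expand_lead hsd hp he
      · rw [if_neg hrp, hr' r hrp, add_zero]
    exact ⟨this, this⟩
  | contract p k he hf hi =>
    have hp' := Function.update_self p (S p).contract S
    have hr' : ∀ r, r ≠ p → Function.update S p (S p).contract r = S r := fun r hr =>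
        Function.update_of_ne hr ..
    refine ⟨rank, b, h.contract hsd he hf hi hp' hr', Or.inr ?_⟩
    have := potential_add_le (C := C) (pos := pos) (rank := rank) (b := b) (rank' := rank)
        (b' := b) (S := S) (S' := Function.update S p (S p).contract) 1 p fun r => by
      by_cases hrp : r = p
      · subst hrp
        rw [if_pos rfl, hp']
        exact h.agentPotential_contract hsd he
      · rw [if_neg hrp, hr' r hrp, add_zero]
    exact ⟨this, this⟩
  | handoverFollow p q k hpq he hq hqe hs hd =>
    set S' := Function.update (Function.update S p (S p).contract) q ((S q).expand (S q).d k)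
      with hS'
    have hq' : S' q = (S q).expand (S q).d k := Function.update_self ..
    have hp' : S' p = (S p).contract := by
      rw [hS', Function.update_of_ne hpq, Function.update_self]
    have hr' : ∀ r, r ≠ p → r ≠ q → S' r = S r := fun r hr hrq => by
      rw [hS', Function.update_of_ne hrq, Function.update_of_ne hr]
    refine ⟨rank, _, h.handoverFollow hsd hpq he hq hqe hs hd hp' hq' hr', Or.inr ?_⟩
    have := potential_add_le (C := C) (pos := pos) (rank := rank) (b := b) (rank' := rank)
        (b' := Function.update b q (b p)) (S := S) (S' := Function.update S q (S' q)) 1 q fun r => by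
      by_cases hrq : r = q
      · subst hrq
        rw [if_pos rfl, Function.update_self, Function.update_self, hq']
        have e : agentPotential C pos n rank (b p) ((S r).expand (S r).d k) =
          phasePotential n (S r).phase + nodePotential C pos n rank (b p) (S r).tail
            + nodePotential C pos n rank (b p) ((S r).tail + dir (S r).d) := rfl
        have hlt := (h.good r).follow_rank hq (by rwa [Agent.head_of_contracted hqe])
        rw [Agent.head_of_contracted hqe] at hlt
        have h1 := nodePotential_lt (C := C) (pos := pos) (n := n) (β := b p) hlt hs
          (fun hw => by rw [hd] at hw ⊢; exact h.base_le p _ (S p).tail_mem_nodes hw) (b r)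
        rw [e, agentPotential, Agent.head_of_contracted hqe]
        rw [nodePotential_notMem hs] at h1 ⊢
        rw [nodePotential_notMem hs]
        omega
      · rw [if_neg hrq, Function.update_of_ne hrq, Function.update_of_ne hrq, add_zero]
    have h2 := potential_add_le (C := C) (pos := pos) (rank := rank)
        (b := Function.update b q (b p)) (rank' := rank)
        (b' := Function.update b q (b p)) (S := Function.update S q (S' q)) (S' := S') 1 p
        fun r => by
      by_cases hrp : r = p
      · subst hrp
        rw [if_pos rfl, Function.update_of_ne hpq, Function.update_of_ne hpq, hp']
        exact h.agentPotential_contract hsd he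
      · rw [if_neg hrp, add_zero]
        by_cases hrq : r = q
        · subst hrq; rw [Function.update_self, Function.update_self]
        · rw [Function.update_of_ne hrq, Function.update_of_ne hrq, hr' r hrp hrq]
    exact ⟨(add_two_le_of_add_one_le h2 this).1, (add_two_le_of_add_one_le h2 this).2⟩
  | handoverLead p q k hpq he hq hqe hst hd =>
    set S' := Function.update (Function.update S p (S p).contract) q
      ((S q).expand (sd (S q).tail) (S q).d) with hS'
    have hq' : S' q = (S q).expand (sd (S q).tail) (S q).d := Function.update_self ..
    have hp' : S' p = (S p).contract := by
      rw [hS', Function.update_of_ne hpq, Function.update_self]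
    have hr' : ∀ r, r ≠ p → r ≠ q → S' r = S r := fun r hr hrq => by
      rw [hS', Function.update_of_ne hrq, Function.update_of_ne hr]
    refine ⟨rank, _, h.handoverLead hsd hpq he hq hqe hst hd hp' hq' hr', Or.inr ?_⟩
    have := potential_add_le (C := C) (pos := pos) (rank := rank) (b := b) (rank' := rank)
        (b' := b) (S := S) (S' := Function.update S q (S' q)) 1 q fun r => by
      by_cases hrq : r = q
      · subst hrq
        rw [if_pos rfl, Function.update_self, hq']
        exact h.agentPotential_expand_lead hsd hq hqe
      · rw [if_neg hrq, Function.update_of_ne hrq, add_zero]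
    have h2 := potential_add_le (C := C) (pos := pos) (rank := rank) (b := b) (rank' := rank)
        (b' := b) (S := Function.update S q (S' q)) (S' := S') 1 p fun r => by
      by_cases hrp : r = p
      · subst hrp
        rw [if_pos rfl, Function.update_of_ne hpq, hp']
        exact h.agentPotential_contract hsd he
      · rw [if_neg hrp, add_zero]
        by_cases hrq : r = q
        · subst hrq; rw [Function.update_self]
        · rw [Function.update_of_ne hrq, hr' r hrp hrq]
    exact ⟨(add_two_le_of_add_one_le h2 this).1, (add_two_le_of_add_one_le h2 this).2⟩

end Invariant

end Coating

/-- A nonempty set is connected if every predicate that does not change along its edges is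
constant on it. -/
theorem ConnectedSet.of_constant {S : Set Node} (hne : S.Nonempty)
    (h : ∀ g : Node → Prop, (∀ u ∈ S, ∀ k, u + dir k ∈ S → (g (u + dir k) ↔ g u)) →
      ∀ u ∈ S, ∀ v ∈ S, (g u ↔ g v)) : ConnectedSet S := by
  have : Nonempty S := hne.to_subtype
  refine ⟨fun u v => ?_⟩
  refine ((h (fun w => ∃ hw : w ∈ S, (Geqt.induce S).Reachable u ⟨w, hw⟩) ?_ u u.2 v v.2).mp
    ⟨u.2, SimpleGraph.Reachable.refl _⟩).2
  intro w hw k hk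
  have hadj : (Geqt.induce S).Adj ⟨w, hw⟩ ⟨w + dir k, hk⟩ := Geqt_adj_dir w k
  exact ⟨fun ⟨_, hr⟩ => ⟨hw, hr.trans hadj.symm.reachable⟩,
    fun ⟨_, hr⟩ => ⟨hk, hr.trans hadj.reachable⟩⟩

/-- Sequences by dependent choice. -/
theorem exists_seq {α : Type*} (P : ℕ → α → Prop) (R : ℕ → α → α → Prop) {x₀ : α} (h0 : P 0 x₀)
    (hs : ∀ t x, P t x → ∃ y, P (t + 1) y ∧ R t x y) :
    ∃ f : ℕ → α, f 0 = x₀ ∧ (∀ t, P t (f t)) ∧ ∀ t, R t (f t) (f (t + 1)) := by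
  classical
  choose! g hg hR using hs
  let f : ℕ → α := fun t => Nat.rec x₀ (fun t x => g t x) t
  have hP : ∀ t, P t (f t) := fun t => by
    induction t with
    | zero => exact h0
    | succ t ih => exact hg t _ ih
  exact ⟨f, rfl, hP, fun t => hR t _ (hP t)⟩

namespace Coating

/-! ### Connectivity and the initial configuration -/

namespace Invariant

variable {C : Set Node} {sd : Node → Dir} {pos : Node → ℤ} {n : ℕ} {rank : Node → ℕ}
  {b : Fin n → ℤ} {S : Fin n → Agent}

/-- Following the followers leads to the surface, because the rank decreases, and the inactive
agents are connected to the others by the condition `cut`. -/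
theorem connectedSet (h : Invariant C sd pos rank b S) (hsd : SurfaceCoordinates C sd pos)
    (hC : ConnectedSet C) : ConnectedSet (C ∪ ⋃ p, (S p).nodes) := by
  obtain ⟨⟨c₀, hc₀⟩⟩ := hC.nonempty
  refine ConnectedSet.of_constant ⟨c₀, Or.inl hc₀⟩ fun g hg => ?_
  have hocc : ∀ {p w}, w ∈ (S p).nodes → w ∈ C ∪ ⋃ p, (S p).nodes := fun {p w} hw =>
    Or.inr (Set.mem_iUnion.mpr ⟨p, hw⟩)
  have hCg : ∀ v ∈ C, (g v ↔ g c₀) := fun v hv =>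
    iff_of_eq (hC.constant g (fun u hu k hk => propext (hg u (Or.inl hu) k (Or.inl hk))) hv hc₀)
  have hsurf : ∀ {p v}, v ∈ (S p).nodes → v ∈ surface C → (g v ↔ g c₀) := by
    intro p v hv hs
    obtain ⟨-, k, hk⟩ := mem_surface_iff.mp hs
    exact (hg v (hocc hv) k (Or.inl hk)).symm.trans (hCg _ hk)
  have hnodes : ∀ p, ∀ v ∈ (S p).nodes, (g v ↔ g (S p).head) := by
    rintro p v (rfl | rfl)
    · rcases he : (S p).ext with _ | a
      · rw [Agent.head_of_contracted he]
      · have := hg _ (hocc (S p).tail_mem_nodes) a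
          (by rw [← Agent.head_of_expanded he]; exact hocc (S p).head_mem_nodes)
        rw [← Agent.head_of_expanded he] at this
        exact this.symm
    · rfl
  have hactive : ∀ r p, (S p).phase ≠ Phase.inactive → rank (S p).head = r →
      (g (S p).head ↔ g c₀) := by
    intro r
    induction r using Nat.strong_induction_on with
    | _ r ih =>
      rintro p hp rfl
      by_cases hs : (S p).head ∈ surface C
      · exact hsurf (S p).head_mem_nodes hs
      have hpf : (S p).phase = Phase.follow := by
        rcases hph : (S p).phase with _ | _ | _
        · exact absurd hph hp
        · rfl
        · exact absurd ((h.good p).head_mem hsd ((h.good p).lead_tail hph)) hs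
      obtain ⟨q, hq, hw⟩ := h.target p hpf
      have hlt := (h.good p).follow_rank hpf hs
      rw [← hg _ (hocc (S p).head_mem_nodes) _ (hocc hw)]
      by_cases hws : (S p).head + dir (S p).d ∈ surface C
      · exact hsurf hw hws
      rw [hnodes q _ hw]
      rcases hw with hw | hw
      · rcases he : (S q).ext with _ | a
        · refine ih _ ?_ q hq rfl
          rwa [Agent.head_of_contracted he, ← hw]
        · rw [hw] at hws hlt
          exact ih _ (((h.good q).follow_ext a ((h.good q).follow_of_tail_notMem he hws)
            he).2.trans hlt) q hq rfl
      · refine ih _ ?_ q hq rfl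
        rwa [← hw]
  have hall : ∀ p, (g (S p).head ↔ g c₀) := by
    by_contra hcon
    obtain ⟨p₀, hp₀⟩ := not_forall.mp hcon
    obtain ⟨p, hp, hp'⟩ := h.cut {p | ¬ (g (S p).head ↔ g c₀)} ⟨p₀, hp₀⟩
      fun p hp => by_contra fun hpa => hp (hactive _ p hpa rfl)
    rw [Set.mem_ofPred_eq, ← hnodes p _ (S p).tail_mem_nodes] at hp
    rcases hp' with hs | ⟨q, hq, k, hk⟩
    · exact hp (hsurf (S p).tail_mem_nodes hs)
    · rw [Set.mem_ofPred_eq, not_not] at hq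
      rw [← hg _ (hocc (S p).tail_mem_nodes) k (hocc hk), hnodes q _ hk] at hp
      exact hp hq
  have hfin : ∀ v ∈ C ∪ ⋃ p, (S p).nodes, (g v ↔ g c₀) := by
    rintro v (hv | hv)
    · exact hCg v hv
    · obtain ⟨p, hp⟩ := Set.mem_iUnion.mp hv
      exact (hnodes p v hp).trans (hall p)
  exact fun u hu v hv => (hfin u hu).trans (hfin v hv).symm

end Invariant

variable {pick : Finset (Fin 10) → Fin 10} {n : ℕ} {c : Config (coating pick) n}

theorem Represents.occupied_eq {S : Fin n → Agent} (h : Represents S c) :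
    c.occupied = c.obj ∪ ⋃ p, (S p).nodes := by
  ext w
  rw [h.mem_occupied, Set.mem_union, Set.mem_iUnion]

theorem Invariant.disjointed {C : Set Node} {sd : Node → Dir} {pos : Node → ℤ} {rank : Node → ℕ}
    {b : Fin n → ℤ} {S : Fin n → Agent} (h : Invariant C sd pos rank b S)
    (hS : ∀ p, Describes (S p) (c.part p)) (hC : c.obj = C) : c.Disjointed := by
  refine ⟨fun p => ?_, fun p q hpq => ?_⟩
  · rw [(hS p).nodes, hC]
    exact Set.disjoint_left.mpr (h.good p).notMem
  · rw [(hS p).nodes, (hS q).nodes]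
    exact Set.disjoint_left.mpr fun v hp hq => hpq (h.disjoint p q v hp hq)

/-- The agents of an initial configuration. -/
def initialAgent (c : Config (coating pick) n) (p : Fin n) : Agent :=
  ⟨Phase.inactive, (c.part p).tail, none, (c.part p).orient, none⟩

theorem represents_initial (h : c.Initial) : Represents (initialAgent c) c where
  disjointed := h.disjointed
  describes p := by
    have hs := h.state p
    refine ⟨?_, ?_, ?_, rfl, h.contracted p, ?_⟩
    · rw [hs]; rfl
    · rw [hs]; rfl
    · rw [hs]; exact (sub_self _).symm
    · rw [h.flags p, hs]; rfl

theorem invariant_initial (h : c.Initial) (sd : Node → Dir) (pos : Node → ℤ) :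
    Invariant c.obj sd pos (fun _ => 0) (fun p => pos (initialAgent c p).tail)
      (initialAgent c) := by
  have hR := represents_initial h
  have hhead : ∀ p, (initialAgent c p).head = (initialAgent c p).tail := fun p => rfl
  have hnodes : ∀ p, (initialAgent c p).nodes = {(initialAgent c p).tail} := fun p =>
    Agent.nodes_of_contracted rfl
  have hphase : ∀ p, (initialAgent c p).phase = Phase.inactive := fun p => rfl
  refine ⟨fun p => ⟨?_, fun _ => rfl, ?_, ?_, ?_, ?_, ?_, ?_⟩, ?_, ?_, fun _ _ => rfl,
    fun _ => Nat.zero_le _, ?_, ?_, ?_, ?_⟩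
  · intro v hv
    rw [hnodes, Set.mem_singleton_iff] at hv
    rw [hv]
    exact hR.tail_notMem p
  · intro h; cases h
  · intro a h; cases h
  · intro a h; cases h
  · intro h; cases h
  · intro h; cases h
  · intro k h; cases h
  · exact fun p q v hp hq => hR.eq_of_mem hp hq
  · intro p h; cases h
  · exact fun p q _ _ hpq => hpq.le
  · intro p v hv _
    rw [hnodes, Set.mem_singleton_iff] at hv
    rw [hv]
  · intro p _
    left
    rw [hhead, sub_self]
    positivity
  · intro T hT _
    by_contra! hcon
    obtain ⟨p₀, hp₀⟩ := hT
    have hconn := h.connected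
    obtain ⟨⟨c₀, hc₀⟩⟩ := h.valid.1.nonempty
    have key : ∀ u ∈ c.occupied, ∀ k, u + dir k ∈ c.occupied →
        (∃ p ∈ T, u = (initialAgent c p).tail) → ∃ p ∈ T, u + dir k = (initialAgent c p).tail := by
      rintro u - k hk ⟨p, hp, rfl⟩
      rcases hR.mem_occupied.mp hk with hk | ⟨q, hq⟩
      · exact absurd (mem_surface_iff.mpr ⟨hR.tail_notMem p, k, hk⟩) (hcon p hp).1
      · refine ⟨q, by_contra fun hqT => (hcon p hp).2 q hqT k hq, ?_⟩
        rwa [hnodes, Set.mem_singleton_iff] at hq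
    have := hconn.constant (fun u => ∃ p ∈ T, u = (initialAgent c p).tail) (fun u hu k hk => by
      refine propext ⟨fun h' => ?_, key u hu k hk⟩
      have := key _ hk (k + 3) (by rwa [add_dir_opp]) h'
      rwa [add_dir_opp] at this)
      (hR.mem_occupied.mpr (Or.inr ⟨p₀, (initialAgent c p₀).tail_mem_nodes⟩))
      (hR.mem_occupied.mpr (Or.inl hc₀))
    obtain ⟨p, -, hp⟩ := this.mp ⟨p₀, hp₀, rfl⟩
    exact hR.tail_notMem p (hp ▸ hc₀)

theorem potential_initial (c : Config (coating pick) n) (C : Set Node) (pos : Node → ℤ) :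
    potential C pos (fun _ => 0) (fun p => pos (initialAgent c p).tail) (initialAgent c) ≤
      12 * (n : ℤ) ^ 2 := by
  have hp : ∀ p : Fin n, agentPotential C pos n (fun _ => 0) (pos (initialAgent c p).tail)
      (initialAgent c p) = 6 * n + 6 := by
    intro p
    have hhead : (initialAgent c p).head = (initialAgent c p).tail := rfl
    have hphase : (initialAgent c p).phase = Phase.inactive := rfl
    rw [agentPotential, hhead, hphase, phasePotential, nodePotential]
    split_ifs <;> push_cast <;> ring
  rw [potential, Finset.sum_congr rfl fun p _ => hp p, Finset.sum_const, Finset.card_univ,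
    Fintype.card_fin, nsmul_eq_mul]
  rcases Nat.eq_zero_or_pos n with rfl | hn
  · simp
  · have : (1 : ℤ) ≤ n := by exact_mod_cast hn
    nlinarith

/-! ### Executions -/

/-- The step in which a leader sends a complaint indicator to the next surface node, which is
occupied. -/
def Complaint (sd : Node → Dir) (S : Fin n → Agent) (a : Action n) (S' : Fin n → Agent) : Prop :=
  ∃ p q, a = Action.idle p ∧ (S p).phase = Phase.lead ∧ (S p).ext = none ∧ q ≠ p ∧
    (S p).tail + dir (sd (S p).tail) ∈ (S q).nodes ∧
    S' = Function.update S p { S p with comp := some (sd (S p).tail) }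

/-- An execution in terms of agents. -/
structure Trace (e : Execution (coating pick) n) (C : Set Node) (sd : Node → Dir) (pos : Node → ℤ)
    (rank : ℕ → Node → ℕ) (b : ℕ → Fin n → ℤ) (S : ℕ → Fin n → Agent) : Prop where
  obj : ∀ t, (e.conf t).obj = C
  represents : ∀ t, Represents (S t) (e.conf t)
  invariant : ∀ t, Invariant C sd pos (rank t) (b t) (S t)
  halt : ∀ t, e.act t = none → S (t + 1) = S t ∧
    potential C pos (rank (t + 1)) (b (t + 1)) (S (t + 1)) = potential C pos (rank t) (b t) (S t)
  step : ∀ t a, e.act t = some a →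
    (Complaint sd (S t) a (S (t + 1)) ∧
      potential C pos (rank (t + 1)) (b (t + 1)) (S (t + 1)) =
        potential C pos (rank t) (b t) (S t)) ∨
    (potential C pos (rank (t + 1)) (b (t + 1)) (S (t + 1)) + 1 ≤
        potential C pos (rank t) (b t) (S t) ∧
      potential C pos (rank (t + 1)) (b (t + 1)) (S (t + 1)) + a.movements ≤
        potential C pos (rank t) (b t) (S t))

theorem exists_trace {e : Execution (coating pick) n} (he : (e.conf 0).Initial)
    (hpick : ∀ S : Finset (Fin 10), S.Nonempty → pick S ∈ S) {sd : Node → Dir} {pos : Node → ℤ}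
    (hsd : SurfaceCoordinates (e.conf 0).obj sd pos) :
    ∃ rank b S, Trace e (e.conf 0).obj sd pos rank b S ∧
      potential (e.conf 0).obj pos (rank 0) (b 0) (S 0) ≤ 12 * (n : ℤ) ^ 2 := by
  set C := (e.conf 0).obj with hC
  obtain ⟨f, hf0, hP, hR⟩ := exists_seq (α := (Node → ℕ) × (Fin n → ℤ) × (Fin n → Agent))
    (fun t x => (e.conf t).obj = C ∧ Represents x.2.2 (e.conf t) ∧
      Invariant C sd pos x.1 x.2.1 x.2.2)
    (fun t x y => (e.act t = none → y.2.2 = x.2.2 ∧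
        potential C pos y.1 y.2.1 y.2.2 = potential C pos x.1 x.2.1 x.2.2) ∧
      ∀ a, e.act t = some a →
        (Complaint sd x.2.2 a y.2.2 ∧
          potential C pos y.1 y.2.1 y.2.2 = potential C pos x.1 x.2.1 x.2.2) ∨
        (potential C pos y.1 y.2.1 y.2.2 + 1 ≤ potential C pos x.1 x.2.1 x.2.2 ∧
          potential C pos y.1 y.2.1 y.2.2 + a.movements ≤ potential C pos x.1 x.2.1 x.2.2))
    (x₀ := (_, _, _)) ⟨rfl, represents_initial he, invariant_initial he sd pos⟩ (by
      rintro t ⟨rank, b, S⟩ ⟨h1, h2, h3⟩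
      rcases ha : e.act t with _ | a
      · refine ⟨(rank, b, S), ?_, fun _ => ⟨rfl, rfl⟩, fun a h => by cases h⟩
        rw [(e.halt t ha).2]
        exact ⟨h1, h2, h3⟩
      · obtain ⟨S', hst, hd, hobj⟩ := h2.step (by rw [h1]; exact hsd) hpick
          (fun p => (h3.good p).inactive)
          (fun p hp _ => by rw [h1]; exact (h3.good p).lead_tail hp) (e.step t a ha)
        rw [h1] at hst hobj
        obtain ⟨rank', b', hinv, hpot⟩ := h3.step hsd hst
        refine ⟨(rank', b', S'), ⟨hobj, ⟨hinv.disjointed hd hobj, hd⟩, hinv⟩,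
          fun h => (by cases h), ?_⟩
        rintro _ ⟨⟩
        refine hpot.imp_left ?_
        rintro ⟨p, q, g1, g2, g3, g4, g5, g6, g7⟩
        exact ⟨⟨p, q, g1, g2, g3, g4, g5, g6⟩, g7⟩)
  refine ⟨fun t => (f t).1, fun t => (f t).2.1, fun t => (f t).2.2,
    ⟨fun t => (hP t).1, fun t => (hP t).2.1, fun t => (hP t).2.2, fun t => (hR t).1,
      fun t => (hR t).2⟩, ?_⟩
  simp only [hf0]
  exact potential_initial _ _ _

namespace Trace

variable {e : Execution (coating pick) n} {C : Set Node} {sd : Node → Dir} {pos : Node → ℤ}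
  {rank : ℕ → Node → ℕ} {b : ℕ → Fin n → ℤ} {S : ℕ → Fin n → Agent}

theorem work_le (h : Trace e C sd pos rank b S) (hsd : SurfaceCoordinates C sd pos) {K : ℕ}
    (hK : potential C pos (rank 0) (b 0) (S 0) ≤ K) : e.work ≤ K := by
  refine iSup_le fun T => ?_
  have key : ((∑ t ∈ Finset.range T, (e.act t).elim 0 Action.movements : ℕ) : ℤ) +
      potential C pos (rank T) (b T) (S T) ≤ K := by
    induction T with
    | zero => simpa using hK
    | succ T ih =>
      rw [Finset.sum_range_succ]
      rcases ha : e.act T with _ | a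
      · rw [(h.halt T ha).2]
        simpa using ih
      · rw [Option.elim_some]
        rcases h.step T a ha with ⟨⟨p, q, rfl, -⟩, h2⟩ | ⟨-, h2⟩
        · rw [h2]; simpa [Action.movements] using ih
        · push_cast at ih ⊢
          linarith
  have := (h.invariant T).potential_nonneg hsd
  exact_mod_cast (le_add_of_nonneg_right this).trans key

theorem isConnected (h : Trace e C sd pos rank b S) (hsd : SurfaceCoordinates C sd pos)
    (hC : ConnectedSet C) (t : ℕ) : (e.conf t).IsConnected := by
  rw [Config.IsConnected, (h.represents t).occupied_eq, h.obj t]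
  exact (h.invariant t).connectedSet hsd hC

end Trace

/-! ### Enabled actions -/

namespace Represents

variable {pick : Finset (Fin 10) → Fin 10} {n : ℕ} {S : Fin n → Agent}
  {c : Config (coating pick) n} {p q : Fin n}

theorem exists_step_inactive (h : Represents S c) (hp : (S p).phase = Phase.inactive)
    (he : (S p).ext = none) (hs : (S p).tail ∈ surface c.obj ∨
      ∃ q, (S q).phase ≠ Phase.inactive ∧ ∃ k, (S p).tail + dir k ∈ (S q).nodes) :
    ∃ c', Step c (Action.idle p) c' := by
  classical
  obtain ⟨t, ht, hm⟩ : ∃ t, inactiveTurn pick (stateOf c p) (reading c p) = some t ∧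
      t.move = Move.idle := by
    rw [inactiveTurn]
    split_ifs with h1 h2
    · exact ⟨_, rfl, rfl⟩
    · exact ⟨_, rfl, rfl⟩
    · exfalso
      rcases hs with hs | ⟨q, hq, k, hk⟩
      · exact h1 ((h.sees_object he).mpr hs)
      · obtain ⟨i, f, -, hr, hf⟩ := h.read_intro (p := p) (q := q)
          (by rintro rfl; exact hq hp) (S p).tail_mem_nodes hk
        exact h2 ⟨i, trivial, f, hr, hf.active.mpr hq⟩
  exact ⟨_, Step.idle p t (mem_turns.mpr ((turn_inactive _ ((h.phase_eq p).trans hp)).trans ht)) hm⟩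

theorem exists_step_follow (h : Represents S c) (hp : (S p).phase = Phase.follow)
    (he : (S p).ext = none) (hs : (S p).tail ∈ surface c.obj) :
    ∃ c', Step c (Action.idle p) c' := by
  classical
  obtain ⟨t, ht, hm⟩ : ∃ t, followTurn (stateOf c p) (reading c p) = some t ∧
      t.move = Move.idle := by
    rw [followTurn, if_pos ((h.sees_object he).mpr hs)]
    exact ⟨_, rfl, rfl⟩
  exact ⟨_, Step.idle p t (mem_turns.mpr ((turn_follow _ ((h.phase_eq p).trans hp)
    (by rw [h.shape_eq, he]; rfl)).trans ht)) hm⟩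

theorem contractsTo (h : Represents S c) {a : Dir} (he : (S p).ext = some a) :
    (c.part p).ContractsTo (headContractLabel (a - (c.part p).orient)) (S p).head (S p).tail := by
  rw [contractsTo_iff ((h.describes p).ext.trans he)]
  exact ⟨(h.describes p).head.symm, (h.describes p).tail.symm⟩

theorem exists_step_handover (h : Represents S c) {a : Dir} (hp : (S p).phase ≠ Phase.inactive)
    (he : (S p).ext = some a) (hpq : p ≠ q) (hq : (S q).Follows (S p).tail)
    (hqe : (S q).ext = none) (hqs : (S q).tail ∉ surface c.obj) :
    ∃ c', Step c (Action.handover p q) c' := by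
  classical
  have hd : (S q).tail + dir (S q).d = (S p).tail := by
    rw [← Agent.head_of_contracted hqe]; exact hq.2
  obtain ⟨i, f, hi, hr, hf⟩ := h.read_intro hpq (S q).tail_mem_nodes (k := (S q).d)
    (by rw [hd]; exact (S p).tail_mem_nodes)
  rw [h.edge_contracted hqe, ← h.d_eq] at hi
  rw [hi.2] at hr
  obtain ⟨t, ht, hm⟩ : ∃ t, followTurn (stateOf c q) (reading c q) = some t ∧
      t.move = Move.expand (dirLabel ((S q).d - (c.part q).orient)) := by
    rw [followTurn, if_neg (by rw [h.sees_object hqe]; exact hqs), hr, Option.bind_some,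
      hf.contractionDir (c.part q).orient _ (by rw [h.d_eq, sub_add_cancel]), he,
      ← h.d_eq]
    exact ⟨_, rfl, rfl⟩
  refine ⟨_, Step.handover p q hpq _ t (headContractLabel (a - (c.part p).orient)) _ (S p).head
    (S q).d ((h.turns_expanded hp he).mpr (Or.inl ⟨⟨q, hpq.symm, hq, hqe⟩, rfl⟩))
    (mem_turns.mpr ((turn_follow _ ((h.phase_eq q).trans hq.1)
      (by rw [h.shape_eq, hqe]; rfl)).trans ht)) (Or.inr rfl) hm ?_ ?_⟩
  · rw [expandsAlong_iff ((h.describes q).ext.trans hqe)]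
  · rw [(h.describes q).tail, hd]
    exact h.contractsTo he

theorem exists_step_contract (h : Represents S c) {a : Dir} (hp : (S p).phase ≠ Phase.inactive)
    (he : (S p).ext = some a) (hf : ∀ q, q ≠ p → ¬ (S q).Follows (S p).tail)
    (hi : ∀ q, (S q).phase ≠ Phase.inactive) : ∃ c', Step c (Action.single p) c' :=
  ⟨_, Step.contract p _ _ _ _
    ((h.turns_expanded hp he).mpr (Or.inr ⟨hf, fun q _ hq => absurd hq (hi q), rfl⟩)) rfl
    (h.contractsTo he)⟩

theorem exists_step_lead (h : Represents S c) {sd : Node → Dir} {pos : Node → ℤ}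
    (hsd : SurfaceCoordinates c.obj sd pos)
    (hpick : ∀ S : Finset (Fin 10), S.Nonempty → pick S ∈ S)
    (hp : (S p).phase = Phase.lead) (hs : (S p).tail ∈ surface c.obj) (hst : Stimulated S p)
    (he : ∀ q, (S q).ext = none) : ∃ a c', Step c a c' ∧ p ∈ a.affects := by
  by_cases hfree : ∃ q, (S p).tail + dir (sd (S p).tail) ∈ (S q).nodes
  · obtain ⟨q, hq⟩ := hfree
    have hqp : q ≠ p := by
      rintro rfl
      rw [Agent.nodes_of_contracted (he q), Set.mem_singleton_iff, add_eq_left] at hq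
      exact dir_ne_zero _ hq
    exact ⟨_, _, Step.idle p _ ((h.turns_lead hsd hpick hp (he p) hs).mpr
      ⟨hst, Or.inr ⟨⟨q, hqp, hq, fun h' => h'.1 (he q)⟩, rfl⟩⟩) rfl, rfl⟩
  · refine ⟨_, _, Step.expand p _ _ (sd (S p).tail) ((h.turns_lead hsd hpick hp (he p) hs).mpr
      ⟨hst, Or.inl ⟨fun q _ hq => absurd ⟨q, hq⟩ hfree, rfl⟩⟩) rfl ?_ ?_, rfl⟩
    · rw [expandsAlong_iff ((h.describes p).ext.trans (he p))]
    · rw [(h.describes p).tail, h.mem_occupied]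
      rintro (h' | h')
      · exact hsd.notMem _ hs h'
      · exact hfree h'

end Represents

/-! ### Quiet configurations -/

/-- The agent `p` is affected by an enabled action that is not one of a contracted leader. -/
def Urgent (C : Set Node) {n : ℕ} (S : Fin n → Agent) (p : Fin n) : Prop :=
  ((S p).phase = Phase.inactive ∧ ((S p).tail ∈ surface C ∨
      ∃ q, (S q).phase ≠ Phase.inactive ∧ ∃ k, (S p).tail + dir k ∈ (S q).nodes)) ∨
    ((S p).phase = Phase.follow ∧ (S p).ext = none ∧ (S p).tail ∈ surface C) ∨
    ((S p).ext ≠ none ∧ ∃ q, p ≠ q ∧ (S q).Follows (S p).tail ∧ (S q).ext = none ∧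
      (S q).tail ∉ surface C) ∨
    ((S p).ext ≠ none ∧ (∀ q, q ≠ p → ¬ (S q).Follows (S p).tail) ∧
      ∀ q, (S q).phase ≠ Phase.inactive)

section

variable {C : Set Node} {sd : Node → Dir} {pos : Node → ℤ} {n : ℕ} {rank : Node → ℕ}
  {b : Fin n → ℤ} {S : Fin n → Agent}

theorem Urgent.not_lead {p : Fin n} (h : Urgent C S p) (hp : (S p).phase = Phase.lead) :
    (S p).ext ≠ none := by
  rcases h with h | h | h | h
  · rw [hp] at h; cases h.1
  · rw [hp] at h; cases h.1
  · exact h.1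
  · exact h.1

theorem Urgent.exists_step {pick : Finset (Fin 10) → Fin 10} {c : Config (coating pick) n}
    {p : Fin n} (h : Urgent C S p) (hc : Represents S c) (hC : c.obj = C)
    (hS : Invariant C sd pos rank b S) : ∃ a c', Step c a c' ∧ p ∈ a.affects := by
  subst hC
  rcases h with ⟨h1, h2⟩ | ⟨h1, h2, h3⟩ | ⟨h1, q, h2, h3, h4, h5⟩ | ⟨h1, h2, h3⟩
  · obtain ⟨c', hc'⟩ := hc.exists_step_inactive h1 ((hS.good p).inactive h1) h2
    exact ⟨_, c', hc', rfl⟩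
  · obtain ⟨c', hc'⟩ := hc.exists_step_follow h1 h2 h3
    exact ⟨_, c', hc', rfl⟩
  · obtain ⟨a, ha⟩ := Option.ne_none_iff_exists'.mp h1
    obtain ⟨c', hc'⟩ := hc.exists_step_handover ((hS.good p).not_inactive ha) ha h2 h3 h4 h5
    exact ⟨_, c', hc', Or.inl rfl⟩
  · obtain ⟨a, ha⟩ := Option.ne_none_iff_exists'.mp h1
    obtain ⟨c', hc'⟩ := hc.exists_step_contract (h3 p) ha h2 h3
    exact ⟨_, c', hc', rfl⟩

namespace Invariant

theorem active_of_not_urgent (h : Invariant C sd pos rank b S) (hu : ∀ p, ¬ Urgent C S p)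
    (p : Fin n) : (S p).phase ≠ Phase.inactive := by
  intro hp
  obtain ⟨p, hp, hp'⟩ := h.cut {p | (S p).phase = Phase.inactive} ⟨p, hp⟩ fun _ hp => hp
  exact hu p (Or.inl ⟨hp, hp'⟩)

/-- An expanded agent with a tail of maximal rank can act. -/
theorem contracted_of_not_urgent (h : Invariant C sd pos rank b S)
    (hsd : SurfaceCoordinates C sd pos) (hu : ∀ p, ¬ Urgent C S p) (p : Fin n) :
    (S p).ext = none := by
  classical
  by_contra hp
  obtain ⟨p, hp, hmax⟩ := Finset.exists_max_image
    (Finset.univ.filter fun p => (S p).ext ≠ none) (fun p => rank (S p).tail) ⟨p, by simpa using hp⟩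
  simp only [Finset.mem_filter, Finset.mem_univ, true_and] at hp hmax
  obtain ⟨q, hqp, hq⟩ : ∃ q, q ≠ p ∧ (S q).Follows (S p).tail := by
    by_contra! hcon
    exact hu p (Or.inr (Or.inr (Or.inr ⟨hp, hcon, h.active_of_not_urgent hu⟩)))
  rcases he : (S q).ext with _ | a
  · by_cases hs : (S q).tail ∈ surface C
    · exact hu q (Or.inr (Or.inl ⟨hq.1, he, hs⟩))
    · exact hu p (Or.inr (Or.inr (Or.inl ⟨hp, q, hqp.symm, hq, he, hs⟩)))
  · have h1 := ((h.good q).follow_ext a hq.1 he).2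
    have h2 := hmax q (by rw [he]; exact Option.some_ne_none a)
    rw [← hq.2] at h2
    by_cases hs : (S q).head ∈ surface C
    · rw [(h.good q).follow_surface hq.1 hs, h.rank_surface _ (hsd.next_mem hs)] at h2
      omega
    · have h3 := (h.good q).follow_rank hq.1 hs
      omega

/-- The target of a follower of minimal rank is a leader. -/
theorem exists_stimulated_lead (h : Invariant C sd pos rank b S)
    (hsd : SurfaceCoordinates C sd pos) (hu : ∀ p, ¬ Urgent C S p) {p : Fin n}
    (hp : (S p).phase ≠ Phase.lead) : ∃ q, (S q).phase = Phase.lead ∧ Stimulated S q := by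
  classical
  have hact := h.active_of_not_urgent hu
  have hext := h.contracted_of_not_urgent hsd hu
  have hfollow : ∀ q, (S q).phase ≠ Phase.lead → (S q).phase = Phase.follow := by
    intro q hq
    rcases hq' : (S q).phase with _ | _ | _
    · exact absurd hq' (hact q)
    · rfl
    · exact absurd hq' hq
  obtain ⟨p, hp, hmin⟩ := Finset.exists_min_image
    (Finset.univ.filter fun p => (S p).phase ≠ Phase.lead) (fun p => rank (S p).head)
    ⟨p, by simpa using hp⟩
  simp only [Finset.mem_filter, Finset.mem_univ, true_and] at hp hmin
  have hpf := hfollow p hp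
  obtain ⟨q, -, hw⟩ := h.target p hpf
  have hs : (S p).head ∉ surface C := by
    rw [Agent.head_of_contracted (hext p)]
    exact fun hs => hu p (Or.inr (Or.inl ⟨hpf, hext p, hs⟩))
  rw [Agent.nodes_of_contracted (hext q), Set.mem_singleton_iff] at hw
  have hq : (S q).phase = Phase.lead := by
    by_contra hq
    have h1 := (h.good p).follow_rank hpf hs
    have h2 := hmin q hq
    rw [Agent.head_of_contracted (hext q), ← hw] at h2
    omega
  exact ⟨q, hq, p, by rintro rfl; exact hp hq, Or.inl ⟨hpf, hw⟩⟩

end Invariant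

end

variable {pick : Finset (Fin 10) → Fin 10} {n : ℕ}

theorem not_step_of_terminated {A : Algorithm} {c c' : Config A n} {a : Action n}
    (hc : c.Terminated) : ¬ Step c a c' := by
  rintro (⟨p, t, ht⟩ | ⟨p, t, i, k, ht⟩ | ⟨p, t, i, u, v, ht⟩ | ⟨p, q, -, t, s, i, j, u, k, ht⟩) <;>
  · rw [hc p] at ht; cases ht

/-- In a terminated configuration all particles are contracted leaders. -/
theorem goal_of_terminated {c c₀ : Config (coating pick) n} {sd : Node → Dir} {pos : Node → ℤ}
    {rank : Node → ℕ} {b : Fin n → ℤ} {S : Fin n → Agent}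
    (hpick : ∀ S : Finset (Fin 10), S.Nonempty → pick S ∈ S)
    (h₀ : c₀.Initial) (hc : Represents S c) (hC : c.obj = c₀.obj)
    (hS : Invariant c₀.obj sd pos rank b S) (hsd : SurfaceCoordinates c₀.obj sd pos)
    (hterm : c.Terminated) : c.Goal := by
  have hu : ∀ p, ¬ Urgent c₀.obj S p := fun p hp => by
    obtain ⟨a, c', hst, -⟩ := hp.exists_step hc hC hS
    exact not_step_of_terminated hterm hst
  have hext := hS.contracted_of_not_urgent hsd hu
  have hlead : ∀ p, (S p).phase = Phase.lead := by
    intro p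
    by_contra hp
    obtain ⟨q, hq, hst⟩ := hS.exists_stimulated_lead hsd hu hp
    obtain ⟨a, c', hst', -⟩ := hc.exists_step_lead (by rw [hC]; exact hsd) hpick hq
      (by rw [hC]; exact (hS.good q).lead_tail hq) hst hext
    exact not_step_of_terminated hterm hst'
  refine ⟨⟨by rw [hC]; exact h₀.valid, by rw [hC]; exact h₀.infinite, hc.disjointed, ?_,
    fun p => (hc.describes p).ext.trans (hext p)⟩, fun p => ⟨(S p).tail, ?_, ?_⟩⟩
  · rw [Config.IsConnected, hc.occupied_eq, hC]
    exact hS.connectedSet hsd h₀.valid.1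
  · rw [(hc.describes p).nodes]
    exact (S p).tail_mem_nodes
  · rw [hC]
    exact ((hS.good p).lead_tail (hlead p)).2

/-! ### Termination -/

/-- Forget the complaint indicators. -/
def forgetComplaints (S : Fin n → Agent) (p : Fin n) : Agent := { S p with comp := none }

/-- From time `T` on, there are only complaints. -/
def OnlyComplaints (e : Execution (coating pick) n) (sd : Node → Dir) (S : ℕ → Fin n → Agent)
    (T : ℕ) : Prop :=
  ∀ t ≥ T, (e.act t = none ∧ S (t + 1) = S t) ∨
    ∃ a, e.act t = some a ∧ Complaint sd (S t) a (S (t + 1))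

namespace Trace

variable {e : Execution (coating pick) n} {C : Set Node} {sd : Node → Dir} {pos : Node → ℤ}
  {rank : ℕ → Node → ℕ} {b : ℕ → Fin n → ℤ} {S : ℕ → Fin n → Agent} {T : ℕ}

/-- The potential decreases only finitely often, so that finally there are only complaints. -/
theorem eventually_complaint (h : Trace e C sd pos rank b S) (hsd : SurfaceCoordinates C sd pos) :
    ∃ T, OnlyComplaints e sd S T := by
  set f : ℕ → ℤ := fun t => potential C pos (rank t) (b t) (S t) with hf
  have hnn : ∀ t, 0 ≤ f t := fun t => (h.invariant t).potential_nonneg hsd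
  have hstep : ∀ t, f (t + 1) ≤ f t := by
    intro t
    rcases ha : e.act t with _ | a
    · exact (h.halt t ha).2.le
    · rcases h.step t a ha with h1 | h1
      · exact h1.2.le
      · have := h1.1
        simp only [hf]
        omega
  have hanti : Antitone f := antitone_nat_of_succ_le hstep
  obtain ⟨T, hT⟩ := WellFounded.has_min (measure fun t => (f t).toNat).wf Set.univ ⟨0, trivial⟩
  refine ⟨T, fun t ht => ?_⟩
  have hconst : ¬ f (t + 1) + 1 ≤ f t := by
    intro hlt
    have h1 := hanti ht
    refine hT.2 (t + 1) trivial ?_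
    show (f (t + 1)).toNat < (f T).toNat
    have := hnn (t + 1)
    omega
  rcases ha : e.act t with _ | a
  · exact Or.inl ⟨rfl, (h.halt t ha).1⟩
  · rcases h.step t a ha with h1 | h1
    · exact Or.inr ⟨a, rfl, h1.1⟩
    · exact absurd h1.1 hconst

theorem forgetComplaints_eq (hT : OnlyComplaints e sd S T) {t : ℕ} (ht : T ≤ t) :
    forgetComplaints (S t) = forgetComplaints (S T) := by
  induction t, ht using Nat.le_induction with
  | base => rfl
  | succ t ht ih =>
    rw [← ih]
    rcases hT t ht with ⟨-, h1⟩ | ⟨a, -, p, q, -, -, -, -, -, h1⟩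
    · rw [h1]
    · rw [h1]
      funext r
      by_cases hr : r = p
      · subst hr
        simp only [forgetComplaints, Function.update_self]
      · simp only [forgetComplaints, Function.update_of_ne hr]

theorem comp_eq (h : Trace e C sd pos rank b S)
    (hT : OnlyComplaints e sd S T) {t t' : ℕ} (ht : T ≤ t) (htt : t ≤ t') {p : Fin n}
    {k : Dir} (hp : (S t p).comp = some k) : (S t' p).comp = some k := by
  induction t', htt using Nat.le_induction with
  | base => exact hp
  | succ t' htt ih =>
    rcases hT t' (ht.trans htt) with ⟨-, h1⟩ | ⟨a, -, r, q, -, -, -, -, -, h1⟩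
    · rw [h1, ih]
    · rw [h1]
      by_cases hr : p = r
      · subst hr
        rw [Function.update_self]
        exact congrArg some (((h.invariant t').good p).comp k ih).2.2.symm
      · rw [Function.update_of_ne hr, ih]

theorem stimulated (h : Trace e C sd pos rank b S)
    (hT : OnlyComplaints e sd S T) {t t' : ℕ} (ht : T ≤ t) (htt : t ≤ t')
    {p : Fin n} (hp : Stimulated (S t) p) : Stimulated (S t') p := by
  have hS : forgetComplaints (S t') = forgetComplaints (S t) :=
    (forgetComplaints_eq hT (ht.trans htt)).trans (forgetComplaints_eq hT ht).symm
  have htail : (S t' p).tail = (S t p).tail := by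
    show (forgetComplaints (S t') p).tail = (forgetComplaints (S t) p).tail
    rw [hS]
  obtain ⟨q, hqp, hq | ⟨k, hk, hq⟩⟩ := hp
  · refine ⟨q, hqp, Or.inl ?_⟩
    have : (forgetComplaints (S t) q).Follows (S t p).tail := hq
    rw [← hS, ← htail] at this
    exact this
  · refine ⟨q, hqp, Or.inr ⟨k, h.comp_eq hT ht htt hk, ?_⟩⟩
    have : (forgetComplaints (S t) q).head + dir k = (S t p).tail := hq
    rw [← hS, ← htail] at this
    exact this

theorem exists_complaint (hT : OnlyComplaints e sd S T) (hfair : e.Fair) {p : Fin n} {t : ℕ} (ht : T ≤ t)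
    (hp : ∀ t' ≥ t, ∃ a c', Step (e.conf t') a c' ∧ p ∈ a.affects) :
    ∃ t' ≥ t, Complaint sd (S t') (Action.idle p) (S (t' + 1)) := by
  obtain ⟨t', ht', ⟨a, ha, hpa⟩ | hn⟩ := hfair p t
  · refine ⟨t', ht', ?_⟩
    rcases hT t' (ht.trans ht') with ⟨h1, -⟩ | ⟨a', h1, h2⟩
    · rw [ha] at h1; cases h1
    · rw [ha] at h1
      cases h1
      have h3 := h2
      obtain ⟨r, q, rfl, -⟩ := h3
      obtain rfl : p = r := hpa
      exact h2
  · exact absurd (hp t' ht') hn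

theorem not_urgent (h : Trace e C sd pos rank b S)
    (hT : OnlyComplaints e sd S T) (hfair : e.Fair) {t : ℕ} (ht : T ≤ t)
    (p : Fin n) : ¬ Urgent C (S t) p := by
  intro hp
  have hS : ∀ t' ≥ t, Urgent C (S t') p := by
    intro t' ht'
    have : Urgent C (forgetComplaints (S t)) p := hp
    rw [forgetComplaints_eq hT ht, ← forgetComplaints_eq hT (ht.trans ht')] at this
    exact this
  obtain ⟨t', ht', r, q, hr, h1, h2, -⟩ := exists_complaint hT hfair ht fun t' ht' =>
    (hS t' ht').exists_step (h.represents t') (h.obj t') (h.invariant t')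
  cases hr
  exact (hS t' ht').not_lead h1 h2

/-- Among the leaders that are stimulated at some time, the foremost would complain to a leader
further ahead. -/
theorem not_stimulated (h : Trace e C sd pos rank b S)
    (hT : OnlyComplaints e sd S T) (hfair : e.Fair)
    (hpick : ∀ S : Finset (Fin 10), S.Nonempty → pick S ∈ S) (hsd : SurfaceCoordinates C sd pos)
    {p : Fin n} (hp : (S T p).phase = Phase.lead) : ¬ Stimulated (S T) p := by
  classical
  intro hst
  have hu := fun {t} (ht : T ≤ t) => h.not_urgent hT hfair ht
  have hS := fun {t} (ht : T ≤ t) (r : Fin n) => congrFun (forgetComplaints_eq hT ht) r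
  have hphase : ∀ {t}, T ≤ t → ∀ r, (S t r).phase = (S T r).phase := fun ht r =>
    show (forgetComplaints _ r).phase = (forgetComplaints _ r).phase by rw [hS ht r]
  have htail : ∀ {t}, T ≤ t → ∀ r, (S t r).tail = (S T r).tail := fun ht r =>
    show (forgetComplaints _ r).tail = (forgetComplaints _ r).tail by rw [hS ht r]
  obtain ⟨p, hp, hmax⟩ := Finset.exists_max_image
    (Finset.univ.filter fun p => (S T p).phase = Phase.lead ∧ ∃ t ≥ T, Stimulated (S t) p)
    (fun p => pos (S T p).tail) ⟨p, by simpa using ⟨hp, T, le_rfl, hst⟩⟩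
  simp only [Finset.mem_filter, Finset.mem_univ, true_and] at hp hmax
  obtain ⟨hp, t, ht, hst⟩ := hp
  obtain ⟨t', ht', r, q, hr, -, -, hqp, hq, hnext⟩ := exists_complaint hT hfair ht fun t' ht' =>
    (h.represents t').exists_step_lead (by rw [h.obj]; exact hsd) hpick
      (by rw [hphase (ht.trans ht'), hp])
      (by rw [h.obj]; exact ((h.invariant t').good p).lead_tail
            (by rw [hphase (ht.trans ht'), hp]))
      (h.stimulated hT ht ht' hst)
      ((h.invariant t').contracted_of_not_urgent hsd (hu (ht.trans ht')))
  cases hr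
  have hTt : T ≤ t' := ht.trans ht'
  have hext := (h.invariant t').contracted_of_not_urgent hsd (hu hTt)
  rw [Agent.nodes_of_contracted (hext q), Set.mem_singleton_iff] at hq
  have hps := ((h.invariant t').good p).lead_tail (by rw [hphase hTt, hp])
  have hqs := hsd.next_mem hps
  have hqlead : (S t' q).phase = Phase.lead := by
    rcases hq' : (S t' q).phase with _ | _ | _
    · exact absurd hq' ((h.invariant t').active_of_not_urgent (hu hTt) q)
    · exact absurd (Or.inr (Or.inl ⟨hq', hext q, hq ▸ hqs⟩)) (hu hTt q)
    · rfl
  have hle := hmax q ⟨by rw [← hphase hTt, hqlead], t' + 1, by omega, p, hqp.symm, Or.inr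
    ⟨sd (S t' p).tail, by rw [hnext, Function.update_self], ?_⟩⟩
  · rw [← htail hTt q, ← htail hTt p, ← hq, hsd.pos_next _ hps] at hle
    omega
  · rw [hnext, Function.update_self, Function.update_of_ne hqp, ← hq]
    exact congrArg (· + _) (Agent.head_of_contracted (hext p))

theorem exists_terminated (h : Trace e C sd pos rank b S) (hfair : e.Fair)
    (hpick : ∀ S : Finset (Fin 10), S.Nonempty → pick S ∈ S)
    (hsd : SurfaceCoordinates C sd pos) : ∃ t, (e.conf t).Terminated := by
  obtain ⟨T, hT⟩ := h.eventually_complaint hsd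
  refine ⟨T, fun p => Set.eq_empty_iff_forall_notMem.mpr fun t ht => ?_⟩
  have hu := h.not_urgent hT hfair le_rfl
  have hst := fun {p} => h.not_stimulated hT hfair hpick hsd (p := p)
  have hp : (S T p).phase = Phase.lead := by
    by_contra hp
    obtain ⟨q, hq, hq'⟩ := (h.invariant T).exists_stimulated_lead hsd hu hp
    exact hst hq hq'
  exact hst hp (((h.represents T).turns_lead (by rw [h.obj]; exact hsd) hpick hp
    ((h.invariant T).contracted_of_not_urgent hsd hu p)
    (by rw [h.obj]; exact ((h.invariant T).good p).lead_tail hp)).mp ht).1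

end Trace

/-- The coating algorithm solves the problem. -/
theorem solves (hpick : ∀ S : Finset (Fin 10), S.Nonempty → pick S ∈ S) :
    Solves (coating pick) := by
  rintro n e ⟨hfair, he⟩
  obtain ⟨sd, pos, hsd⟩ := exists_surfaceCoordinates he.valid he.infinite
  obtain ⟨rank, b, S, h, -⟩ := exists_trace he hpick hsd
  exact ⟨h.isConnected hsd he.valid.1, h.exists_terminated hfair hpick hsd,
    fun t ht => goal_of_terminated hpick he (h.represents t) (h.obj t) (h.invariant t) hsd ht⟩

theorem worstCaseWork_le (hpick : ∀ S : Finset (Fin 10), S.Nonempty → pick S ∈ S) (n : ℕ) :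
    worstCaseWork (coating pick) n ≤ ((12 : ℕ) : ℕ∞) * (n : ℕ∞) ^ 2 := by
  refine iSup₂_le fun e he => ?_
  obtain ⟨sd, pos, hsd⟩ := exists_surfaceCoordinates he.2.valid he.2.infinite
  obtain ⟨rank, b, S, h, hpot⟩ := exists_trace he.2 hpick hsd
  have := h.work_le hsd (K := 12 * n ^ 2) (by push_cast; exact hpot)
  simpa using this

end Coating

/-! ### The lower bound -/

/-- The lower half-plane. -/
def halfPlane : Set Node := {v | v.2 < 0}

theorem constant_on_row {S : Set Node} {g : Node → Prop}
    (hg : ∀ u ∈ S, ∀ k, u + dir k ∈ S → (g (u + dir k) ↔ g u)) {y : ℤ}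
    (hS : ∀ x, (x, y) ∈ S) (x : ℤ) : g (x, y) ↔ g (0, y) := by
  have h1 : ∀ x : ℤ, g (x + 1, y) ↔ g (x, y) := fun x => by
    have e : ((x, y) : Node) + dir 0 = (x + 1, y) := by simp [dir]
    have := hg (x, y) (hS x) 0 (by rw [e]; exact hS _)
    rwa [e] at this
  induction x using Int.induction_on with
  | zero => rfl
  | succ i ih => exact (h1 _).trans ih
  | pred i ih =>
    have := h1 (-(i : ℤ) - 1)
    rw [sub_add_cancel] at this
    exact this.symm.trans ih

theorem constant_on_column {S : Set Node} {g : Node → Prop}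
    (hg : ∀ u ∈ S, ∀ k, u + dir k ∈ S → (g (u + dir k) ↔ g u)) {x y z : ℤ} (hyz : y ≤ z)
    (hS : ∀ w, y ≤ w → w ≤ z → (x, w) ∈ S) : g (x, z) ↔ g (x, y) := by
  induction z, hyz using Int.leInduction with
  | base => rfl
  | succ z hyz ih =>
    rw [← ih fun w h1 h2 => hS w h1 (by omega)]
    have e : ((x, z) : Node) + dir 1 = (x, z + 1) := by simp [dir]
    have := hg (x, z) (hS z hyz (by omega)) 1 (by rw [e]; exact hS _ (by omega) le_rfl)
    rwa [e] at this

theorem connectedSet_of_row {S : Set Node} {y : ℤ} (hS : ∀ x, (x, y) ∈ S)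
    (h : ∀ g : Node → Prop, (∀ u ∈ S, ∀ k, u + dir k ∈ S → (g (u + dir k) ↔ g u)) →
      ∀ u ∈ S, ∃ x, (g u ↔ g (x, y))) : ConnectedSet S := by
  refine ConnectedSet.of_constant ⟨_, hS 0⟩ fun g hg => ?_
  have : ∀ u ∈ S, (g u ↔ g (0, y)) := fun u hu => by
    obtain ⟨x, hx⟩ := h g hg u hu
    exact hx.trans (constant_on_row hg hS x)
  exact fun u hu v hv => (this u hu).trans (this v hv).symm

/-- The upper half-plane without a node `v` is connected: a node below `v` is connected to the row
above `v` via the next column. -/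
theorem connectedSet_upperHalfPlane_diff {v : Node} (hv : -1 ≤ v.2) :
    ConnectedSet {u | 0 ≤ u.2 ∧ u ≠ v} := by
  obtain ⟨a, c⟩ := v
  change -1 ≤ c at hv
  refine connectedSet_of_row (y := c + 1) (fun x => ⟨by show 0 ≤ c + 1; omega, by simp⟩) ?_
  rintro g hg ⟨x, y⟩ ⟨hy, hne⟩
  change 0 ≤ y at hy
  rw [ne_eq, Prod.mk.injEq] at hne
  have hcol : ∀ x y : ℤ, 0 ≤ y → y ≤ c → x ≠ a → (g (x, y) ↔ g (x, c + 1)) :=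
    fun x y h0 hyc hx => (constant_on_column hg (by omega) fun w h1 _ =>
      ⟨h0.trans h1, by simp [hx]⟩).symm
  rcases lt_or_ge c y with hcy | hyc
  · exact ⟨x, constant_on_column hg (by omega) fun w h1 _ =>
      ⟨by show 0 ≤ w; omega, by rw [ne_eq, Prod.mk.injEq]; omega⟩⟩
  · by_cases hx : x = a
    · refine ⟨x + 1, ?_⟩
      rw [← hcol (x + 1) y hy hyc (by omega)]
      have e : ((x, y) : Node) + dir 0 = (x + 1, y) := by simp [dir]
      have := hg (x, y) ⟨hy, by rw [ne_eq, Prod.mk.injEq]; exact hne⟩ 0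
        (by rw [e]; exact ⟨hy, by rw [ne_eq, Prod.mk.injEq]; omega⟩)
      rw [e] at this
      exact this.symm
    · exact ⟨x, hcol x y hy hyc hx⟩

theorem validObject_halfPlane : ValidObject halfPlane := by
  have hcompl : halfPlaneᶜ = {u : Node | 0 ≤ u.2 ∧ u ≠ (0, -1)} := by
    ext ⟨x, y⟩
    simp only [halfPlane, Set.mem_compl_iff, Set.mem_ofPred_eq, ne_eq, Prod.mk.injEq]
    omega
  refine ⟨connectedSet_of_row (y := -1) (fun x => by show (-1 : ℤ) < 0; norm_num) ?_, ?_, ?_, ?_⟩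
  · rintro g hg ⟨x, y⟩ hy
    change y < 0 at hy
    exact ⟨x, (constant_on_column hg (by omega) fun w _ h2 => by show w < 0; omega).symm⟩
  · have hinf : (halfPlaneᶜ).Infinite :=
      Set.infinite_of_injective_forall_mem (f := fun x : ℤ => ((x, 0) : Node))
        (fun x y h => congrArg Prod.fst h) fun x => by simp [halfPlane]
    rw [hinf.encard_eq]
    exact WithTop.coe_lt_top 2
  · rw [hcompl]
    exact connectedSet_upperHalfPlane_diff le_rfl
  · rintro v hv
    have : halfPlaneᶜ \ {v} = {u : Node | 0 ≤ u.2 ∧ u ≠ v} := by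
      ext u
      simp [halfPlane]
    rw [this]
    have hv' : ¬ v.2 < 0 := hv
    exact connectedSet_upperHalfPlane_diff (by omega)

theorem surface_halfPlane_infinite : (surface halfPlane).Infinite :=
  Set.infinite_of_injective_forall_mem (f := fun x : ℤ => ((x, 0) : Node))
    (fun x y h => congrArg Prod.fst h)
    fun x => mem_surface_iff.mpr ⟨by simp [halfPlane], 4, by simp [halfPlane, dir]⟩

section

variable (A : Algorithm) (n : ℕ)

/-- The initial configuration of a line of particles that leads away from the half-plane. -/
def lineConfig : Config A n where
  obj := halfPlane
  objOrient _ := 0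
  part i := ⟨A.initState, A.initFlags, (0, i), none, 0⟩

theorem lineConfig_nodes (i : Fin n) : ((lineConfig A n).part i).nodes = {((0, i) : Node)} :=
  Particle.nodes_of_contracted _ rfl

theorem lineConfig_initial : (lineConfig A n).Initial where
  valid := validObject_halfPlane
  infinite := surface_halfPlane_infinite
  disjointed := by
    refine ⟨fun i => ?_, fun i j hij => ?_⟩
    · rw [lineConfig_nodes, Set.disjoint_singleton_left]
      simp [lineConfig, halfPlane]
    · rw [lineConfig_nodes, lineConfig_nodes, Set.disjoint_singleton]
      simpa [Fin.ext_iff] using hij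
  connected := by
    have hocc : ∀ u : Node, u ∈ (lineConfig A n).occupied ↔ u.2 < 0 ∨ ∃ i : Fin n, u = (0, ↑↑i) := by
      intro u
      simp only [Config.occupied, Set.mem_union, Set.mem_iUnion, lineConfig_nodes,
        Set.mem_singleton_iff]
      rfl
    refine connectedSet_of_row (y := -1) (fun x => by rw [hocc]; left; norm_num) ?_
    rintro g hg ⟨x, y⟩ hu
    refine ⟨x, ?_⟩
    rcases lt_or_ge y 0 with hy | hy
    · exact (constant_on_column hg (by omega) fun w _ h2 => by
        rw [hocc]; left; show w < 0; omega).symm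
    · rw [hocc] at hu
      obtain ⟨i, hi⟩ := hu.resolve_left (by show ¬ y < 0; omega)
      rw [Prod.mk.injEq] at hi
      obtain ⟨rfl, rfl⟩ := hi
      refine constant_on_column hg (by omega) fun w h1 h2 => ?_
      rw [hocc]
      rcases lt_or_ge w 0 with hw | hw
      · exact Or.inl hw
      · exact Or.inr ⟨⟨w.toNat, by omega⟩, by simp [hw]⟩
  contracted _ := rfl
  state _ := rfl
  flags _ := rfl

end

variable {A : Algorithm} {n : ℕ}

/-- A fair execution is obtained by serving the particles in turn. -/
theorem exists_fair_execution (c : Config A n) : ∃ e : Execution A n, e.Fair ∧ e.conf 0 = c := by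
  classical
  obtain ⟨f, hf0, -, hf⟩ := exists_seq (fun _ _ => True)
    (fun t (c c' : Config A n) => ∃ o : Option (Action n), (∀ a, o = some a → Step c a c') ∧
      (o = none → (∀ a c'', ¬ Step c a c'') ∧ c' = c) ∧
      ∀ p : Fin n, p.val = t % n → (∃ a c'', Step c a c'' ∧ p ∈ a.affects) →
        ∃ a, o = some a ∧ p ∈ a.affects) (x₀ := c) trivial (by
    intro t c _
    by_cases h1 : ∃ p : Fin n, p.val = t % n ∧ ∃ a c', Step c a c' ∧ p ∈ a.affects
    · obtain ⟨p, hp, a, c', hst, hpa⟩ := h1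
      refine ⟨c', trivial, some a, ?_, fun h => (by cases h), fun q hq _ => ⟨a, rfl, ?_⟩⟩
      · rintro _ ⟨⟩; exact hst
      · rwa [Fin.ext (hq.trans hp.symm)]
    by_cases h2 : ∃ a c', Step c a c'
    · obtain ⟨a, c', hst⟩ := h2
      refine ⟨c', trivial, some a, ?_, fun h => (by cases h),
        fun p hp hpa => absurd ⟨p, hp, hpa⟩ h1⟩
      rintro _ ⟨⟩; exact hst
    · exact ⟨c, trivial, none, fun a h => (by cases h),
        fun _ => ⟨fun a c' hst => h2 ⟨a, c', hst⟩, rfl⟩, fun p hp hpa => absurd ⟨p, hp, hpa⟩ h1⟩)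
  choose o ho1 ho2 ho3 using hf
  refine ⟨⟨f, o, ho1, ho2⟩, fun p t => ?_, hf0⟩
  have hn : 1 ≤ n := by have := p.2; omega
  refine ⟨t * n + p, by nlinarith, ?_⟩
  by_cases h : ∃ a c', Step (f (t * n + p)) a c' ∧ p ∈ a.affects
  · exact Or.inl (ho3 _ p (by rw [Nat.mul_add_mod_self_right, Nat.mod_eq_of_lt p.2]) h)
  · exact Or.inr h

/-- The height of a particle over the half-plane, summed over its head and its tail. -/
def Particle.height (x : Particle A) : ℤ := x.tail.2 + x.head.2

def Config.height (c : Config A n) : ℤ := ∑ p, (c.part p).height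

theorem Config.height_le_update (c : Config A n) (p : Fin n) (x : Particle A) {k : ℤ}
    (h : (c.part p).height ≤ x.height + k) : c.height ≤ (c.update p x).height + k := by
  classical
  have : c.height ≤ ∑ r, (((c.update p x).part r).height + if r = p then k else 0) := by
    refine Finset.sum_le_sum fun r _ => ?_
    by_cases hr : r = p
    · subst hr
      simpa [Config.update] using h
    · simp [Config.update, hr]
  rwa [Finset.sum_add_distrib, Finset.sum_ite_eq', if_pos (Finset.mem_univ p)] at this

theorem dir_snd_le : ∀ k : Dir, -1 ≤ (dir k).2 ∧ (dir k).2 ≤ 1 := by decide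

theorem Particle.height_le_expand (x : Particle A) (t : Turn A.Q A.Flag) (k : Dir)
    (hx : x.ext = none) : x.height ≤ Particle.height { x.assume t with ext := some k } + 1 := by
  have h1 := x.head_of_contracted hx
  have h2 := dir_snd_le k
  have h3 : Particle.height { x.assume t with ext := some k } =
    x.tail.2 + (x.tail.2 + (dir k).2) := rfl
  rw [h3, Particle.height, h1]
  omega

theorem Particle.height_le_contract (x : Particle A) (t : Turn A.Q A.Flag) {i : Fin 10}
    {u v : Node} (hx : x.ContractsTo i u v) :
    x.height ≤ Particle.height { x.assume t with tail := u, ext := none } + 1 := by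
  obtain ⟨a, ha, h⟩ := hx
  have h1 : x.head.2 = x.tail.2 + (dir a).2 := by rw [x.head_of_expanded ha]; rfl
  have h2 := dir_snd_le a
  have h3 : Particle.height { x.assume t with tail := u, ext := none } = u.2 + u.2 := rfl
  rw [h3, Particle.height]
  rcases h with ⟨-, rfl, -⟩ | ⟨-, rfl, -⟩ <;> omega

theorem Step.height_le {c c' : Config A n} {a : Action n} (h : Step c a c') :
    c.height ≤ c'.height + a.movements := by
  rcases h with ⟨p, t⟩ | ⟨p, t, i, k, -, -, he⟩ | ⟨p, t, i, u, v, -, -, hc⟩ |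
    ⟨p, q, hpq, t, s, i, j, u, k, -, -, -, -, he, hc⟩
  · exact c.height_le_update p _ (k := (0 : ℕ)) (by simp [Particle.height, Particle.assume, Particle.head])
  · exact c.height_le_update p _ ((c.part p).height_le_expand t k he.1)
  · exact c.height_le_update p _ ((c.part p).height_le_contract t hc)
  · have h1 := c.height_le_update p _ ((c.part p).height_le_contract t hc)
    have h2 := (c.update p { (c.part p).assume t with tail := u, ext := none }).height_le_update q
      { (c.part q).assume s with ext := some k } (k := 1) (by
        have : (c.update p { (c.part p).assume t with tail := u, ext := none }).part q =
          c.part q := Function.update_of_ne hpq.symm _ _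
        rw [this]
        exact (c.part q).height_le_expand s k he.1)
    have h3 : (((Action.handover p q).movements : ℕ) : ℤ) = 2 := rfl
    rw [h3]
    omega

theorem Step.obj_eq {c c' : Config A n} {a : Action n} (h : Step c a c') : c'.obj = c.obj := by
  cases h <;> rfl

theorem Execution.obj_eq (e : Execution A n) (t : ℕ) : (e.conf t).obj = (e.conf 0).obj := by
  induction t with
  | zero => rfl
  | succ t ih =>
    rcases ha : e.act t with _ | a
    · rw [(e.halt t ha).2, ih]
    · rw [(e.step t a ha).obj_eq, ih]

theorem Execution.height_le (e : Execution A n) (T : ℕ) : (e.conf 0).height ≤ (e.conf T).height +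
    ((∑ t ∈ Finset.range T, (e.act t).elim 0 Action.movements : ℕ) : ℤ) := by
  induction T with
  | zero => simp
  | succ T ih =>
    rw [Finset.sum_range_succ]
    rcases ha : e.act T with _ | a
    · rw [(e.halt T ha).2]
      simpa using ih
    · have := (e.step T a ha).height_le
      rw [Option.elim_some]
      push_cast at ih ⊢
      linarith

theorem lineConfig_height (A : Algorithm) (n : ℕ) :
    (lineConfig A n).height = (n : ℤ) * (n - 1) := by
  have h : ∀ i : Fin n, ((lineConfig A n).part i).height = 2 * ((i : ℕ) : ℤ) := fun i => by
    have : ((lineConfig A n).part i).height = ((i : ℕ) : ℤ) + ((i : ℕ) : ℤ) := rfl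
    rw [this]; ring
  rw [Config.height, Finset.sum_congr rfl fun i _ => h i,
    Fin.sum_univ_eq_sum_range (fun i => 2 * (i : ℤ)) n]
  induction n with
  | zero => simp
  | succ n ih =>
    rw [Finset.sum_range_succ, ih fun i => by
      have : ((lineConfig A n).part i).height = ((i : ℕ) : ℤ) + ((i : ℕ) : ℤ) := rfl
      rw [this]; ring]
    push_cast; ring

theorem Config.Goal.height_eq_zero {c : Config A n} (h : c.Goal) (hobj : c.obj = halfPlane) :
    c.height = 0 := by
  refine Finset.sum_eq_zero fun p _ => ?_
  have hd := Set.disjoint_left.mp (h.disjointed.1 p) (Particle.tail_mem_nodes _)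
  obtain ⟨v, hv, w, hw, k, rfl⟩ := h.onSurface p
  rw [hobj] at hw hd
  rw [Particle.nodes_of_contracted _ (h.contracted p), Set.mem_singleton_iff] at hv
  subst hv
  rw [Particle.height, Particle.head_of_contracted _ (h.contracted p)]
  have h1 : (c.part p).tail.2 + (dir k).2 < 0 := hw
  have h2 : ¬ (c.part p).tail.2 < 0 := hd
  have h3 := dir_snd_le k
  omega

/-- The particles of a line that leads away from the half-plane have to descend to the surface,
which takes `n * (n - 1)` movements in total. -/
theorem sq_le_worstCaseWork (hA : Solves A) (hn : 2 ≤ n) :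
    (n : ℕ∞) ^ 2 ≤ ((2 : ℕ) : ℕ∞) * worstCaseWork A n := by
  obtain ⟨e, hfair, he⟩ := exists_fair_execution (lineConfig A n)
  have hproper : e.Proper := ⟨hfair, by rw [he]; exact lineConfig_initial A n⟩
  obtain ⟨-, ⟨T, hT⟩, hgoal⟩ := hA n e hproper
  have h0 := (hgoal T hT).height_eq_zero (by rw [e.obj_eq, he]; rfl)
  have h1 := e.height_le T
  rw [h0, he, lineConfig_height, zero_add] at h1
  set W := ∑ t ∈ Finset.range T, (e.act t).elim 0 Action.movements
  have h2 : n ^ 2 ≤ 2 * W := by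
    have : (2 : ℤ) ≤ n := by exact_mod_cast hn
    zify
    nlinarith
  have h3 : (W : ℕ∞) ≤ worstCaseWork A n :=
    (le_iSup (fun T : ℕ =>
      ((∑ t ∈ Finset.range T, (e.act t).elim 0 Action.movements : ℕ) : ℕ∞)) T).trans
      (le_iSup₂ (f := fun (e : Execution A n) (_ : e.Proper) => e.work) e hproper)
  calc (n : ℕ∞) ^ 2 ≤ ((2 : ℕ) : ℕ∞) * (W : ℕ∞) := by exact_mod_cast h2
    _ ≤ _ := by gcongr

end Amoebot

theorem theorem2 :
    ∃ k K : ℕ, 0 < k ∧ 0 < K ∧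
      (∀ pick : Finset (Fin 10) → Fin 10, (∀ S : Finset (Fin 10), S.Nonempty → pick S ∈ S) →
        Amoebot.Solves (Amoebot.coating pick) ∧
        (∀ n : ℕ, Amoebot.worstCaseWork (Amoebot.coating pick) n ≤ (K : ℕ∞) * (n : ℕ∞) ^ 2) ∧
        (∀ n : ℕ, 2 ≤ n →
          (n : ℕ∞) ^ 2 ≤ (k : ℕ∞) * Amoebot.worstCaseWork (Amoebot.coating pick) n)) ∧
      (∀ A : Amoebot.Algorithm, Amoebot.Solves A → ∀ n : ℕ, 2 ≤ n →
        (n : ℕ∞) ^ 2 ≤ (k : ℕ∞) * Amoebot.worstCaseWork A n) :=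
  ⟨2, 12, by norm_num, by norm_num, fun _ hpick => ⟨Amoebot.Coating.solves hpick,
    Amoebot.Coating.worstCaseWork_le hpick,
    fun _ hn => Amoebot.sq_le_worstCaseWork (Amoebot.Coating.solves hpick) hn⟩,
    fun _ hA _ hn => Amoebot.sq_le_worstCaseWork hA hn⟩
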